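/- **Setting.** In a finite undirected (multi)graph $G=(\mathcal V,\mathcal E)$ a *finite path* $\sigma$ is a finite walk, from its entrance $\mathrm{ent}(\sigma)$ to its exit $\mathrm{exi}(\sigma)$ (trivial paths of length $0$ are allowed); $n(\sigma,e)$ is the number of times $\sigma$ traverses the edge $e$, in either direction. A *path-flow* is a finite nonnegative measure $\mu$ on the set of finite paths. Its *transportation measure* $\mathrm{tra}(\mu)$ is the push-forward of $\mu$ under $\sigma\mapsto(\mathrm{ent}(\sigma),\mathrm{exi}(\sigma))$, and its *flow-volume* is $\mathrm{flo}(\mu)=\big(\int n(\sigma,e)\,\mu(d\sigma)\big)_{e\in\mathcal E}$. An *environment* is a family $\mathbf c=(c(e))_{e\in\mathcal E}$ of nonnegative reals, and $\mathrm{cost}(\mathbf f,\mathbf c)=\sum_{e}c(e)f(e)^2$. Let $\kappa$ be a probability distribution with $\kappa[0,c^*]=1$ for some $0<c^*<\infty$, and let $B>\frac14$. **Torus.** The $N\times N$ torus has vertex set $[0,N-1]^2$ and $2N^2$ edges, one from each $(i,j)$ to $(i+1,j)$ and one from each $(i,j)$ to $(i,j+1)$, modulo $N$. A *standardized global flow*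 is the flow-volume of a path-flow $\mu$ on it with $\mathrm{tra}(\mu)(v,w)=N^{-3}$ for all vertices $v,w$. On the torus $\mathbb E$ is the expectation when the $c(e)$ are i.i.d. with law $\kappa$. **Square.** For $M\ge1$ the *extended $M\times M$ square* consists of the lattice square $[0,M-1]^2$ with its nearest-neighbour edges, and of $4M$ boundary points $(-\frac12,j)$, $(M-\frac12,j)$, $(i,-\frac12)$, $(i,M-\frac12)$ with $0\le i,j\le M-1$ (left, right, bottom, top), each joined by a half-edge to the nearest vertex of the square. Let $\mathrm{Bou}_M$ be the set of boundary points and $b\mapsto b^{\mathrm{reflect}}$ the reflection of $\mathrm{Bou}_M$ exchanging left with right and bottom with top. Let $\mathcal Q_M$ be the set of finite measures $Q$ on $\mathrm{Bou}_M\times\mathrm{Bou}_M$ such that the push-forward of the second (exit) marginal under $b\mapsto b^{\mathrm{reflect}}$ equals the first (entrance) marginal, and put $$\mathrm{drift}(Q)=\frac1{M^2}\sum_{b_1,b_2}(b_2-b_1)\,Q(b_1,b_2)\in\mathbb R^2 .$$ Let $\mathcal Q_M^{\mathrm{iso}}$ be the set of finite measures $Q_0=\int Q\,\psi(dQ)$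 where $\psi$ is a probability distribution on $\mathcal Q_M$ under which $\mathrm{drift}(Q)$ modulo $(1,1)$ is uniformly distributed on $[0,1]^2$. For a finite measure $Q$ on $\mathrm{Bou}_M\times\mathrm{Bou}_M$ let $$\mathrm{cost}_{M,B}(Q,\mathbf c)=\inf\{\mathrm{cost}(\mathrm{flo}(\mu),\mathbf c):\ \mathrm{tra}(\mu)=Q,\ \max_e\mathrm{flo}(\mu)(e)\le B\}$$ over path-flows $\mu$ on the extended square ($\inf\emptyset=\infty$), and $$c_{M,B}=\inf\{\mathbb E\,\mathrm{cost}_{M,B}(Q,\mathbf c):\ Q\in\mathcal Q_M^{\mathrm{iso}}\},$$ where here the $c(e)$ are i.i.d. with law $\kappa$ over the internal edges and the half-edges on the left and bottom sides, and $c(e)=0$ on the half-edges on the right and top sides. **Proposition 17.** There exist, for all $N$ and all environments $\mathbf c$ on the $N\times N$ torus, standardized global flows $\mathbf f(\cdot\mid\mathbf c)$ on the $N\times N$ torus, depending measurably on $\mathbf c$, such that $\max_e f(e\mid\mathbf c)\le B$ and such that, for each fixed $M\ge1$, $$\limsup_{N\to\infty}N^{-2}\,\mathbb E\,\mathrm{cost}(\mathbf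 f(\cdot\mid\mathbf c),\mathbf c)\le M^{-2}c_{M,B}.$$ -/

import Mathlib

open MeasureTheory Filter
open scoped NNReal ENNReal

namespace RoutingFlow

noncomputable section

/-! ### Paths, path-flows, flow-volumes and costs on a finite multigraph -/

section General

variable {V E : Type}

/-- The multigraph on all of `V` whose edge `e` joins the two components of `ends e`.
Edges are undirected: the order of the two ends plays no role. -/
def graphOfEnds (ends : E → V × V) : Graph V E where
  vertexSet := Set.univ
  IsLink e x y := ends e = (x, y) ∨ ends e = (y, x)
  isLink_symm := fun _ _ => ⟨fun _ _ h => h.symm⟩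
  eq_or_eq_of_isLink_of_isLink := by
    rintro e x y v w (h | h) (h' | h') <;> rw [h] at h' <;> simp only [Prod.mk.injEq] at h' <;> tauto
  left_mem_of_isLink := fun _ _ _ _ => trivial

/-- Finite paths `u = v₀, e₁, v₁, …, e_k, v_k = w` in `G` from `u` to `w`. -/
inductive PathFromTo (G : Graph V E) : V → V → Type
  | nil (v : V) (hv : v ∈ G.vertexSet) : PathFromTo G v v
  | cons {u v w : V} (e : E) (h : G.IsLink e u v) (p : PathFromTo G v w) : PathFromTo G u w

/-- The list of edges of a path, in order of traversal. -/
def PathFromTo.edges {G : Graph V E} : {u w : V} → PathFromTo G u w → List E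
  | _, _, .nil _ _ => []
  | _, _, .cons e _ p => e :: p.edges

/-- The set `Σ` of all finite paths of `G`. -/
structure FinPath (G : Graph V E) where
  /-- the entrance (source) -/
  ent : V
  /-- the exit (destination) -/
  exi : V
  /-- the path itself -/
  path : PathFromTo G ent exi

/-- The path space is discrete (it is countable whenever the graph is finite). -/
instance (G : Graph V E) : MeasurableSpace (FinPath G) := ⊤

open Classical in
/-- `n(σ, e)`: the number of times that `e` occurs, in either direction, in `σ`. -/
def FinPath.n {G : Graph V E} (σ : FinPath G) (e : E) : ℕ := σ.path.edges.count e

/-- The transportation measure `tra(μ)`, given by its point masses: the mass at `(v, w)` of the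
push-forward of `μ` under `σ ↦ (ent σ, exi σ)`. -/
def tra {G : Graph V E} (μ : Measure (FinPath G)) (v w : V) : ℝ≥0∞ :=
  μ {σ | σ.ent = v ∧ σ.exi = w}

/-- The flow-volume `flo(μ)`. -/
def flo {G : Graph V E} (μ : Measure (FinPath G)) (e : E) : ℝ≥0∞ :=
  ∫⁻ σ, (σ.n e : ℝ≥0∞) ∂μ

/-- The cost `∑ₑ c(e) f(e)²` of the flow-volume `f` in the environment `c`. -/
def cost [Fintype E] (f : E → ℝ≥0∞) (c : E → ℝ≥0) : ℝ≥0∞ :=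
  ∑ e, (c e : ℝ≥0∞) * f e ^ 2

end General

/-! ### The `N × N` torus -/

/-- Vertices `[0, N-1]²` of the torus. -/
abbrev TorusVertex (N : ℕ) : Type := Fin N × Fin N

/-- The `2N²` edges of the torus: `inl (i, j)` is the edge from `(i, j)` to `(i+1, j)` and
`inr (i, j)` the edge from `(i, j)` to `(i, j+1)`, modulo `N`. -/
abbrev TorusEdge (N : ℕ) : Type := (Fin N × Fin N) ⊕ (Fin N × Fin N)

/-- `i + 1` modulo `N`. -/
def cyclicSucc {N : ℕ} (i : Fin N) : Fin N := ⟨(i.val + 1) % N, Nat.mod_lt _ i.pos⟩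

/-- The two ends of an edge of the torus. -/
def torusEnds (N : ℕ) : TorusEdge N → TorusVertex N × TorusVertex N
  | .inl (i, j) => ((i, j), (cyclicSucc i, j))
  | .inr (i, j) => ((i, j), (i, cyclicSucc j))

/-- The discrete torus. For `N ≥ 3` it is a simple graph; for `N = 2` it has double edges and for
`N = 1` loops, so that it always has `2N²` edges. -/
def torus (N : ℕ) : Graph (TorusVertex N) (TorusEdge N) := graphOfEnds (torusEnds N)

/-- `f` is the flow-volume of a path-flow (a finite measure on paths) which carries volume `N⁻³`
between every source-destination pair. -/
def IsStandardizedGlobalFlow (N : ℕ) (f : TorusEdge N → ℝ≥0∞) : Prop :=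
  ∃ μ : Measure (FinPath (torus N)), IsFiniteMeasure μ ∧
    (∀ v w : TorusVertex N, tra μ v w = ((N : ℝ≥0∞) ^ 3)⁻¹) ∧ f = flo μ

/-- The law of the i.i.d. (`κ`) environment on the torus. -/
def torusEnvLaw (κ : Measure ℝ≥0) (N : ℕ) : Measure (TorusEdge N → ℝ≥0) :=
  Measure.pi fun _ => κ

/-! ### The extended `M × M` square -/

/-- The four sides of the square. -/
inductive Side
  | left | right | bottom | top
  deriving DecidableEq

instance : Fintype Side := ⟨{.left, .right, .bottom, .top}, by rintro (_ | _ | _ | _) <;> decide⟩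

/-- The opposite side. -/
def Side.opposite : Side → Side
  | .left => .right
  | .right => .left
  | .bottom => .top
  | .top => .bottom

/-- The `4M` boundary points: a side, and a position along that side. -/
abbrev Bou (M : ℕ) : Type := Side × Fin M

/-- The coordinates of a boundary point: `(-1/2, j)`, `(M - 1/2, j)`, `(i, -1/2)` or
`(i, M - 1/2)`. -/
def Bou.pos {M : ℕ} : Bou M → ℝ × ℝ
  | (.left, j) => (-1 / 2, (j : ℕ))
  | (.right, j) => ((M : ℝ) - 1 / 2, (j : ℕ))
  | (.bottom, i) => ((i : ℕ), -1 / 2)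
  | (.top, i) => ((i : ℕ), (M : ℝ) - 1 / 2)

/-- Reflection of a boundary point left-to-right or top-to-bottom. -/
def Bou.reflect {M : ℕ} (b : Bou M) : Bou M := (b.1.opposite, b.2)

/-- The vertex of the `M × M` square to which a boundary point is attached. -/
def Bou.inner {M : ℕ} : Bou M → Fin M × Fin M
  | (.left, j) => (⟨0, j.pos⟩, j)
  | (.right, j) => (⟨M - 1, Nat.sub_lt j.pos Nat.one_pos⟩, j)
  | (.bottom, i) => (i, ⟨0, i.pos⟩)
  | (.top, i) => (i, ⟨M - 1, Nat.sub_lt i.pos Nat.one_pos⟩)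

/-- Vertices of the extended square: internal vertices (`inl`) and boundary points (`inr`). -/
abbrev SquareVertex (M : ℕ) : Type := (Fin M × Fin M) ⊕ Bou M

/-- Edges of the extended square: `inl (inl (i, j))` joins `(i, j)` and `(i+1, j)`,
`inl (inr (i, j))` joins `(i, j)` and `(i, j+1)`, and `inr b` is the half-edge ending at the
boundary point `b`. -/
abbrev SquareEdge (M : ℕ) : Type :=
  ((Fin (M - 1) × Fin M) ⊕ (Fin M × Fin (M - 1))) ⊕ Bou M

/-- The two ends of an edge of the extended square. -/
def squareEnds (M : ℕ) : SquareEdge M → SquareVertex M × SquareVertex M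
  | .inl (.inl (i, j)) =>
      (.inl (⟨i.val, by have := i.isLt; omega⟩, j), .inl (⟨i.val + 1, by have := i.isLt; omega⟩, j))
  | .inl (.inr (i, j)) =>
      (.inl (i, ⟨j.val, by have := j.isLt; omega⟩), .inl (i, ⟨j.val + 1, by have := j.isLt; omega⟩))
  | .inr b => (.inr b, .inl b.inner)

/-- The extended `M × M` square. -/
def square (M : ℕ) : Graph (SquareVertex M) (SquareEdge M) := graphOfEnds (squareEnds M)

/-- A (finite) transportation measure on `Bou_M × Bou_M`, given by its point masses. -/
abbrev Transport (M : ℕ) : Type := Bou M → Bou M → ℝ≥0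

/-- The entrance marginal. -/
def Transport.entMarginal {M : ℕ} (Q : Transport M) (b : Bou M) : ℝ≥0 := ∑ b', Q b b'

/-- The exit marginal. -/
def Transport.exiMarginal {M : ℕ} (Q : Transport M) (b : Bou M) : ℝ≥0 := ∑ b', Q b' b

/-- `𝒬_M`: the push-forward of the exit marginal under `b ↦ b.reflect` is the entrance marginal. -/
def balanced (M : ℕ) : Set (Transport M) :=
  {Q | ∀ b : Bou M, ∑ b' with b'.reflect = b, Q.exiMarginal b' = Q.entMarginal b}

/-- `drift(Q) = M⁻² ∑ (b₂ - b₁) Q(b₁, b₂)`. -/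
def drift {M : ℕ} (Q : Transport M) : ℝ × ℝ :=
  ((M : ℝ) ^ 2)⁻¹ • ∑ b₁ : Bou M, ∑ b₂ : Bou M, (Q b₁ b₂ : ℝ) • (b₂.pos - b₁.pos)

/-- `drift(Q)` modulo `(1, 1)`, as a point of `[0, 1)²`. -/
def driftMod {M : ℕ} (Q : Transport M) : ℝ × ℝ := (Int.fract (drift Q).1, Int.fract (drift Q).2)

/-- The isotropic transportation measures: mixtures `Q₀ = ∫ Q ψ(dQ)` for a probability law `ψ` on
`𝒬_M` under which `drift(Q)` modulo `(1, 1)` is uniform on the unit square. -/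
def isotropic (M : ℕ) : Set (Transport M) :=
  {Q₀ | ∃ ψ : Measure (Transport M), IsProbabilityMeasure ψ ∧
    (∀ᵐ Q ∂ψ, Q ∈ balanced M) ∧
    (∀ b₁ b₂ : Bou M, (Q₀ b₁ b₂ : ℝ≥0∞) = ∫⁻ Q, (Q b₁ b₂ : ℝ≥0∞) ∂ψ) ∧
    ψ.map driftMod = volume.restrict (Set.Icc (0 : ℝ) 1 ×ˢ Set.Icc (0 : ℝ) 1)}

/-- A transportation measure on `Bou_M × Bou_M`, regarded as a measure (by its point masses) on
pairs of vertices of the extended square. -/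
def Transport.extend {M : ℕ} (Q : Transport M) : SquareVertex M → SquareVertex M → ℝ≥0∞
  | .inr b₁, .inr b₂ => Q b₁ b₂
  | _, _ => 0

/-- `cost_{M,B}(Q, c)`: the infimum of the cost over all path-flows across the extended square with
transportation measure `Q` and all edge-flows at most `B`; it is `∞` if there are none. -/
def squareCost (M : ℕ) (B : ℝ≥0) (Q : Transport M) (c : SquareEdge M → ℝ≥0) : ℝ≥0∞ :=
  ⨅ μ ∈ {μ : Measure (FinPath (square M)) |
      IsFiniteMeasure μ ∧ (∀ v w, tra μ v w = Q.extend v w) ∧ ∀ e, flo μ e ≤ B},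
    cost (flo μ) c

/-- The law of the random environment on the extended square: independent cost-factors with law `κ`
on internal edges and on the half-edges on the left and bottom sides, and cost-factor `0` on the
half-edges on the right and top sides. -/
def squareEnvLaw (κ : Measure ℝ≥0) (M : ℕ) : Measure (SquareEdge M → ℝ≥0) :=
  Measure.pi fun e => match e with
    | .inl _ => κ
    | .inr (.left, _) => κ
    | .inr (.bottom, _) => κ
    | .inr (.right, _) => Measure.dirac 0
    | .inr (.top, _) => Measure.dirac 0

/-- The constant `c_{M,B}`: the infimum of `𝔼 cost_{M,B}(Q, c)` over isotropic `Q`. -/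
def localCost (κ : Measure ℝ≥0) (B : ℝ≥0) (M : ℕ) : ℝ≥0∞ :=
  ⨅ Q ∈ isotropic M, ∫⁻ c, squareCost M B Q c ∂(squareEnvLaw κ M)

end

end RoutingFlow

/-!
Cut the `N × N` torus into `⌊N / M⌋²` squares of side `M`. For an isotropic `Q₀` of nearly minimal
expected cost, use in each square a nearly optimal path-flow with transportation measure `Q₀` for
the environment in that square. The squares share no edge and their environments have the law of the
environment on one extended square, so the expected cost is `⌊N / M⌋²` times the local one.

To join these path-flows to a global flow, write `Q₀` as a mixture of balanced measures `Q`. By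
Birkhoff's theorem `Q` is, up to a bounded number of mismatches, the count of the steps of a long
itinerary in which every step enters the next square where the preceding step left the last one.
Started in a uniformly chosen square, the itinerary uses all squares equally, and it ends at a
displacement of about `N • drift Q` from its start. As the drift is uniform modulo `(1, 1)`, each
pair `(v, w)` of vertices can be assigned those `Q` whose drift lies in the same cell of a fine
partition of the unit square as `(w - v) / N`, so that the itinerary started at `v` ends close to
`w`.

Mismatches and missed endpoints are repaired by shortest routes of total volume `o(N²)`. Averaging
over all translations of the torus spreads this volume evenly over the edges, and costs nothing by
convexity and stationarity. Finally a small proportion of the flow is replaced by routing along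
shortest paths, whose flow per edge is at most `1 / 4 < B`, which brings all edge-flows below `B`.
-/

namespace RoutingFlow

noncomputable section

/-! ### Unit flows -/

section UnitFlows

variable {V E V' E' : Type} {G : Graph V E} {G' : Graph V' E'}

open Classical in
/-- The number of traversals of the edge `e` by the path `p`, in either direction. -/
def PathFromTo.count {u w : V} (p : PathFromTo G u w) (e : E) : ℕ := p.edges.count e

lemma PathFromTo.count_nil (v : V) (hv : v ∈ G.vertexSet) (e : E) :
    (PathFromTo.nil (G := G) v hv).count e = 0 := rfl

open Classical in
lemma PathFromTo.count_cons {u v w : V} (a : E) (h : G.IsLink a u v) (p : PathFromTo G v w)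
    (e : E) : (PathFromTo.cons a h p).count e = p.count e + if a = e then 1 else 0 := by
  simp [PathFromTo.count, PathFromTo.edges, List.count_cons]

/-- Concatenation of paths. -/
def PathFromTo.append {u v w : V} : PathFromTo G u v → PathFromTo G v w → PathFromTo G u w
  | .nil _ _, q => q
  | .cons e h p, q => .cons e h (p.append q)

lemma PathFromTo.count_append {u v w : V} (p : PathFromTo G u v) (q : PathFromTo G v w) (e : E) :
    (p.append q).count e = p.count e + q.count e := by
  induction p with
  | nil => simp [PathFromTo.append, PathFromTo.count_nil]
  | cons a h p ih => simp only [PathFromTo.append, PathFromTo.count_cons, ih]; ring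

/-- The same path, traversed backwards. -/
def PathFromTo.reverse {u v : V} : PathFromTo G u v → PathFromTo G v u
  | .nil v hv => .nil v hv
  | .cons e h p => p.reverse.append (.cons e h.symm (.nil _ h.left_mem))

lemma PathFromTo.count_reverse {u v : V} (p : PathFromTo G u v) (e : E) :
    p.reverse.count e = p.count e := by
  induction p with
  | nil => rfl
  | cons a h p ih =>
    simp [PathFromTo.reverse, PathFromTo.count_append, PathFromTo.count_cons,
      PathFromTo.count_nil, ih]

/-- `f` is the flow-volume of a probability distribution on the paths from `v` to `w`. The
distribution is encoded by an indexed family of weighted paths, so that unit flows can be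
concatenated and mixed without merging equal paths. -/
def IsUnitFlow (G : Graph V E) (v w : V) (f : E → ℝ≥0∞) : Prop :=
  ∃ (ι : Type) (p : ι → ℝ≥0∞) (γ : ι → PathFromTo G v w),
    ∑' i, p i = 1 ∧ ∀ e, ∑' i, p i * ((γ i).count e : ℝ≥0∞) = f e

lemma PathFromTo.isUnitFlow {v w : V} (p : PathFromTo G v w) :
    IsUnitFlow G v w fun e => (p.count e : ℝ≥0∞) :=
  ⟨Unit, fun _ => 1, fun _ => p, by simp, by simp⟩

lemma IsUnitFlow.refl {v : V} (hv : v ∈ G.vertexSet) : IsUnitFlow G v v 0 := by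
  convert (PathFromTo.nil (G := G) v hv).isUnitFlow using 1
  ext e
  simp [PathFromTo.count_nil]

lemma IsUnitFlow.of_isLink [DecidableEq E] {e : E} {u v : V} (h : G.IsLink e u v) :
    IsUnitFlow G u v (Pi.single e 1) := by
  convert (PathFromTo.cons e h (.nil v h.right_mem)).isUnitFlow using 1
  ext e'
  rw [PathFromTo.count_cons, PathFromTo.count_nil]
  rcases eq_or_ne e e' with rfl | he
  · simp
  · simp [he, he.symm]

lemma IsUnitFlow.symm {v w : V} {f : E → ℝ≥0∞} (hf : IsUnitFlow G v w f) :
    IsUnitFlow G w v f := by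
  obtain ⟨ι, p, γ, hp, hf⟩ := hf
  exact ⟨ι, p, fun i => (γ i).reverse, hp, by simpa only [PathFromTo.count_reverse]⟩

lemma IsUnitFlow.trans {u v w : V} {f g : E → ℝ≥0∞} (hf : IsUnitFlow G u v f)
    (hg : IsUnitFlow G v w g) : IsUnitFlow G u w (f + g) := by
  obtain ⟨ι, p, γ, hp, hf⟩ := hf
  obtain ⟨κ, q, δ, hq, hg⟩ := hg
  refine ⟨ι × κ, fun x => p x.1 * q x.2, fun x => (γ x.1).append (δ x.2), ?_, fun e => ?_⟩
  · rw [ENNReal.tsum_prod (f := fun i j => p i * q j)]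
    simp [ENNReal.tsum_mul_left, hp, hq]
  · have first : ∑' x : ι × κ, (p x.1 * (γ x.1).count e) * q x.2 = f e := by
      rw [ENNReal.tsum_prod (f := fun i j => (p i * (γ i).count e) * q j)]
      simp [ENNReal.tsum_mul_left, hq, hf]
    have second : ∑' x : ι × κ, p x.1 * (q x.2 * (δ x.2).count e) = g e := by
      rw [ENNReal.tsum_prod (f := fun i j => p i * (q j * (δ j).count e))]
      simp [ENNReal.tsum_mul_left, ENNReal.tsum_mul_right, hp, hg]
    rw [Pi.add_apply, ← first, ← second, ← ENNReal.tsum_add]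
    refine tsum_congr fun x => ?_
    rw [PathFromTo.count_append]
    push_cast
    ring

lemma IsUnitFlow.sum {J : Type} [Fintype J] {v w : V} {m : J → ℝ≥0∞} {f : J → E → ℝ≥0∞}
    (hm : ∑ j, m j = 1) (hf : ∀ j, IsUnitFlow G v w (f j)) :
    IsUnitFlow G v w fun e => ∑ j, m j * f j e := by
  choose ι p γ hp hf using hf
  refine ⟨Σ j, ι j, fun x => m x.1 * p x.1 x.2, fun x => γ x.1 x.2, ?_, fun e => ?_⟩
  · rw [ENNReal.tsum_sigma (f := fun j i => m j * p j i)]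
    simp [ENNReal.tsum_mul_left, hp, hm]
  · beta_reduce
    rw [← tsum_fintype (L := SummationFilter.unconditional _)]
    rw [ENNReal.tsum_sigma (f := fun j i => m j * p j i * (γ j i).count e)]
    refine tsum_congr fun j => ?_
    rw [← hf, ← ENNReal.tsum_mul_left]
    exact tsum_congr fun i => by ring

open Classical in
/-- The image of the flow-volume `f` under a map `ε` of edges which contracts the edges in `S`. -/
def pushFlow [Fintype E] (S : Set E) (ε : E → E') (f : E → ℝ≥0∞) (e' : E') : ℝ≥0∞ :=
  ∑ e with e ∉ S ∧ ε e = e', f e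

open Classical in
lemma PathFromTo.exists_map [Fintype E] {φ : V → V'} {S : Set E} {ε : E → E'}
    (hV : ∀ v, φ v ∈ G'.vertexSet)
    (hS : ∀ e ∈ S, ∀ x y, G.IsLink e x y → φ x = φ y)
    (hε : ∀ e ∉ S, ∀ x y, G.IsLink e x y → G'.IsLink (ε e) (φ x) (φ y))
    {u w : V} (p : PathFromTo G u w) :
    ∃ p' : PathFromTo G' (φ u) (φ w),
      ∀ e', p'.count e' = ∑ e with e ∉ S ∧ ε e = e', p.count e := by
  induction p with
  | nil v hv => exact ⟨.nil _ (hV v), fun e' => by simp [PathFromTo.count_nil]⟩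
  | @cons u v w a h p ih =>
    obtain ⟨p', hp'⟩ := ih
    by_cases ha : a ∈ S
    · rw [hS a ha _ _ h]
      refine ⟨p', fun e' => ?_⟩
      rw [hp']
      refine Finset.sum_congr rfl fun e he => ?_
      rw [PathFromTo.count_cons, if_neg, add_zero]
      rintro rfl
      simp [ha] at he
    · refine ⟨.cons (ε a) (hε a ha _ _ h) p', fun e' => ?_⟩
      rw [PathFromTo.count_cons, hp']
      simp only [PathFromTo.count_cons, Finset.sum_add_distrib, Finset.sum_ite_eq]
      simp [ha]

lemma IsUnitFlow.map [Fintype E] {φ : V → V'} {S : Set E} {ε : E → E'}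
    (hV : ∀ v, φ v ∈ G'.vertexSet)
    (hS : ∀ e ∈ S, ∀ x y, G.IsLink e x y → φ x = φ y)
    (hε : ∀ e ∉ S, ∀ x y, G.IsLink e x y → G'.IsLink (ε e) (φ x) (φ y))
    {v w : V} {f : E → ℝ≥0∞} (hf : IsUnitFlow G v w f) :
    IsUnitFlow G' (φ v) (φ w) (pushFlow S ε f) := by
  classical
  obtain ⟨ι, p, γ, hp, hf⟩ := hf
  choose δ hδ using fun i => (γ i).exists_map hV hS hε
  refine ⟨ι, p, δ, hp, fun e' => ?_⟩
  unfold pushFlow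
  simp_rw [← hf, hδ, Nat.cast_sum, Finset.mul_sum]
  exact Summable.tsum_finsetSum fun _ _ => ENNReal.summable

/-- Total volume of a flow. -/
def vol [Fintype E] (f : E → ℝ≥0∞) : ℝ≥0∞ := ∑ e, f e

lemma vol_add [Fintype E] (f g : E → ℝ≥0∞) : vol (f + g) = vol f + vol g :=
  Finset.sum_add_distrib

end UnitFlows

section PathFlows

variable {V E : Type} {G : Graph V E}

open Classical in
lemma IsUnitFlow.exists_measure {v w : V} {f : E → ℝ≥0∞} (hf : IsUnitFlow G v w f) :
    ∃ μ : Measure (FinPath G), IsProbabilityMeasure μ ∧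
      (∀ a b, tra μ a b = if v = a ∧ w = b then 1 else 0) ∧ flo μ = f := by
  obtain ⟨ι, p, γ, hp, hf⟩ := hf
  let μ : Measure (FinPath G) := Measure.sum fun i => p i • Measure.dirac ⟨v, w, γ i⟩
  have hμ (s : Set (FinPath G)) : μ s = ∑' i, p i * s.indicator 1 (⟨v, w, γ i⟩ : FinPath G) := by
    have hs : MeasurableSet s := trivial
    simp [μ, Measure.sum_apply _ hs, Measure.dirac_apply' _ hs]
  refine ⟨μ, ⟨by simp [hμ, hp]⟩, fun a b => ?_, funext fun e => ?_⟩
  · rw [tra, hμ]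
    by_cases hab : v = a ∧ w = b <;> simp [hab, hp]
  · simp only [flo, μ, lintegral_sum_measure, lintegral_smul_measure, smul_eq_mul,
      lintegral_dirac' _ measurable_from_top, ← hf]
    rfl

lemma exists_measure_of_isUnitFlow [Fintype V] {T : V → V → ℝ≥0∞} {F : V → V → E → ℝ≥0∞}
    (hT : ∀ v w, T v w ≠ ∞) (hF : ∀ v w, IsUnitFlow G v w (F v w)) :
    ∃ μ : Measure (FinPath G), IsFiniteMeasure μ ∧ (∀ v w, tra μ v w = T v w) ∧
      flo μ = fun e => ∑ v, ∑ w, T v w * F v w e := by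
  classical
  choose μ _ hμ_tra hμ_flo using fun v w => (hF v w).exists_measure
  refine ⟨∑ v, ∑ w, T v w • μ v w, ⟨?_⟩, fun a b => ?_, funext fun e => ?_⟩
  · simpa [ENNReal.sum_lt_top] using fun v w => (hT v w).lt_top
  · have hμ_tra' (v w : V) : μ v w {σ | σ.ent = a ∧ σ.exi = b} = if v = a ∧ w = b then 1 else 0 :=
      hμ_tra v w a b
    simp [tra, hμ_tra', ite_and, Finset.sum_ite_eq', apply_ite]
  · simp [← hμ_flo, flo]

/-- The edges of a path together with the vertices that follow them, in order of traversal. Together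
with the entrance it determines the path. -/
def PathFromTo.trail : {u w : V} → PathFromTo G u w → List (E × V)
  | _, _, .nil _ _ => []
  | _, _, .cons (v := v) e _ p => (e, v) :: p.trail

lemma PathFromTo.finPath_eq_of_trail_eq {u w w' : V} (p : PathFromTo G u w)
    (q : PathFromTo G u w') (h : p.trail = q.trail) : (⟨u, w, p⟩ : FinPath G) = ⟨u, w', q⟩ := by
  induction p with
  | nil => cases q with
    | nil => rfl
    | cons => simp [PathFromTo.trail] at h
  | cons e _ p ih => cases q with
    | nil => simp [PathFromTo.trail] at h
    | cons _ _ q =>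
      simp only [PathFromTo.trail, List.cons.injEq, Prod.mk.injEq] at h
      obtain ⟨⟨rfl, rfl⟩, h⟩ := h
      have tails_eq := ih q h
      simp only [FinPath.mk.injEq, true_and] at tails_eq
      obtain ⟨rfl, hpq⟩ := tails_eq
      cases hpq
      rfl

instance [Countable V] [Countable E] : Countable (FinPath G) := by
  refine Function.Injective.countable (f := fun σ : FinPath G => (σ.ent, σ.path.trail)) ?_
  rintro ⟨u, w, p⟩ ⟨u', w', q⟩ h
  simp only [Prod.mk.injEq] at h
  obtain ⟨rfl, h⟩ := h
  exact p.finPath_eq_of_trail_eq q h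

/-- The paths from `v` to `w`, as a set of finite paths. -/
def pathsBetween (G : Graph V E) (v w : V) : Set (FinPath G) := {σ | σ.ent = v ∧ σ.exi = w}

lemma exists_count_eq_of_mem_pathsBetween {v w : V} {σ : FinPath G} (hσ : σ ∈ pathsBetween G v w) :
    ∃ γ : PathFromTo G v w, ∀ e, γ.count e = σ.n e := by
  obtain ⟨u, x, p⟩ := σ
  obtain ⟨rfl, rfl⟩ := hσ
  exact ⟨p, fun _ => rfl⟩

lemma isUnitFlow_cond [Countable V] [Countable E] (μ : Measure (FinPath G)) [IsFiniteMeasure μ]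
    {v w : V} (h0 : tra μ v w ≠ 0) :
    IsUnitFlow G v w fun e => (tra μ v w)⁻¹ * ∫⁻ σ in pathsBetween G v w, (σ.n e : ℝ≥0∞) ∂μ := by
  choose γ hγ using fun σ : pathsBetween G v w => exists_count_eq_of_mem_pathsBetween σ.2
  have hcount : (pathsBetween G v w).Countable := Set.to_countable _
  refine ⟨pathsBetween G v w, fun σ => (tra μ v w)⁻¹ * μ {σ.1}, γ, ?_, fun e => ?_⟩
  · have total : ∑' σ : pathsBetween G v w, μ {σ.1} = tra μ v w := by
      simpa [tra, pathsBetween] using (lintegral_countable (μ := μ) 1 hcount).symm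
    rw [ENNReal.tsum_mul_left, total]
    exact ENNReal.inv_mul_cancel h0 (measure_ne_top μ _)
  · beta_reduce
    rw [lintegral_countable _ hcount, ← ENNReal.tsum_mul_left]
    exact tsum_congr fun σ => by rw [hγ, mul_assoc, mul_comm (μ _)]

lemma sum_setLIntegral_pathsBetween_le_flo {β : Type} [Fintype β] {ι : β → V}
    (hι : ι.Injective) (μ : Measure (FinPath G)) (e : E) :
    ∑ a, ∑ b, ∫⁻ σ in pathsBetween G (ι a) (ι b), (σ.n e : ℝ≥0∞) ∂μ ≤ flo μ e := by
  classical
  have hdisj : Set.PairwiseDisjoint ((Finset.univ : Finset (β × β)) : Set (β × β))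
      fun x => pathsBetween G (ι x.1) (ι x.2) := by
    rintro ⟨a, b⟩ _ ⟨a', b'⟩ _ hne
    refine Set.disjoint_left.2 ?_
    rintro σ ⟨ha, hb⟩ ⟨ha', hb'⟩
    exact hne (Prod.ext (hι (ha.symm.trans ha')) (hι (hb.symm.trans hb')))
  rw [← Fintype.sum_prod_type', ← lintegral_biUnion_finset hdisj fun _ _ => trivial]
  exact setLIntegral_le_lintegral _ _

lemma exists_isUnitFlow_of_measure [Countable V] [Countable E] {β : Type} [Fintype β] {ι : β → V}
    (hι : ι.Injective) (μ : Measure (FinPath G)) [IsFiniteMeasure μ] :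
    ∃ g : β → β → E → ℝ≥0∞,
      (∀ a b, tra μ (ι a) (ι b) ≠ 0 → IsUnitFlow G (ι a) (ι b) (g a b)) ∧
      ∀ e, ∑ a, ∑ b, tra μ (ι a) (ι b) * g a b e ≤ flo μ e := by
  refine ⟨fun a b e => (tra μ (ι a) (ι b))⁻¹ *
    ∫⁻ σ in pathsBetween G (ι a) (ι b), (σ.n e : ℝ≥0∞) ∂μ, fun a b => isUnitFlow_cond μ,
    fun e => le_trans ?_ (sum_setLIntegral_pathsBetween_le_flo hι μ e)⟩
  gcongr with a _ b _
  rw [← mul_assoc]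
  exact mul_le_of_le_one_left' (ENNReal.mul_inv_le_one _)

end PathFlows

/-! ### Standardized flows and shortest routes on the torus -/

section StandardFlows

variable {N : ℕ}

/-- The superposition of the flows `F v w` from `v` to `w`, each with volume `N⁻³`. -/
def superpose (F : TorusVertex N → TorusVertex N → TorusEdge N → ℝ≥0∞) (e : TorusEdge N) : ℝ≥0∞ :=
  ∑ v, ∑ w, ((N : ℝ≥0∞) ^ 3)⁻¹ * F v w e

lemma superpose_add (F G : TorusVertex N → TorusVertex N → TorusEdge N → ℝ≥0∞) :
    superpose (F + G) = superpose F + superpose G := by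
  ext e
  simp only [superpose, Pi.add_apply, mul_add, Finset.sum_add_distrib]

lemma vol_superpose (F : TorusVertex N → TorusVertex N → TorusEdge N → ℝ≥0∞) :
    vol (superpose F) = ((N : ℝ≥0∞) ^ 3)⁻¹ * ∑ v, ∑ w, vol (F v w) := by
  simp only [vol, superpose, ← Finset.mul_sum]
  rw [Finset.sum_comm]
  simp only [Finset.sum_comm (s := (Finset.univ : Finset (TorusEdge N)))]

/-- `f` is a superposition of unit flows with volume `N⁻³` between any two vertices: the form in
which standardized global flows are built. -/
def IsStdFlow (N : ℕ) (f : TorusEdge N → ℝ≥0∞) : Prop :=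
  ∃ F : TorusVertex N → TorusVertex N → TorusEdge N → ℝ≥0∞,
    (∀ v w, IsUnitFlow (torus N) v w (F v w)) ∧ f = superpose F

lemma IsStdFlow.of_eq_zero (f : TorusEdge 0 → ℝ≥0∞) : IsStdFlow 0 f :=
  ⟨fun v => v.1.elim0, fun v => v.1.elim0,
    funext fun e => by rcases e with e | e <;> exact e.1.elim0⟩

lemma IsStdFlow.isStandardizedGlobalFlow {f : TorusEdge N → ℝ≥0∞} (hf : IsStdFlow N f) :
    IsStandardizedGlobalFlow N f := by
  obtain ⟨F, hF, rfl⟩ := hf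
  rcases Nat.eq_zero_or_pos N with rfl | hN
  · exact ⟨0, inferInstance, fun v => v.1.elim0,
      funext fun e => by rcases e with e | e <;> exact e.1.elim0⟩
  obtain ⟨μ, hμ, hμ_tra, hμ_flo⟩ := exists_measure_of_isUnitFlow
    (T := fun _ _ => ((N : ℝ≥0∞) ^ 3)⁻¹) (fun _ _ => by simp [hN.ne']) hF
  exact ⟨μ, hμ, hμ_tra, hμ_flo.symm⟩

lemma IsStdFlow.sum {J : Type} [Fintype J] {m : J → ℝ≥0∞} {f : J → TorusEdge N → ℝ≥0∞}
    (hm : ∑ j, m j = 1) (hf : ∀ j, IsStdFlow N (f j)) :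
    IsStdFlow N fun e => ∑ j, m j * f j e := by
  choose F hF h using hf
  refine ⟨fun v w e => ∑ j, m j * F j v w e, fun v w => IsUnitFlow.sum hm fun j => hF j v w, ?_⟩
  ext e
  simp_rw [h, superpose, Finset.mul_sum]
  rw [Finset.sum_comm]
  refine Finset.sum_congr rfl fun v _ => ?_
  rw [Finset.sum_comm]
  exact Finset.sum_congr rfl fun w _ => Finset.sum_congr rfl fun j _ => by ring

lemma card_torusVertex : ((Fintype.card (TorusVertex N) : ℕ) : ℝ≥0∞) = (N : ℝ≥0∞) ^ 2 := by
  simp [Fintype.card_prod, sq]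

end StandardFlows

section Cycle

variable {N : ℕ}

lemma emod_natCast_le_self {a : ℤ} (ha : 0 ≤ a) : a % N ≤ a := by
  lift a to ℕ using ha
  exact_mod_cast Nat.mod_le a N

/-- Distance on the cycle of length `N`. -/
def cycleDist (i j : Fin N) : ℕ := min (j - i : Fin N).val (i - j : Fin N).val

lemma cycleDist_comm (i j : Fin N) : cycleDist i j = cycleDist j i := min_comm _ _

variable [NeZero N]

open Fin.CommRing in
/-- Reduction of an integer modulo `N`. -/
def residue (N : ℕ) [NeZero N] : ℤ →+ Fin N := Int.castAddHom (Fin N)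

lemma residue_val (i : ℤ) : ((residue N i : ℕ) : ℤ) = i % N := by
  cases N with
  | zero => exact (NeZero.ne 0 rfl).elim
  | succ n => exact ZMod.val_intCast (n := n + 1) i

lemma residue_eq_iff {i j : ℤ} : residue N i = residue N j ↔ i % N = j % N := by
  rw [← residue_val, ← residue_val, Fin.ext_iff]
  norm_cast

lemma residue_natCast_val (a : Fin N) : residue N (a : ℕ) = a := by
  have h : ((residue N (a : ℕ) : ℕ) : ℤ) = (a : ℕ) := by
    rw [residue_val]
    exact Int.emod_eq_of_lt (by positivity) (by exact_mod_cast a.isLt)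
  exact Fin.ext (by exact_mod_cast h)

lemma cyclicSucc_eq (i : Fin N) : cyclicSucc i = i + residue N 1 := by
  have h : (residue N 1 : ℕ) = 1 % N := by
    have := residue_val (N := N) 1
    exact_mod_cast this
  apply Fin.ext
  simp [Fin.val_add, cyclicSucc, h]

lemma cyclicSucc_residue (i : ℤ) : cyclicSucc (residue N i) = residue N (i + 1) := by
  rw [cyclicSucc_eq, map_add]

lemma cycleDist_self (i : Fin N) : cycleDist i i = 0 := by simp [cycleDist]

lemma cycleDist_residue_le (x y : ℤ) : (cycleDist (residue N x) (residue N y) : ℤ) ≤ |x - y| := by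
  wlog hyx : y ≤ x generalizing x y
  · rw [cycleDist_comm, abs_sub_comm]
    exact this y x (le_of_not_ge hyx)
  rw [cycleDist, ← map_sub, ← map_sub, Nat.cast_min, residue_val, residue_val,
    abs_of_nonneg (sub_nonneg.2 hyx)]
  exact (min_le_right _ _).trans (emod_natCast_le_self (sub_nonneg.2 hyx))

lemma cycleDist_le (i j : Fin N) : 2 * cycleDist i j ≤ N := by
  unfold cycleDist
  by_cases h : j = i
  · simp [h]
  have pos : (j - i : Fin N).val ≠ 0 := Fin.val_ne_zero_iff.2 (sub_ne_zero.2 h)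
  have complement : ((i - j : Fin N) : ℕ) = N - (j - i : Fin N) := by
    rw [← neg_sub j i, Fin.val_neg', Nat.mod_eq_of_lt]
    omega
  omega

lemma four_mul_sum_min_le (n : ℕ) : 4 * ∑ d ∈ Finset.range n, min d (n - d) ≤ n ^ 2 := by
  induction n using Nat.twoStepInduction with
  | zero => simp
  | one => simp
  | more n ih _ =>
    have peel : ∑ d ∈ Finset.range (n + 2), min d (n + 2 - d)
        = ∑ d ∈ Finset.range n, min d (n - d) + (n + 1) := by
      rw [Finset.sum_range_succ']
      have shift : ∀ d ∈ Finset.range (n + 1),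
          min (d + 1) (n + 2 - (d + 1)) = min d (n - d) + 1 := by
        intro d hd
        have := Finset.mem_range.1 hd
        omega
      rw [Finset.sum_congr rfl shift, Finset.sum_add_distrib, Finset.sum_range_succ]
      simp
    rw [peel]
    nlinarith

lemma four_mul_sum_cycleDist_le (i : Fin N) : 4 * ∑ j, cycleDist i j ≤ N ^ 2 := by
  refine le_trans ?_ (four_mul_sum_min_le N)
  rw [← Fin.sum_univ_eq_sum_range (fun d => min d (N - d)),
    ← Equiv.sum_comp (Equiv.subRight i) fun d : Fin N => min (d : ℕ) (N - d)]
  gcongr with j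
  simp only [Equiv.subRight_apply, cycleDist]
  gcongr
  rw [← neg_sub j i, Fin.val_neg']
  exact Nat.mod_le _ _

end Cycle

section ShortestRoutes

variable {N : ℕ}

/-- There is a unit flow from `v` to `w` with horizontal and vertical volumes at most `a`, `b`. -/
def HasRoute (v w : TorusVertex N) (a b : ℕ) : Prop :=
  ∃ f, IsUnitFlow (torus N) v w f ∧ ∑ x, f (.inl x) ≤ a ∧ ∑ x, f (.inr x) ≤ b

lemma HasRoute.refl (v : TorusVertex N) : HasRoute v v 0 0 :=
  ⟨0, IsUnitFlow.refl trivial, by simp, by simp⟩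

lemma HasRoute.symm {v w : TorusVertex N} {a b : ℕ} : HasRoute v w a b → HasRoute w v a b
  | ⟨f, hf, horizontal, vertical⟩ => ⟨f, hf.symm, horizontal, vertical⟩

lemma HasRoute.trans {u v w : TorusVertex N} {a b a' b' : ℕ} :
    HasRoute u v a b → HasRoute v w a' b' → HasRoute u w (a + a') (b + b')
  | ⟨f, hf, hfa, hfb⟩, ⟨g, hg, hga, hgb⟩ => by
    refine ⟨f + g, hf.trans hg, ?_, ?_⟩ <;>
    · simp only [Pi.add_apply, Finset.sum_add_distrib]
      push_cast
      gcongr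

variable [NeZero N]

lemma HasRoute.right (v : TorusVertex N) : HasRoute v (v.1 + residue N 1, v.2) 1 0 := by
  have h : (torus N).IsLink (.inl v) v (v.1 + residue N 1, v.2) :=
    .inl (by simp [torusEnds, cyclicSucc_eq])
  exact ⟨_, .of_isLink h, by simp [Pi.single_apply], by simp⟩

lemma HasRoute.up (v : TorusVertex N) : HasRoute v (v.1, v.2 + residue N 1) 0 1 := by
  have h : (torus N).IsLink (.inr v) v (v.1, v.2 + residue N 1) :=
    .inl (by simp [torusEnds, cyclicSucc_eq])
  exact ⟨_, .of_isLink h, by simp, by simp [Pi.single_apply]⟩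

lemma HasRoute.horizontal (v : TorusVertex N) (n : ℕ) :
    HasRoute v (v.1 + residue N n, v.2) n 0 := by
  induction n with
  | zero => simpa using HasRoute.refl v
  | succ n ih => simpa [add_assoc] using ih.trans (HasRoute.right _)

lemma HasRoute.vertical (v : TorusVertex N) (n : ℕ) :
    HasRoute v (v.1, v.2 + residue N n) 0 n := by
  induction n with
  | zero => simpa using HasRoute.refl v
  | succ n ih => simpa [add_assoc] using ih.trans (HasRoute.up _)

lemma HasRoute.row (i i' j : Fin N) : HasRoute (i, j) (i', j) (cycleDist i i') 0 := by
  unfold cycleDist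
  rcases min_choice (i' - i : Fin N).val (i - i' : Fin N).val with h | h <;> rw [h]
  · simpa [residue_natCast_val] using HasRoute.horizontal (i, j) (i' - i : Fin N).val
  · simpa [residue_natCast_val] using (HasRoute.horizontal (i', j) (i - i' : Fin N).val).symm

lemma HasRoute.column (i j j' : Fin N) : HasRoute (i, j) (i, j') 0 (cycleDist j j') := by
  unfold cycleDist
  rcases min_choice (j' - j : Fin N).val (j - j' : Fin N).val with h | h <;> rw [h]
  · simpa [residue_natCast_val] using HasRoute.vertical (i, j) (j' - j : Fin N).val
  · simpa [residue_natCast_val] using (HasRoute.vertical (i, j') (j - j' : Fin N).val).symm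

lemma hasRoute_cycleDist (v w : TorusVertex N) :
    HasRoute v w (cycleDist v.1 w.1) (cycleDist v.2 w.2) := by
  simpa using (HasRoute.row v.1 w.1 v.2).trans (HasRoute.column w.1 v.2 w.2)

/-- A unit flow along a shortest route. -/
def shortestFlow (v w : TorusVertex N) : TorusEdge N → ℝ≥0∞ := (hasRoute_cycleDist v w).choose

/-- The `ℓ¹` distance on the torus. -/
def torusDist (v w : TorusVertex N) : ℕ := cycleDist v.1 w.1 + cycleDist v.2 w.2

lemma isUnitFlow_shortestFlow (v w : TorusVertex N) :
    IsUnitFlow (torus N) v w (shortestFlow v w) :=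
  (hasRoute_cycleDist v w).choose_spec.1

lemma sum_shortestFlow_inl_le (v w : TorusVertex N) :
    ∑ x, shortestFlow v w (.inl x) ≤ cycleDist v.1 w.1 :=
  (hasRoute_cycleDist v w).choose_spec.2.1

lemma sum_shortestFlow_inr_le (v w : TorusVertex N) :
    ∑ x, shortestFlow v w (.inr x) ≤ cycleDist v.2 w.2 :=
  (hasRoute_cycleDist v w).choose_spec.2.2

lemma vol_shortestFlow_le (v w : TorusVertex N) : vol (shortestFlow v w) ≤ torusDist v w := by
  unfold vol torusDist
  rw [Fintype.sum_sum_type]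
  push_cast
  exact add_le_add (sum_shortestFlow_inl_le v w) (sum_shortestFlow_inr_le v w)

lemma torusDist_le (v w : TorusVertex N) : torusDist v w ≤ N := by
  have := cycleDist_le v.1 w.1
  have := cycleDist_le v.2 w.2
  unfold torusDist
  omega

lemma torusDist_self (v : TorusVertex N) : torusDist v v = 0 := by simp [torusDist, cycleDist_self]

/-- The point of the torus with given integer coordinates. -/
def torusPoint (N : ℕ) [NeZero N] : ℤ × ℤ →+ TorusVertex N := (residue N).prodMap (residue N)

lemma torusPoint_apply (x : ℤ × ℤ) : torusPoint N x = (residue N x.1, residue N x.2) := rfl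

lemma torusDist_torusPoint_le (x y : ℤ × ℤ) :
    (torusDist (torusPoint N x) (torusPoint N y) : ℤ) ≤ |x.1 - y.1| + |x.2 - y.2| := by
  unfold torusDist
  push_cast
  exact add_le_add (cycleDist_residue_le _ _) (cycleDist_residue_le _ _)

end ShortestRoutes

section Translations

variable {N : ℕ} [NeZero N]

/-- Translation of edges. -/
def edgeShift (τ : TorusVertex N) : TorusEdge N ≃ TorusEdge N :=
  Equiv.sumCongr (Equiv.addRight τ) (Equiv.addRight τ)

lemma torusEnds_edgeShift (τ : TorusVertex N) (e : TorusEdge N) :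
    torusEnds N (edgeShift τ e) = ((torusEnds N e).1 + τ, (torusEnds N e).2 + τ) := by
  rcases e with ⟨i, j⟩ | ⟨i, j⟩ <;>
  simp [edgeShift, torusEnds, cyclicSucc_eq, Prod.ext_iff, add_right_comm]

lemma IsUnitFlow.translate {v w : TorusVertex N} {f : TorusEdge N → ℝ≥0∞} (τ : TorusVertex N)
    (hf : IsUnitFlow (torus N) v w f) :
    IsUnitFlow (torus N) (v + τ) (w + τ) fun e => f ((edgeShift τ).symm e) := by
  classical
  have hlink (e : TorusEdge N) (_ : e ∉ (∅ : Set (TorusEdge N))) (x y : TorusVertex N)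
      (h : (torus N).IsLink e x y) : (torus N).IsLink (edgeShift τ e) (x + τ) (y + τ) := by
    change torusEnds N _ = _ ∨ torusEnds N _ = _
    rw [torusEnds_edgeShift]
    exact h.imp (fun h => by rw [h]) (fun h => by rw [h])
  convert hf.map (φ := fun v => v + τ) (G' := torus N) (fun _ => trivial)
    (fun _ he => he.elim) hlink using 1
  ext e
  simp [pushFlow, Finset.sum_filter, ← Equiv.eq_symm_apply]

lemma IsStdFlow.translate {f : TorusEdge N → ℝ≥0∞} (τ : TorusVertex N) (hf : IsStdFlow N f) :
    IsStdFlow N fun e => f ((edgeShift τ).symm e) := by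
  obtain ⟨F, hF, rfl⟩ := hf
  refine ⟨fun v w e => F (v - τ) (w - τ) ((edgeShift τ).symm e), fun v w => ?_, ?_⟩
  · simpa using (hF (v - τ) (w - τ)).translate τ
  · ext e
    refine (Equiv.sum_comp (Equiv.subRight τ) _).symm.trans ?_
    exact Finset.sum_congr rfl fun v _ => (Equiv.sum_comp (Equiv.subRight τ) _).symm

lemma sum_inv_card_torusVertex : ∑ _τ : TorusVertex N, ((N : ℝ≥0∞) ^ 2)⁻¹ = 1 := by
  rw [Finset.sum_const, nsmul_eq_mul, Finset.card_univ, card_torusVertex]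
  exact ENNReal.mul_inv_cancel (by simp [NeZero.ne N]) (by finiteness)

/-- The average, over all translations `τ` of the torus, of the translate of `f τ` by `τ`. -/
def average (f : TorusVertex N → TorusEdge N → ℝ≥0∞) (e : TorusEdge N) : ℝ≥0∞ :=
  ∑ τ, ((N : ℝ≥0∞) ^ 2)⁻¹ * f τ ((edgeShift τ).symm e)

lemma IsStdFlow.average {f : TorusVertex N → TorusEdge N → ℝ≥0∞} (hf : ∀ τ, IsStdFlow N (f τ)) :
    IsStdFlow N (average f) :=
  IsStdFlow.sum sum_inv_card_torusVertex fun τ => (hf τ).translate τ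

lemma average_add (f g : TorusVertex N → TorusEdge N → ℝ≥0∞) :
    average (f + g) = average f + average g := by
  ext e
  simp only [average, Pi.add_apply, mul_add, Finset.sum_add_distrib]

lemma average_mono {f g : TorusVertex N → TorusEdge N → ℝ≥0∞} (h : ∀ τ e, f τ e ≤ g τ e)
    (e : TorusEdge N) : average f e ≤ average g e := by
  unfold average
  gcongr
  exact h _ _

lemma average_le {f : TorusVertex N → TorusEdge N → ℝ≥0∞} {B : ℝ≥0∞} (hf : ∀ τ e, f τ e ≤ B)
    (e : TorusEdge N) : average f e ≤ B :=
  calc average f e ≤ ∑ _τ : TorusVertex N, ((N : ℝ≥0∞) ^ 2)⁻¹ * B := by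
        unfold average
        gcongr
        exact hf _ _
    _ = B := by rw [← Finset.sum_mul, sum_inv_card_torusVertex, one_mul]

lemma average_const_le {f : TorusEdge N → ℝ≥0∞} {e : TorusEdge N} {η : ℝ≥0∞}
    (hf : ∑ τ, f ((edgeShift τ).symm e) ≤ η * (N : ℝ≥0∞) ^ 2) : average (fun _ => f) e ≤ η := by
  rw [average, ← Finset.mul_sum, mul_comm, ← div_eq_mul_inv]
  exact ENNReal.div_le_of_le_mul hf

lemma sum_edgeShift_inl (f : TorusEdge N → ℝ≥0∞) (x : TorusVertex N) :
    ∑ τ, f ((edgeShift τ).symm (.inl x)) = ∑ y, f (.inl y) := by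
  rw [← Equiv.sum_comp (Equiv.subLeft x) fun y => f (.inl y)]
  exact Finset.sum_congr rfl fun τ _ => by simp [edgeShift, sub_eq_add_neg]

lemma sum_edgeShift_inr (f : TorusEdge N → ℝ≥0∞) (x : TorusVertex N) :
    ∑ τ, f ((edgeShift τ).symm (.inr x)) = ∑ y, f (.inr y) := by
  rw [← Equiv.sum_comp (Equiv.subLeft x) fun y => f (.inr y)]
  exact Finset.sum_congr rfl fun τ _ => by simp [edgeShift, sub_eq_add_neg]

lemma sum_edgeShift_le_vol (f : TorusEdge N → ℝ≥0∞) (e : TorusEdge N) :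
    ∑ τ, f ((edgeShift τ).symm e) ≤ vol f := by
  unfold vol
  rw [Fintype.sum_sum_type]
  rcases e with x | x
  · rw [sum_edgeShift_inl]
    exact le_self_add
  · rw [sum_edgeShift_inr]
    exact le_add_self

end Translations

section UniformFlow

variable {N : ℕ} [NeZero N]

/-- The standardized flow which sends everything along shortest routes. -/
def shortestStdFlow (N : ℕ) [NeZero N] (e : TorusEdge N) : ℝ≥0∞ :=
  ∑ v, ∑ w, ((N : ℝ≥0∞) ^ 3)⁻¹ * shortestFlow v w e

lemma isStdFlow_shortestStdFlow : IsStdFlow N (shortestStdFlow N) :=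
  ⟨shortestFlow, isUnitFlow_shortestFlow, rfl⟩

lemma four_mul_sum_cycleDist_fst_le (v : TorusVertex N) :
    4 * ∑ w : TorusVertex N, cycleDist v.1 w.1 ≤ N ^ 3 := by
  simp only [Fintype.sum_prod_type, Finset.sum_const, Finset.card_univ, Fintype.card_fin,
    smul_eq_mul, ← Finset.mul_sum]
  nlinarith [four_mul_sum_cycleDist_le v.1]

lemma four_mul_sum_cycleDist_snd_le (v : TorusVertex N) :
    4 * ∑ w : TorusVertex N, cycleDist v.2 w.2 ≤ N ^ 3 := by
  simp only [Fintype.sum_prod_type, Finset.sum_const, Finset.card_univ, Fintype.card_fin,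
    smul_eq_mul]
  nlinarith [four_mul_sum_cycleDist_le v.2]

lemma sum_shortestStdFlow_le {ι : TorusVertex N → TorusEdge N}
    {d : TorusVertex N → TorusVertex N → ℕ}
    (hι : ∀ v w, ∑ y, shortestFlow v w (ι y) ≤ d v w) (hd : ∀ v, 4 * ∑ w, d v w ≤ N ^ 3) :
    ∑ y, shortestStdFlow N (ι y) ≤ (N : ℝ≥0∞) ^ 2 * (1 / 4) := by
  have load (v : TorusVertex N) :
      ∑ w, ((N : ℝ≥0∞) ^ 3)⁻¹ * ∑ y, shortestFlow v w (ι y) ≤ 1 / 4 := by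
    rw [← Finset.mul_sum, ENNReal.le_div_iff_mul_le (by simp) (by simp), mul_assoc]
    calc ((N : ℝ≥0∞) ^ 3)⁻¹ * ((∑ w, ∑ y, shortestFlow v w (ι y)) * 4)
        ≤ ((N : ℝ≥0∞) ^ 3)⁻¹ * ((∑ w, (d v w : ℝ≥0∞)) * 4) := by
          gcongr
          exact hι v _
      _ ≤ ((N : ℝ≥0∞) ^ 3)⁻¹ * (N : ℝ≥0∞) ^ 3 := by
          gcongr
          rw [mul_comm]
          exact_mod_cast hd v
      _ ≤ 1 := ENNReal.inv_mul_le_one _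
  calc ∑ y, shortestStdFlow N (ι y)
      = ∑ v, ∑ w, ((N : ℝ≥0∞) ^ 3)⁻¹ * ∑ y, shortestFlow v w (ι y) := by
        simp_rw [shortestStdFlow, Finset.mul_sum]
        rw [Finset.sum_comm]
        exact Finset.sum_congr rfl fun v _ => Finset.sum_comm
    _ ≤ ∑ _v : TorusVertex N, 1 / 4 := Finset.sum_le_sum fun v _ => load v
    _ = (N : ℝ≥0∞) ^ 2 * (1 / 4) := by
        rw [Finset.sum_const, nsmul_eq_mul, Finset.card_univ, card_torusVertex]

lemma sum_edgeShift_shortestStdFlow_le (e : TorusEdge N) :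
    ∑ τ, shortestStdFlow N ((edgeShift τ).symm e) ≤ (N : ℝ≥0∞) ^ 2 * (1 / 4) := by
  rcases e with x | x
  · rw [sum_edgeShift_inl]
    exact sum_shortestStdFlow_le sum_shortestFlow_inl_le four_mul_sum_cycleDist_fst_le
  · rw [sum_edgeShift_inr]
    exact sum_shortestStdFlow_le sum_shortestFlow_inr_le four_mul_sum_cycleDist_snd_le

lemma exists_isStdFlow_le_quarter (N : ℕ) : ∃ u, IsStdFlow N u ∧ ∀ e, u e ≤ 1 / 4 := by
  rcases Nat.eq_zero_or_pos N with rfl | hN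
  · exact ⟨0, .of_eq_zero 0, by simp⟩
  have : NeZero N := ⟨hN.ne'⟩
  refine ⟨_, IsStdFlow.average fun _ => isStdFlow_shortestStdFlow (N := N), fun e => ?_⟩
  exact average_const_le ((sum_edgeShift_shortestStdFlow_le e).trans_eq (mul_comm _ _))

end UniformFlow

/-! ### Measurable selection of nearly optimal flows -/

section Selection

variable {E : Type} [Fintype E]

lemma continuous_cost_flow (c : E → ℝ≥0) : Continuous fun f : E → ℝ≥0∞ => cost f c := by
  unfold cost
  refine continuous_finsetSum _ fun e _ => ?_
  exact (ENNReal.continuous_const_mul ENNReal.coe_ne_top).comp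
    ((ENNReal.continuous_pow 2).comp (continuous_apply e))

lemma continuous_cost_env {f : E → ℝ≥0∞} (hf : ∀ e, f e ≠ ∞) :
    Continuous fun c : E → ℝ≥0 => cost f c := by
  unfold cost
  refine continuous_finsetSum _ fun e _ => ?_
  exact (ENNReal.continuous_mul_const (ENNReal.pow_ne_top (hf e))).comp
    (ENNReal.continuous_coe.comp (continuous_apply e))

lemma cost_lt_top {f : E → ℝ≥0∞} (hf : ∀ e, f e ≠ ∞) (c : E → ℝ≥0) : cost f c < ∞ :=
  ENNReal.sum_lt_top.2 fun e _ =>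
    ENNReal.mul_lt_top ENNReal.coe_lt_top (ENNReal.pow_lt_top (hf e).lt_top)

lemma exists_measurable_selection_cost {F : Set (E → ℝ≥0∞)} (hF : F.Nonempty)
    (hfin : ∀ f ∈ F, ∀ e, f e ≠ ∞) {ε : ℝ≥0∞} (hε : ε ≠ 0) :
    ∃ f : (E → ℝ≥0) → (E → ℝ≥0∞), Measurable f ∧ (∀ c, f c ∈ F) ∧
      ∀ c, ∀ g ∈ F, cost (f c) c ≤ cost g c + ε := by
  classical
  have : Nonempty F := hF.to_subtype
  let d : ℕ → F := TopologicalSpace.denseSeq F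
  have hmeas (n : ℕ) : Measurable fun c => cost (d n).1 c :=
    (continuous_cost_env (hfin _ (d n).2)).measurable
  have nearly_optimal (c : E → ℝ≥0) : ∃ n, cost (d n).1 c ≤ (⨅ m, cost (d m).1 c) + ε := by
    have hinf : (⨅ m, cost (d m).1 c) ≠ ∞ :=
      ((iInf_le _ 0).trans_lt (cost_lt_top (hfin _ (d 0).2) c)).ne
    obtain ⟨n, hn⟩ := iInf_lt_iff.1 (ENNReal.lt_add_right hinf hε)
    exact ⟨n, hn.le⟩
  refine ⟨fun c => (d (Nat.find (nearly_optimal c))).1, ?_, fun c => (d _).2, fun c g hg => ?_⟩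
  · refine Measurable.comp (g := fun n => (d n).1) measurable_from_top
      (measurable_find nearly_optimal fun n => ?_)
    exact measurableSet_le (hmeas n) ((Measurable.iInf hmeas).add_const _)
  · refine (Nat.find_spec (nearly_optimal c)).trans ?_
    gcongr
    refine (TopologicalSpace.denseRange_denseSeq F).induction_on
      (p := fun x => (⨅ m, cost (d m).1 c) ≤ cost x.1 c) ⟨g, hg⟩ ?_ fun n => iInf_le _ n
    exact isClosed_le continuous_const ((continuous_cost_flow c).comp continuous_subtype_val)

/-- Standardized global flows subject to the capacity `B`. -/
def feasible (N : ℕ) (B : ℝ≥0) : Set (TorusEdge N → ℝ≥0∞) :=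
  {f | IsStandardizedGlobalFlow N f ∧ ∀ e, f e ≤ B}

lemma feasible_nonempty (N : ℕ) {B : ℝ≥0} (hB : 1 / 4 ≤ B) : (feasible N B).Nonempty := by
  obtain ⟨u, hu, hle⟩ := exists_isStdFlow_le_quarter N
  refine ⟨u, hu.isStandardizedGlobalFlow, fun e => (hle e).trans ?_⟩
  have : ((1 / 4 : ℝ≥0) : ℝ≥0∞) ≤ B := by exact_mod_cast hB
  simpa using this

lemma exists_measurable_selection_feasible (N : ℕ) {B : ℝ≥0} (hB : 1 / 4 ≤ B) :
    ∃ f : (TorusEdge N → ℝ≥0) → (TorusEdge N → ℝ≥0∞), Measurable f ∧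
      (∀ c, f c ∈ feasible N B) ∧ ∀ c, ∀ g ∈ feasible N B, cost (f c) c ≤ cost g c + 1 :=
  exists_measurable_selection_cost (feasible_nonempty N hB)
    (fun _ hf e => ((hf.2 e).trans_lt ENNReal.coe_lt_top).ne) one_ne_zero

lemma measurable_squareCost (M : ℕ) (B : ℝ≥0) (Q : Transport M) :
    Measurable (squareCost M B Q) := by
  unfold squareCost
  refine UpperSemicontinuous.measurable ?_
  refine upperSemicontinuous_biInf fun μ hμ => Continuous.upperSemicontinuous ?_
  exact continuous_cost_env fun e => ((hμ.2.2 e).trans_lt ENNReal.coe_lt_top).ne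

end Selection

/-! ### Itineraries of a balanced transportation measure -/

section Itinerary

variable {M : ℕ}

lemma Bou.reflect_reflect (b : Bou M) : b.reflect.reflect = b := by
  obtain ⟨s, j⟩ := b
  cases s <;> rfl

lemma Bou.sum_reflect {α : Type} [AddCommMonoid α] (g : Bou M → α) :
    ∑ b : Bou M, g b.reflect = ∑ b, g b :=
  Equiv.sum_comp (Function.Involutive.toPerm _ Bou.reflect_reflect) g

/-- Number of consecutive legs `(x, b), (x', b')` such that `x'` is not the reflection of `b`,
when the legs are run through starting from the entrance `y`. A leg is a pair (entrance, exit) for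
one square; without mismatches, it ends where the next leg starts. -/
def mismatches (y : Bou M) : List (Bou M × Bou M) → ℕ
  | [] => 0
  | (x, b) :: l => (if y = x then 0 else 1) + mismatches b.reflect l

lemma exists_mismatches_append (y : Bou M) (l l' : List (Bou M × Bou M)) :
    ∃ z, mismatches y (l ++ l') = mismatches y l + mismatches z l' := by
  induction l generalizing y with
  | nil => exact ⟨y, by simp [mismatches]⟩
  | cons a l ih =>
    obtain ⟨x, b⟩ := a
    obtain ⟨z, hz⟩ := ih b.reflect
    exact ⟨z, by simp [mismatches, hz, add_assoc]⟩

lemma mismatches_le (y z : Bou M) (l : List (Bou M × Bou M)) :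
    mismatches y l ≤ mismatches z l + 1 := by
  cases l with
  | nil => simp [mismatches]
  | cons a l =>
    obtain ⟨x, b⟩ := a
    simp only [mismatches]
    split_ifs <;> omega

lemma mismatches_flatMap_le {ι : Type} (f : ι → List (Bou M × Bou M)) (C : ℕ)
    (hC : ∀ i, ∃ z, mismatches z (f i) ≤ C) (y : Bou M) (L : List ι) :
    mismatches y (L.flatMap f) ≤ L.length * (C + 1) := by
  induction L generalizing y with
  | nil => simp [mismatches]
  | cons i L ih =>
    obtain ⟨z, hz⟩ := exists_mismatches_append y (f i) (L.flatMap f)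
    obtain ⟨z', hz'⟩ := hC i
    have := mismatches_le y z' (f i)
    have := ih z
    rw [List.flatMap_cons, hz, List.length_cons]
    nlinarith

/-- A permutation of two copies of the boundary which moves between the copies only over the same
boundary point. -/
def IsStitching (π : Equiv.Perm (Bou M × Bool)) : Prop := ∀ z, (π z).2 ≠ z.2 → (π z).1 = z.1

/-- The leg used in one step of a permutation of two copies of the set of entrances; moves between
the copies use no leg. -/
def permLeg (π : Equiv.Perm (Bou M × Bool)) (z : Bou M × Bool) : List (Bou M × Bou M) :=
  if (π z).2 = z.2 then [(z.1, (π z).1.reflect)] else []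

/-- The legs used in `t` steps of a permutation. -/
def permRun (π : Equiv.Perm (Bou M × Bool)) : Bou M × Bool → ℕ → List (Bou M × Bou M)
  | _, 0 => []
  | z, t + 1 => permLeg π z ++ permRun π (π z) t

lemma IsStitching.mismatches_permRun {π : Equiv.Perm (Bou M × Bool)} (hπ : IsStitching π)
    (z : Bou M × Bool) (t : ℕ) : mismatches z.1 (permRun π z t) = 0 := by
  induction t generalizing z with
  | zero => rfl
  | succ t ih =>
    simp only [permRun, permLeg]
    split_ifs with h
    · simp [mismatches, Bou.reflect_reflect, ih]
    · simpa [hπ z h] using ih (π z)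

lemma sum_count_permRun (π : Equiv.Perm (Bou M × Bool)) (t : ℕ) (a : Bou M × Bou M) :
    ∑ z, (permRun π z t).count a = t * ∑ z, (permLeg π z).count a := by
  induction t with
  | zero => simp [permRun]
  | succ t ih =>
    simp only [permRun, List.count_append, Finset.sum_add_distrib]
    rw [Equiv.sum_comp π fun z => (permRun π z t).count a, ih]
    ring

lemma count_permLeg (π : Equiv.Perm (Bou M × Bool)) (z : Bou M × Bool) (a b : Bou M) :
    (permLeg π z).count (a, b) = if z.1 = a ∧ π z = (b.reflect, z.2) then 1 else 0 := by
  have exit_eq : (π z).1.reflect = b ↔ (π z).1 = b.reflect :=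
    ⟨fun h => by rw [← h, Bou.reflect_reflect], fun h => by rw [h, Bou.reflect_reflect]⟩
  unfold permLeg
  by_cases h : (π z).2 = z.2
  · simp [h, List.count_cons, Prod.ext_iff, exit_eq]
  · simp [h, Prod.ext_iff]

lemma sum_count_permLeg (π : Equiv.Perm (Bou M × Bool)) (a b : Bou M) :
    ∑ z, (permLeg π z).count (a, b) = ∑ ε, if π (a, ε) = (b.reflect, ε) then 1 else 0 := by
  simp [count_permLeg, Fintype.sum_prod_type_right, ite_and]

lemma exists_list_of_stitchings (t : Equiv.Perm (Bou M × Bool) → ℕ)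
    (ht : ∀ π, t π ≠ 0 → IsStitching π) :
    ∃ l : List (Bou M × Bou M),
      (∀ y, mismatches y l ≤ Fintype.card (Equiv.Perm (Bou M × Bool) × (Bou M × Bool))) ∧
      ∀ a, l.count a = ∑ π, t π * ∑ z, (permLeg π z).count a := by
  let run : Equiv.Perm (Bou M × Bool) × (Bou M × Bool) → List (Bou M × Bou M) :=
    fun x => permRun x.1 x.2 (t x.1)
  have run_matches (x) : ∃ z, mismatches z (run x) ≤ 0 := by
    refine ⟨x.2.1, ?_⟩
    by_cases h : t x.1 = 0
    · simp [run, h, permRun, mismatches]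
    · exact ((ht _ h).mismatches_permRun _ _).le
  refine ⟨Finset.univ.toList.flatMap run, fun y => ?_, fun a => ?_⟩
  · simpa using mismatches_flatMap_le run 0 run_matches y Finset.univ.toList
  · calc (Finset.univ.toList.flatMap run).count a = ∑ x, (run x).count a := by
          rw [List.count_flatMap, ← Finset.sum_map_toList]
          rfl
      _ = ∑ π, t π * ∑ z, (permLeg π z).count a := by
          rw [Fintype.sum_prod_type]
          exact Finset.sum_congr rfl fun π _ => sum_count_permRun π (t π) a

lemma exiMarginal_reflect {Q : Transport M} (hQ : Q ∈ balanced M) (b : Bou M) :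
    Q.exiMarginal b.reflect = Q.entMarginal b := by
  rw [← hQ b, Finset.sum_eq_single b.reflect]
  · intro b' hb' hne
    rw [Finset.mem_filter] at hb'
    exact absurd (by rw [← hb'.2, Bou.reflect_reflect]) hne
  · simp [Bou.reflect_reflect]

/-- A constant which dominates the entrance marginal of `Q`. -/
def Transport.bound (Q : Transport M) : ℝ := 1 + ∑ b, (Q.entMarginal b : ℝ)

lemma Transport.bound_pos (Q : Transport M) : 0 < Q.bound := by
  unfold Transport.bound
  positivity

lemma Transport.entMarginal_le_bound (Q : Transport M) (b : Bou M) : Q.entMarginal b ≤ Q.bound := by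
  have : (Q.entMarginal b : ℝ) ≤ ∑ b, (Q.entMarginal b : ℝ) :=
    Finset.single_le_sum (f := fun b => (Q.entMarginal b : ℝ)) (fun b _ => by positivity)
      (Finset.mem_univ b)
  unfold Transport.bound
  linarith

/-- The normalized matrix of `Q` on two copies of the boundary. The entries between the copies
complete all row and column sums to `Q.bound`. -/
def Transport.doubled (Q : Transport M) : Matrix (Bou M × Bool) (Bou M × Bool) ℝ := fun z z' =>
  Q.bound⁻¹ * if z.2 = z'.2 then (Q z.1 z'.1.reflect : ℝ) else
    if z.1 = z'.1 then Q.bound - Q.entMarginal z.1 else 0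

lemma doubled_mem_doublyStochastic {Q : Transport M} (hQ : Q ∈ balanced M) :
    Q.doubled ∈ doublyStochastic ℝ (Bou M × Bool) := by
  have bound_ne := Q.bound_pos.ne'
  rw [mem_doublyStochastic_iff_sum]
  refine ⟨fun z z' => ?_, fun z => ?_, fun z => ?_⟩
  · refine mul_nonneg (inv_nonneg.2 Q.bound_pos.le) ?_
    split_ifs
    · positivity
    · exact sub_nonneg.2 (Q.entMarginal_le_bound z.1)
    · exact le_rfl
  · have row : ∑ b : Bou M, (Q z.1 b.reflect : ℝ) = Q.entMarginal z.1 := by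
      rw [Bou.sum_reflect fun b => (Q z.1 b : ℝ)]
      simp [Transport.entMarginal]
    simp only [Transport.doubled, ← Finset.mul_sum]
    rw [Fintype.sum_prod_type_right, Fintype.sum_bool]
    obtain ⟨b, ε⟩ := z
    cases ε <;> simp [row] <;> field_simp
  · have column : ∑ b, (Q b z.1.reflect : ℝ) = Q.entMarginal z.1 := by
      rw [← exiMarginal_reflect hQ]
      simp [Transport.exiMarginal]
    simp only [Transport.doubled, ← Finset.mul_sum]
    rw [Fintype.sum_prod_type_right, Fintype.sum_bool]
    obtain ⟨b, ε⟩ := z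
    cases ε <;> simp [column] <;> field_simp

lemma exists_perm_weights {n : Type} [Fintype n] [DecidableEq n] {A : Matrix n n ℝ}
    (hA : A ∈ doublyStochastic ℝ n) :
    ∃ w : Equiv.Perm n → ℝ, (∀ π, 0 ≤ w π) ∧
      ∀ i j, ∑ π : Equiv.Perm n, w π * (if π i = j then 1 else 0) = A i j := by
  obtain ⟨w, hw_nonneg, -, hw⟩ := exists_eq_sum_perm_of_mem_doublyStochastic hA
  refine ⟨w, hw_nonneg, fun i j => ?_⟩
  rw [← hw]
  simp [Matrix.sum_apply, Equiv.Perm.permMatrix, PEquiv.toMatrix_apply, eq_comm]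

lemma eq_zero_of_not_isStitching {Q : Transport M} {w : Equiv.Perm (Bou M × Bool) → ℝ}
    (hw_nonneg : ∀ π, 0 ≤ w π)
    (hw : ∀ z z', ∑ π, w π * (if π z = z' then 1 else 0) = Q.doubled z z')
    {π : Equiv.Perm (Bou M × Bool)} (hπ : ¬ IsStitching π) : w π = 0 := by
  simp only [IsStitching, not_forall] at hπ
  obtain ⟨z, hz, hne⟩ := hπ
  have entry_eq_zero : Q.doubled z (π z) = 0 := by
    rw [Transport.doubled, if_neg (Ne.symm hz), if_neg (Ne.symm hne), mul_zero]
  rw [← hw, Finset.sum_eq_zero_iff_of_nonneg fun σ _ =>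
    mul_nonneg (hw_nonneg σ) (by split_ifs <;> simp)] at entry_eq_zero
  simpa using entry_eq_zero π (Finset.mem_univ _)

lemma exists_stitching_decomposition {Q : Transport M} (hQ : Q ∈ balanced M) :
    ∃ w : Equiv.Perm (Bou M × Bool) → ℝ, (∀ π, 0 ≤ w π) ∧ (∀ π, w π ≠ 0 → IsStitching π) ∧
      ∀ a : Bou M × Bou M, (Q a.1 a.2 : ℝ) = ∑ π, w π * (∑ z, (permLeg π z).count a : ℕ) := by
  have bound_ne := Q.bound_pos.ne'
  obtain ⟨w, hw_nonneg, hw⟩ := exists_perm_weights (doubled_mem_doublyStochastic hQ)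
  refine ⟨fun π => Q.bound / 2 * w π,
    fun π => mul_nonneg (div_nonneg Q.bound_pos.le zero_le_two) (hw_nonneg π), fun π hπ => ?_, ?_⟩
  · by_contra h
    exact hπ (by simp [eq_zero_of_not_isStitching hw_nonneg hw h])
  · rintro ⟨a, b⟩
    have entry (ε : Bool) : ∑ π : Equiv.Perm (Bou M × Bool),
        w π * (if π (a, ε) = (b.reflect, ε) then 1 else 0) = Q.bound⁻¹ * Q a b := by
      rw [hw]
      simp [Transport.doubled, Bou.reflect_reflect]
    simp only [sum_count_permLeg, Nat.cast_sum, Nat.cast_ite, Nat.cast_one, Nat.cast_zero,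
      mul_assoc, Finset.mul_sum]
    rw [Finset.sum_comm]
    simp_rw [← Finset.mul_sum, entry]
    simp only [Finset.sum_const, Finset.card_univ, Fintype.card_bool, nsmul_eq_mul]
    field_simp
    norm_num

lemma exists_itinerary {Q : Transport M} (hQ : Q ∈ balanced M) :
    ∃ C : ℕ, ∀ s : ℝ, 0 ≤ s → ∃ l : List (Bou M × Bou M), (∀ y, mismatches y l ≤ C) ∧
      ∀ a, (l.count a : ℝ) ≤ s * Q a.1 a.2 ∧ s * Q a.1 a.2 ≤ l.count a + C := by
  obtain ⟨w, hw_nonneg, hw, hQw⟩ := exists_stitching_decomposition hQ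
  let legs (π : Equiv.Perm (Bou M × Bool)) (a : Bou M × Bou M) : ℕ := ∑ z, (permLeg π z).count a
  refine ⟨Fintype.card (Equiv.Perm (Bou M × Bool) × (Bou M × Bool)) + ∑ a, ∑ π, legs π a,
    fun s hs => ?_⟩
  obtain ⟨l, hl, hcount⟩ := exists_list_of_stitchings (fun π => ⌊s * w π⌋₊) fun π h =>
    hw π fun h0 => h (by simp [h0])
  refine ⟨l, fun y => (hl y).trans (Nat.le_add_right _ _), fun a => ?_⟩
  have hQa : s * (Q a.1 a.2 : ℝ) = ∑ π, s * w π * legs π a := by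
    simp only [hQw, Finset.mul_sum, mul_assoc, legs]
  have hla : (l.count a : ℝ) = ∑ π, (⌊s * w π⌋₊ : ℝ) * legs π a := by
    rw [hcount, Nat.cast_sum]
    simp only [Nat.cast_mul, legs]
  rw [hQa, hla]
  constructor
  · gcongr with π _
    exact Nat.floor_le (mul_nonneg hs (hw_nonneg π))
  · calc ∑ π, s * w π * legs π a ≤ ∑ π, ((⌊s * w π⌋₊ : ℝ) * legs π a + legs π a) := by
          gcongr with π _
          rw [← add_one_mul]
          gcongr
          exact (Nat.lt_floor_add_one _).le
      _ = ∑ π, (⌊s * w π⌋₊ : ℝ) * legs π a + (∑ π, legs π a : ℕ) := by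
          rw [Finset.sum_add_distrib, Nat.cast_sum (s := Finset.univ)]
      _ ≤ _ := by
          gcongr
          exact (Finset.single_le_sum (f := fun a => ∑ π, legs π a) (fun _ _ => Nat.zero_le _)
            (Finset.mem_univ a)).trans (Nat.le_add_left _ _)

end Itinerary

/-! ### Discretization of an isotropic mixture -/

section Grid

/-- The cell `k` of the square grid of mesh `1 / n`. It is closed, so that averages of points of the
cell stay in the cell. -/
def gridCell (n : ℕ) (k : ℤ × ℤ) : Set (ℝ × ℝ) :=
  Set.Icc ((k.1 : ℝ) / n) ((k.1 + 1) / n) ×ˢ Set.Icc ((k.2 : ℝ) / n) ((k.2 + 1) / n)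

lemma isClosed_gridCell (n : ℕ) (k : ℤ × ℤ) : IsClosed (gridCell n k) :=
  isClosed_Icc.prod isClosed_Icc

lemma convex_gridCell (n : ℕ) (k : ℤ × ℤ) : Convex ℝ (gridCell n k) :=
  (convex_Icc _ _).prod (convex_Icc _ _)

lemma volume_gridCell {n : ℕ} (hn : 0 < n) (k : ℤ × ℤ) :
    volume (gridCell n k) = ((n : ℝ≥0∞) ^ 2)⁻¹ := by
  have hside (x : ℝ) : (x + 1) / n - x / n = (n : ℝ)⁻¹ := by ring
  rw [gridCell, Measure.volume_eq_prod, Measure.prod_prod, Real.volume_Icc, Real.volume_Icc, hside,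
    hside, ENNReal.ofReal_inv_of_pos (by positivity), ENNReal.ofReal_natCast, ← sq, ENNReal.inv_pow]

/-- The index of a cell of the grid of mesh `1 / n` that contains `x`; the fibres of this map are
the half-open cells, which partition the plane. -/
def gridIndex (n : ℕ) (x : ℝ × ℝ) : ℤ × ℤ := (⌊n * x.1⌋, ⌊n * x.2⌋)

lemma measurable_gridIndex (n : ℕ) : Measurable (gridIndex n) :=
  (Int.measurable_floor.comp (measurable_fst.const_mul _)).prodMk
    (Int.measurable_floor.comp (measurable_snd.const_mul _))

lemma mem_gridCell_gridIndex {n : ℕ} (hn : 0 < n) (x : ℝ × ℝ) : x ∈ gridCell n (gridIndex n x) := by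
  have hn' : (0 : ℝ) < n := by exact_mod_cast hn
  have hmem (y : ℝ) : y ∈ Set.Icc ((⌊n * y⌋ : ℝ) / n) ((⌊n * y⌋ + 1) / n) :=
    ⟨(div_le_iff₀' hn').2 (Int.floor_le _), (le_div_iff₀' hn').2 (Int.lt_floor_add_one _).le⟩
  exact ⟨hmem x.1, hmem x.2⟩

lemma floor_natCast_mul_fract {n : ℕ} (hn : 0 < n) (x : ℝ) :
    ⌊n * Int.fract x⌋ = ⌊n * x⌋ % n := by
  have hdiv : ⌊n * x⌋ / (n : ℤ) = ⌊x⌋ := by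
    rw [← Int.floor_div_natCast, mul_div_cancel_left₀ x (by positivity)]
  have hfract : (n : ℝ) * Int.fract x = n * x - ((n * ⌊x⌋ : ℤ) : ℝ) := by
    rw [← Int.self_sub_floor]
    push_cast
    ring
  rw [hfract, Int.floor_sub_intCast, Int.emod_def, hdiv]

end Grid

section Discretization

variable {M : ℕ}

lemma Transport.measurable_apply (b₁ b₂ : Bou M) : Measurable fun Q : Transport M => Q b₁ b₂ :=
  (measurable_pi_apply b₂).comp (measurable_pi_apply b₁)

lemma measurable_drift : Measurable (drift : Transport M → ℝ × ℝ) := by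
  have (b₁ b₂ : Bou M) : Measurable fun Q : Transport M => (Q b₁ b₂ : ℝ) :=
    (Transport.measurable_apply b₁ b₂).coe_nnreal_real
  unfold drift
  fun_prop

lemma measurable_gridIndex_drift (n : ℕ) :
    Measurable fun Q : Transport M => gridIndex n (drift Q) :=
  (measurable_gridIndex n).comp measurable_drift

lemma measurable_driftMod : Measurable (driftMod : Transport M → ℝ × ℝ) :=
  (measurable_fract.comp measurable_drift.fst).prodMk (measurable_fract.comp measurable_drift.snd)

lemma driftMod_mem_gridCell {n : ℕ} (hn : 0 < n) (Q : Transport M) :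
    driftMod Q ∈ gridCell n
      ((gridIndex n (drift Q)).1 % (n : ℤ), (gridIndex n (drift Q)).2 % (n : ℤ)) := by
  have hmem := mem_gridCell_gridIndex hn (driftMod Q)
  simpa only [gridIndex, driftMod, floor_natCast_mul_fract hn] using hmem

/-- The mean of a law `ν` of transportation measures, entry by entry; an entry of infinite mean is
replaced by `0`. -/
def Transport.mean (ν : Measure (Transport M)) : Transport M :=
  fun b₁ b₂ => (∫⁻ Q, (Q b₁ b₂ : ℝ≥0∞) ∂ν).toNNReal

section Mean

variable {ν : Measure (Transport M)}

lemma Transport.coe_mean (hν : ∀ b₁ b₂, ∫⁻ Q, (Q b₁ b₂ : ℝ≥0∞) ∂ν ≠ ∞) (b₁ b₂ : Bou M) :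
    (Transport.mean ν b₁ b₂ : ℝ≥0∞) = ∫⁻ Q, (Q b₁ b₂ : ℝ≥0∞) ∂ν :=
  ENNReal.coe_toNNReal (hν b₁ b₂)

lemma Transport.mean_mem_balanced (hν : ∀ b₁ b₂, ∫⁻ Q, (Q b₁ b₂ : ℝ≥0∞) ∂ν ≠ ∞)
    (hbal : ∀ᵐ Q ∂ν, Q ∈ balanced M) : Transport.mean ν ∈ balanced M := by
  have hmeas (b₁ b₂ : Bou M) : Measurable fun Q : Transport M => (Q b₁ b₂ : ℝ≥0∞) :=
    (Transport.measurable_apply b₁ b₂).coe_nnreal_ennreal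
  have hexi (b : Bou M) : (∑ b' with b'.reflect = b, (mean ν).exiMarginal b' : ℝ≥0) =
      ∫⁻ Q, (∑ b' with b'.reflect = b, Q.exiMarginal b' : ℝ≥0) ∂ν := by
    simp only [exiMarginal, ENNReal.ofNNReal_finsetSum, coe_mean hν]
    rw [lintegral_finsetSum _ fun b' _ => Finset.measurable_fun_sum _ fun b'' _ => hmeas b'' b']
    exact Finset.sum_congr rfl fun b' _ => (lintegral_finsetSum _ fun b'' _ => hmeas b'' b').symm
  have hent (b : Bou M) : ((mean ν).entMarginal b : ℝ≥0∞) = ∫⁻ Q, Q.entMarginal b ∂ν := by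
    simp only [entMarginal, ENNReal.ofNNReal_finsetSum, coe_mean hν]
    exact (lintegral_finsetSum _ fun b' _ => hmeas b b').symm
  intro b
  rw [← ENNReal.coe_inj, hexi, hent]
  refine lintegral_congr_ae ?_
  filter_upwards [hbal] with Q hQ
  rw [hQ b]

lemma Transport.integrable_apply (hν : ∀ b₁ b₂, ∫⁻ Q, (Q b₁ b₂ : ℝ≥0∞) ∂ν ≠ ∞)
    (b₁ b₂ : Bou M) : Integrable (fun Q : Transport M => (Q b₁ b₂ : ℝ)) ν := by
  refine ⟨(Transport.measurable_apply b₁ b₂).coe_nnreal_real.aestronglyMeasurable, ?_⟩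
  rw [hasFiniteIntegral_iff_enorm]
  simpa using (hν b₁ b₂).lt_top

lemma integrable_drift (hν : ∀ b₁ b₂, ∫⁻ Q, (Q b₁ b₂ : ℝ≥0∞) ∂ν ≠ ∞) :
    Integrable (drift : Transport M → ℝ × ℝ) ν := by
  unfold drift
  exact Integrable.fun_smul _ (integrable_finsetSum _ fun b₁ _ => integrable_finsetSum _ fun b₂ _ =>
    (Transport.integrable_apply hν b₁ b₂).smul_const (b₂.pos - b₁.pos))

lemma drift_mean (hν : ∀ b₁ b₂, ∫⁻ Q, (Q b₁ b₂ : ℝ≥0∞) ∂ν ≠ ∞) :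
    drift (Transport.mean ν) = ∫ Q, drift Q ∂ν := by
  have hint (b₁ b₂ : Bou M) :
      Integrable (fun Q : Transport M => (Q b₁ b₂ : ℝ) • (b₂.pos - b₁.pos)) ν :=
    (Transport.integrable_apply hν b₁ b₂).smul_const _
  have hcoe (b₁ b₂ : Bou M) : (Transport.mean ν b₁ b₂ : ℝ) = ∫ Q, (Q b₁ b₂ : ℝ) ∂ν := by
    rw [integral_eq_lintegral_of_nonneg_ae (Eventually.of_forall fun _ => NNReal.coe_nonneg _)
      (Transport.integrable_apply hν b₁ b₂).aestronglyMeasurable]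
    simp [Transport.mean, ENNReal.toReal]
  simp only [drift]
  rw [integral_smul, integral_finsetSum _ fun b₁ _ => integrable_finsetSum _ fun b₂ _ => hint b₁ b₂]
  congr 1
  refine Finset.sum_congr rfl fun b₁ _ => ?_
  rw [integral_finsetSum _ fun b₂ _ => hint b₁ b₂]
  exact Finset.sum_congr rfl fun b₂ _ => by rw [integral_smul_const, hcoe]

lemma drift_mean_mem [IsProbabilityMeasure ν] (hν : ∀ b₁ b₂, ∫⁻ Q, (Q b₁ b₂ : ℝ≥0∞) ∂ν ≠ ∞)
    {S : Set (ℝ × ℝ)} (hconv : Convex ℝ S) (hclosed : IsClosed S) (hS : ∀ᵐ Q ∂ν, drift Q ∈ S) :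
    drift (Transport.mean ν) ∈ S := by
  rw [drift_mean hν]
  exact hconv.integral_mem hclosed hS (integrable_drift hν)

end Mean

lemma exists_finset_one_le_sum_add {α ι : Type*} [MeasurableSpace α] [Countable ι]
    [MeasurableSpace ι] [MeasurableSingletonClass ι] (ψ : Measure α) [IsProbabilityMeasure ψ]
    {f : α → ι} (hf : Measurable f) {ε : ℝ≥0∞} (hε : 0 < ε) :
    ∃ I : Finset ι, (∀ k ∈ I, ψ (f ⁻¹' {k}) ≠ 0) ∧ 1 ≤ ∑ k ∈ I, ψ (f ⁻¹' {k}) + ε := by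
  classical
  have htsum : ∑' k, ψ (f ⁻¹' {k}) = 1 := by
    rw [← measure_iUnion (fun k k' hk => Disjoint.preimage f (by simpa using hk))
      fun k => hf (measurableSet_singleton k), ← Set.preimage_iUnion, Set.iUnion_of_singleton,
      Set.preimage_univ, measure_univ]
  have hlt : 1 - ε < ∑' k, ψ (f ⁻¹' {k}) := by
    rw [htsum]
    exact ENNReal.sub_lt_self ENNReal.one_ne_top one_ne_zero hε.ne'
  rw [ENNReal.tsum_eq_iSup_sum, lt_iSup_iff] at hlt
  obtain ⟨I, hI⟩ := hlt
  refine ⟨{k ∈ I | ψ (f ⁻¹' {k}) ≠ 0}, fun k hk => (Finset.mem_filter.1 hk).2, ?_⟩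
  rw [Finset.sum_filter_ne_zero]
  exact tsub_le_iff_right.1 hI.le

lemma sum_measure_gridIndex_le {ψ : Measure (Transport M)}
    (hunif : ψ.map driftMod = volume.restrict (Set.Icc (0 : ℝ) 1 ×ˢ Set.Icc (0 : ℝ) 1))
    {n : ℕ} (hn : 0 < n) (I : Finset (ℤ × ℤ)) (c : ℤ × ℤ) :
    ∑ k ∈ I with (k.1 % (n : ℤ), k.2 % (n : ℤ)) = c, ψ ((fun Q => gridIndex n (drift Q)) ⁻¹' {k}) ≤
      ((n : ℝ≥0∞) ^ 2)⁻¹ := by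
  rw [sum_measure_preimage_singleton _ fun k _ =>
    measurable_gridIndex_drift n (measurableSet_singleton k)]
  calc _ ≤ ψ (driftMod ⁻¹' gridCell n c) := by
        refine measure_mono fun Q hQ => ?_
        obtain ⟨-, rfl⟩ := Finset.mem_filter.1 hQ
        exact driftMod_mem_gridCell hn Q
    _ = ψ.map driftMod (gridCell n c) :=
        (Measure.map_apply measurable_driftMod (isClosed_gridCell n c).measurableSet).symm
    _ ≤ volume (gridCell n c) := by
        rw [hunif]
        exact Measure.restrict_apply_le _ _
    _ = _ := volume_gridCell hn c

lemma mul_lintegral_cond {α : Type*} [MeasurableSpace α] (ψ : Measure α) [IsFiniteMeasure ψ]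
    {s : Set α} (hs : ψ s ≠ 0) (g : α → ℝ≥0∞) :
    ψ s * ∫⁻ x, g x ∂ProbabilityTheory.cond ψ s = ∫⁻ x in s, g x ∂ψ := by
  rw [ProbabilityTheory.cond, lintegral_smul_measure, smul_eq_mul, ← mul_assoc,
    ENNReal.mul_inv_cancel hs (measure_ne_top _ _), one_mul]

-- The law is conditioned on the cell of the grid that contains the drift: balance and the drift
-- bound survive averaging within a cell, and finitely many cells carry almost all of the mass.
lemma exists_discretization {Q₀ : Transport M} (hQ₀ : Q₀ ∈ isotropic M) {n : ℕ} (hn : 0 < n)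
    {ε : ℝ≥0∞} (hε : 0 < ε) :
    ∃ (I : Finset (ℤ × ℤ)) (p : ℤ × ℤ → ℝ≥0) (Q : ℤ × ℤ → Transport M),
      (∀ k ∈ I, Q k ∈ balanced M) ∧
      (∀ b₁ b₂, ∑ k ∈ I, p k * Q k b₁ b₂ ≤ Q₀ b₁ b₂) ∧
      (∀ c : ℤ × ℤ, ∑ k ∈ I with (k.1 % (n : ℤ), k.2 % (n : ℤ)) = c, p k ≤ ((n : ℝ≥0) ^ 2)⁻¹) ∧
      (1 ≤ ∑ k ∈ I, (p k : ℝ≥0∞) + ε) ∧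
      ∀ k ∈ I, drift (Q k) ∈ gridCell n k := by
  classical
  obtain ⟨ψ, hψ, hbal, hmix, hunif⟩ := hQ₀
  let A : ℤ × ℤ → Set (Transport M) := fun k => (fun Q => gridIndex n (drift Q)) ⁻¹' {k}
  have hA (k : ℤ × ℤ) : MeasurableSet (A k) :=
    measurable_gridIndex_drift n (measurableSet_singleton k)
  obtain ⟨I, hI, htot⟩ := exists_finset_one_le_sum_add ψ (measurable_gridIndex_drift n) hε
  have hp (k : ℤ × ℤ) : ((ψ (A k)).toNNReal : ℝ≥0∞) = ψ (A k) :=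
    ENNReal.coe_toNNReal (measure_ne_top _ _)
  let ν : ℤ × ℤ → Measure (Transport M) := fun k => ProbabilityTheory.cond ψ (A k)
  have hν (k : ℤ × ℤ) (hk : k ∈ I) (b₁ b₂ : Bou M) : ∫⁻ Q, (Q b₁ b₂ : ℝ≥0∞) ∂ν k ≠ ∞ := by
    refine (ENNReal.lt_top_of_mul_ne_top_right ?_ (hI k hk)).ne
    rw [mul_lintegral_cond ψ (hI k hk)]
    exact ((setLIntegral_le_lintegral _ _).trans_lt (hmix b₁ b₂ ▸ ENNReal.coe_lt_top)).ne
  refine ⟨I, fun k => (ψ (A k)).toNNReal, fun k => .mean (ν k), fun k hk => ?_, fun b₁ b₂ => ?_,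
    fun c => ?_, ?_, fun k hk => ?_⟩
  · exact Transport.mean_mem_balanced (hν k hk) (ProbabilityTheory.cond_absolutelyContinuous hbal)
  · have hterm (k : ℤ × ℤ) (hk : k ∈ I) :
        (((ψ (A k)).toNNReal * Transport.mean (ν k) b₁ b₂ : ℝ≥0) : ℝ≥0∞) =
          ∫⁻ Q in A k, (Q b₁ b₂ : ℝ≥0∞) ∂ψ := by
      rw [ENNReal.coe_mul, hp, Transport.coe_mean (hν k hk), mul_lintegral_cond ψ (hI k hk)]
    rw [← ENNReal.coe_le_coe, ENNReal.ofNNReal_finsetSum, Finset.sum_congr rfl hterm, hmix,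
      ← lintegral_biUnion_finset (Set.pairwiseDisjoint_fiber _ _) fun k _ => hA k]
    exact setLIntegral_le_lintegral _ _
  · rw [← ENNReal.coe_le_coe, ENNReal.ofNNReal_finsetSum]
    simp_rw [hp]
    refine (sum_measure_gridIndex_le hunif hn I c).trans_eq ?_
    rw [ENNReal.coe_inv (by positivity), ENNReal.coe_pow, ENNReal.coe_natCast]
  · simpa only [hp] using htot
  · have := ProbabilityTheory.cond_isProbabilityMeasure (hI k hk)
    refine drift_mean_mem (hν k hk) (convex_gridCell n k) (isClosed_gridCell n k) ?_
    filter_upwards [ProbabilityTheory.ae_cond_mem (hA k)] with Q hQ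
    rw [← Set.mem_singleton_iff.1 hQ]
    exact mem_gridCell_gridIndex hn _

end Discretization

/-! ### Embedding copies of the extended square into the torus -/

section Blocks

variable {M : ℕ}

/-- The direction in which one leaves a square through a boundary point, in units of blocks. -/
def Bou.dir (b : Bou M) : ℤ × ℤ :=
  match b.1 with
  | .left => (-1, 0)
  | .right => (1, 0)
  | .bottom => (0, -1)
  | .top => (0, 1)

/-- The lattice point which represents a boundary point of the square with lower left corner `0`:
half-edges on the left and bottom sides are stretched to full edges, those on the right and top
sides are contracted to a point. -/
def Bou.offset : Bou M → ℤ × ℤ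
  | (.left, j) => (-1, (j : ℕ))
  | (.right, j) => (M - 1, (j : ℕ))
  | (.bottom, i) => ((i : ℕ), -1)
  | (.top, i) => ((i : ℕ), M - 1)

lemma Bou.offset_reflect (b : Bou M) :
    b.reflect.offset = (b.offset.1 - M * b.dir.1, b.offset.2 - M * b.dir.2) := by
  obtain ⟨s, j⟩ := b
  cases s <;> simp [Bou.reflect, Side.opposite, Bou.offset, Bou.dir] <;> ring

lemma Bou.offset_mem (b : Bou M) : (-1 ≤ b.offset.1 ∧ b.offset.1 ≤ M - 1) ∧
    (-1 ≤ b.offset.2 ∧ b.offset.2 ≤ M - 1) := by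
  obtain ⟨s, j⟩ := b
  have := j.isLt
  cases s <;> simp only [Bou.offset] <;> omega

/-- The position, relative to the lower left corner of the square, of the left or lower end of the
lattice edge which represents an edge of the extended square. -/
def edgeOffset : SquareEdge M → ℤ × ℤ
  | .inl (.inl (i, j)) => ((i : ℕ), (j : ℕ))
  | .inl (.inr (i, j)) => ((i : ℕ), (j : ℕ))
  | .inr b => b.offset

/-- The direction of an edge of the extended square, which decides between the two families of
edges of the torus. -/
def isHorizontal : SquareEdge M → Bool
  | .inl (.inl _) => true
  | .inl (.inr _) => false
  | .inr (.left, _) => true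
  | .inr (.right, _) => true
  | .inr (.bottom, _) => false
  | .inr (.top, _) => false

/-- The half-edges on the right and top sides, which are contracted to points of the torus. -/
def contracted (M : ℕ) : Set (SquareEdge M) := {e | ∃ j, e = .inr (.right, j) ∨ e = .inr (.top, j)}

lemma eq_of_edgeOffset_eq {e e' : SquareEdge M} (hdir : isHorizontal e = isHorizontal e')
    (hoff : edgeOffset e = edgeOffset e') : e = e' := by
  rcases e with (⟨i, j⟩ | ⟨i, j⟩) | ⟨_ | _ | _ | _, j⟩ <;>
  rcases e' with (⟨i', j'⟩ | ⟨i', j'⟩) | ⟨_ | _ | _ | _, j'⟩ <;>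
  simp only [isHorizontal, reduceCtorEq] at hdir <;>
  simp only [edgeOffset, Bou.offset, Prod.mk.injEq] at hoff <;>
  first
  | (exfalso; omega)
  | (obtain rfl : j = j' := Fin.ext (by omega)
     obtain rfl : i = i' := Fin.ext (by omega)
     rfl)
  | (obtain rfl : j = j' := Fin.ext (by omega)
     rfl)

lemma edgeOffset_mem (e : SquareEdge M) : (-1 ≤ (edgeOffset e).1 ∧ (edgeOffset e).1 ≤ M - 1) ∧
    (-1 ≤ (edgeOffset e).2 ∧ (edgeOffset e).2 ≤ M - 1) := by
  rcases e with (⟨i, j⟩ | ⟨i, j⟩) | b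
  · have := i.isLt; have := j.isLt; simp only [edgeOffset]; omega
  · have := i.isLt; have := j.isLt; simp only [edgeOffset]; omega
  · exact b.offset_mem

lemma edgeOffset_mem_of_notMem_contracted {e : SquareEdge M} (he : e ∉ contracted M) :
    if isHorizontal e then
      ((edgeOffset e).1 ≤ M - 2 ∧ 0 ≤ (edgeOffset e).2)
    else (0 ≤ (edgeOffset e).1 ∧ (edgeOffset e).2 ≤ M - 2) := by
  rcases e with (⟨i, j⟩ | ⟨i, j⟩) | ⟨_ | _ | _ | _, j⟩
  · have := i.isLt; simp only [isHorizontal, edgeOffset, if_true]; omega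
  · have := j.isLt; simp only [isHorizontal, edgeOffset, Bool.false_eq_true, if_false]; omega
  · have := j.isLt; simp only [isHorizontal, edgeOffset, Bou.offset, if_true]; omega
  · exact absurd ⟨j, .inl rfl⟩ he
  · have := j.isLt
    simp only [isHorizontal, edgeOffset, Bou.offset, Bool.false_eq_true, if_false]
    omega
  · exact absurd ⟨j, .inr rfl⟩ he

/-- The integer coordinates of a block. -/
def blockIdx {K : ℕ} (α : Fin K × Fin K) : ℤ × ℤ := ((α.1 : ℕ), (α.2 : ℕ))

lemma mul_blockIdx_mem {N K : ℕ} (hK : M * K ≤ N) (a : Fin K) :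
    (0 : ℤ) ≤ M * (a : ℕ) ∧ (M : ℤ) * (a : ℕ) + M ≤ N := by
  have hle : M * ((a : ℕ) + 1) ≤ N := (Nat.mul_le_mul_left _ a.isLt).trans hK
  refine ⟨by positivity, ?_⟩
  zify at hle
  linarith

variable (N : ℕ) [NeZero N]

/-- The lattice point with offset `o` in the block `A`. -/
def blockPt (M : ℕ) (A o : ℤ × ℤ) : TorusVertex N := torusPoint N (M * A.1 + o.1, M * A.2 + o.2)

/-- The map into the torus of the vertices of the extended square, placed at block `A`; a boundary
point on the right or top side has the same image as its neighbour in the square. -/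
def blockVertex (A : ℤ × ℤ) : SquareVertex M → TorusVertex N
  | .inl (i, j) => blockPt N M A ((i : ℕ), (j : ℕ))
  | .inr b => blockPt N M A b.offset

/-- The map into the torus of the edges of the extended square, placed at block `A`; its values on
contracted edges are irrelevant. -/
def blockEdge (A : ℤ × ℤ) (e : SquareEdge M) : TorusEdge N :=
  if isHorizontal e then .inl (blockPt N M A (edgeOffset e))
  else .inr (blockPt N M A (edgeOffset e))

variable {N}

lemma blockVertex_eq_of_mem_contracted (A : ℤ × ℤ) {e : SquareEdge M} (he : e ∈ contracted M) :
    blockVertex N A (squareEnds M e).1 = blockVertex N A (squareEnds M e).2 := by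
  obtain ⟨j, rfl | rfl⟩ := he <;>
  · have hcast : ((M - 1 : ℕ) : ℤ) = M - 1 := by have := j.isLt; omega
    simp [squareEnds, blockVertex, Bou.inner, Bou.offset, hcast]

lemma torusEnds_blockEdge (A : ℤ × ℤ) {e : SquareEdge M} (he : e ∉ contracted M) :
    torusEnds N (blockEdge N A e) =
      (blockVertex N A (squareEnds M e).1, blockVertex N A (squareEnds M e).2) := by
  rcases e with (⟨i, j⟩ | ⟨i, j⟩) | ⟨_ | _ | _ | _, j⟩
  case inr.right => exact absurd ⟨j, .inl rfl⟩ he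
  case inr.top => exact absurd ⟨j, .inr rfl⟩ he
  all_goals
    simp [blockEdge, isHorizontal, edgeOffset, blockPt, torusPoint_apply, torusEnds, squareEnds,
      blockVertex, cyclicSucc_residue, add_assoc, Bou.inner, Bou.offset, -map_add, -map_sub,
      -map_neg]

lemma IsUnitFlow.toBlock (A : ℤ × ℤ) {x y : SquareVertex M} {f : SquareEdge M → ℝ≥0∞}
    (hf : IsUnitFlow (square M) x y f) :
    IsUnitFlow (torus N) (blockVertex N A x) (blockVertex N A y)
      (pushFlow (contracted M) (blockEdge N A) f) := by
  refine hf.map (G' := torus N) (fun _ => trivial) (fun e he x y hlink => ?_)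
    (fun e he x y hlink => ?_)
  · have hends := blockVertex_eq_of_mem_contracted (N := N) A he
    rcases hlink with hlink | hlink <;> rw [hlink] at hends
    exacts [hends, hends.symm]
  · have hends := torusEnds_blockEdge (N := N) A he
    rcases hlink with hlink | hlink <;> rw [hlink] at hends
    exacts [.inl hends, .inr hends]

lemma eq_of_residue_eq {x y : ℤ} (hres : residue N x = residue N y) (hxy : |x - y| < N) :
    x = y := by
  have hdvd : (N : ℤ) ∣ x - y := Int.ModEq.dvd (residue_eq_iff.1 hres).symm
  exact sub_eq_zero.1 (Int.eq_zero_of_abs_lt_dvd hdvd hxy)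

lemma eq_of_blockPt_eq {A o A' o' : ℤ × ℤ} (hpt : blockPt N M A o = blockPt N M A' o')
    (hfst : |M * A.1 + o.1 - (M * A'.1 + o'.1)| < N)
    (hsnd : |M * A.2 + o.2 - (M * A'.2 + o'.2)| < N) :
    M * A.1 + o.1 = M * A'.1 + o'.1 ∧ M * A.2 + o.2 = M * A'.2 + o'.2 := by
  simp only [blockPt, torusPoint_apply, Prod.mk.injEq] at hpt
  exact ⟨eq_of_residue_eq hpt.1 hfst, eq_of_residue_eq hpt.2 hsnd⟩

lemma blockEdge_eq_iff {A A' : ℤ × ℤ} {e e' : SquareEdge M} :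
    blockEdge N A e = blockEdge N A' e' ↔ isHorizontal e = isHorizontal e' ∧
      blockPt N M A (edgeOffset e) = blockPt N M A' (edgeOffset e') := by
  unfold blockEdge
  cases isHorizontal e <;> cases isHorizontal e' <;> simp

lemma blockEdge_injective (hMN : M + 1 ≤ N) (A : ℤ × ℤ) :
    Function.Injective (blockEdge (M := M) N A) := by
  intro e e' hee'
  obtain ⟨hdir, hpt⟩ := blockEdge_eq_iff.1 hee'
  have hmem := edgeOffset_mem e
  have hmem' := edgeOffset_mem e'
  have hcoord := eq_of_blockPt_eq hpt (by rw [abs_lt]; omega) (by rw [abs_lt]; omega)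
  exact eq_of_edgeOffset_eq hdir (Prod.ext (by omega) (by omega))

lemma eq_of_mul_add_eq {m a a' o o' : ℤ} (heq : m * a + o = m * a' + o') (hlt : |o - o'| < m) :
    a = a' ∧ o = o' := by
  have hdvd : m ∣ o - o' := ⟨a' - a, by linarith⟩
  obtain rfl : o = o' := sub_eq_zero.1 (Int.eq_zero_of_abs_lt_dvd hdvd hlt)
  have hm : 0 < m := (abs_nonneg _).trans_lt hlt
  exact ⟨mul_left_cancel₀ hm.ne' (by linarith), rfl⟩

lemma blockEdge_injOn {K : ℕ} (hK : M * K ≤ N) {α α' : Fin K × Fin K} {e e' : SquareEdge M}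
    (he : e ∉ contracted M) (he' : e' ∉ contracted M)
    (hee' : blockEdge N (blockIdx α) e = blockEdge N (blockIdx α') e') : α = α' ∧ e = e' := by
  obtain ⟨hdir, hpt⟩ := blockEdge_eq_iff.1 hee'
  have hmem := edgeOffset_mem e
  have hmem' := edgeOffset_mem e'
  have hsharp := edgeOffset_mem_of_notMem_contracted he
  have hsharp' := edgeOffset_mem_of_notMem_contracted he'
  have hα₁ := mul_blockIdx_mem hK α.1
  have hα₂ := mul_blockIdx_mem hK α.2
  have hα'₁ := mul_blockIdx_mem hK α'.1
  have hα'₂ := mul_blockIdx_mem hK α'.2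
  simp only [blockIdx] at hpt
  rw [← hdir] at hsharp'
  cases hh : isHorizontal e <;>
    simp only [hh, if_true, Bool.false_eq_true, if_false] at hsharp hsharp'
  all_goals
    have hcoord := eq_of_blockPt_eq hpt (by simp only; rw [abs_lt]; omega)
      (by simp only; rw [abs_lt]; omega)
    simp only at hcoord
    obtain ⟨hblock₁, hoff₁⟩ := eq_of_mul_add_eq hcoord.1 (by rw [abs_lt]; omega)
    obtain ⟨hblock₂, hoff₂⟩ := eq_of_mul_add_eq hcoord.2 (by rw [abs_lt]; omega)
    exact ⟨Prod.ext (Fin.ext (Nat.cast_injective hblock₁)) (Fin.ext (Nat.cast_injective hblock₂)),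
      eq_of_edgeOffset_eq hdir (Prod.ext hoff₁ hoff₂)⟩

/-- The flow on the torus obtained from flows across the extended square, one for each block. -/
def blockSum (N : ℕ) [NeZero N] {K : ℕ} (f : Fin K × Fin K → SquareEdge M → ℝ≥0∞)
    (e' : TorusEdge N) : ℝ≥0∞ :=
  ∑ α, pushFlow (contracted M) (blockEdge N (blockIdx α)) (f α) e'

open Classical in
lemma blockSum_eq_sum {K : ℕ} (f : Fin K × Fin K → SquareEdge M → ℝ≥0∞) (e' : TorusEdge N) :
    blockSum N f e' = ∑ x : (Fin K × Fin K) × SquareEdge M with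
      x.2 ∉ contracted M ∧ blockEdge N (blockIdx x.1) x.2 = e', f x.1 x.2 := by
  simp only [blockSum, pushFlow, Finset.sum_filter]
  symm
  rw [Fintype.sum_prod_type]
  refine Finset.sum_congr rfl fun α _ => Finset.sum_congr rfl fun e _ => ?_
  congr

lemma blockSum_blockEdge {K : ℕ} (hK : M * K ≤ N) (f : Fin K × Fin K → SquareEdge M → ℝ≥0∞)
    (α : Fin K × Fin K) {e : SquareEdge M} (he : e ∉ contracted M) :
    blockSum N f (blockEdge N (blockIdx α) e) = f α e := by
  classical
  rw [blockSum_eq_sum, Finset.sum_eq_single (α, e)]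
  · rintro ⟨α', e'⟩ hx hne
    obtain ⟨he', hee'⟩ := (Finset.mem_filter.1 hx).2
    obtain ⟨rfl, rfl⟩ := blockEdge_injOn hK he' he hee'
    exact absurd rfl hne
  · intro hx
    exact absurd (Finset.mem_filter.2 ⟨Finset.mem_univ _, he, rfl⟩) hx

lemma blockSum_eq_zero {K : ℕ} (f : Fin K × Fin K → SquareEdge M → ℝ≥0∞) {e' : TorusEdge N}
    (he' : ∀ (α : Fin K × Fin K) (e : SquareEdge M),
      e ∉ contracted M → blockEdge N (blockIdx α) e ≠ e') :
    blockSum N f e' = 0 := by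
  classical
  rw [blockSum_eq_sum, Finset.sum_eq_zero]
  intro x hx
  obtain ⟨he, hxe'⟩ := (Finset.mem_filter.1 hx).2
  exact absurd hxe' (he' _ _ he)

lemma blockSum_cases {K : ℕ} (hK : M * K ≤ N) (f : Fin K × Fin K → SquareEdge M → ℝ≥0∞)
    (e' : TorusEdge N) : blockSum N f e' = 0 ∨ ∃ α e, e ∉ contracted M ∧
      blockEdge N (blockIdx α) e = e' ∧ blockSum N f e' = f α e := by
  by_cases hex : ∃ (α : Fin K × Fin K) (e : SquareEdge M),
      e ∉ contracted M ∧ blockEdge N (blockIdx α) e = e'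
  · obtain ⟨α, e, he, rfl⟩ := hex
    exact .inr ⟨α, e, he, rfl, blockSum_blockEdge hK f α he⟩
  · push Not at hex
    exact .inl (blockSum_eq_zero f hex)

lemma blockSum_le {K : ℕ} (hK : M * K ≤ N) {f : Fin K × Fin K → SquareEdge M → ℝ≥0∞} {B : ℝ≥0∞}
    (hf : ∀ α e, f α e ≤ B) (e' : TorusEdge N) : blockSum N f e' ≤ B := by
  rcases blockSum_cases hK f e' with hzero | ⟨α, e, -, -, heq⟩
  · simp [hzero]
  · exact heq ▸ hf α e

open Classical in
/-- The environment on the extended square seen in block `A`, with cost-factor `0` on contracted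
edges. -/
def blockEnv (A : ℤ × ℤ) (c : TorusEdge N → ℝ≥0) (e : SquareEdge M) : ℝ≥0 :=
  if e ∈ contracted M then 0 else c (blockEdge N A e)

lemma cost_blockSum_le {K : ℕ} (hK : M * K ≤ N) (f : Fin K × Fin K → SquareEdge M → ℝ≥0∞)
    (c : TorusEdge N → ℝ≥0) :
    cost (blockSum N f) c ≤ ∑ α, cost (f α) (blockEnv (blockIdx α) c) := by
  classical
  let term : (Fin K × Fin K) × SquareEdge M → ℝ≥0∞ := fun x =>
    blockEnv (blockIdx x.1) c x.2 * f x.1 x.2 ^ 2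
  calc cost (blockSum N f) c
      = ∑ e', (c e' : ℝ≥0∞) * blockSum N f e' ^ 2 := rfl
    _ ≤ ∑ e', ∑ x : (Fin K × Fin K) × SquareEdge M with blockEdge N (blockIdx x.1) x.2 = e',
          term x := by
        gcongr with e' _
        rcases blockSum_cases hK f e' with hzero | ⟨α, e, he, he', heq⟩
        · simp [hzero]
        · calc (c e' : ℝ≥0∞) * blockSum N f e' ^ 2 = term (α, e) := by
                simp [term, blockEnv, he, he', heq]
            _ ≤ _ := Finset.single_le_sum (f := term) (fun _ _ => zero_le) (by simpa using he')
    _ = ∑ x, term x := Finset.sum_fiberwise _ _ _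
    _ = _ := Fintype.sum_prod_type _

open ProbabilityTheory in
lemma pi_map_comp_injective {ι ι' α β : Type*} [Fintype ι] [Fintype ι'] [MeasurableSpace α]
    [MeasurableSpace β] (κ : Measure α) [IsProbabilityMeasure κ] {g : ι' → ι}
    (hg : g.Injective) {F : ι' → α → β} (hF : ∀ i, Measurable (F i)) :
    (Measure.pi fun _ : ι => κ).map (fun c i => F i (c (g i))) =
      Measure.pi fun i => κ.map (F i) := by
  have hindep : iIndepFun (fun i (c : ι → α) => c i) (Measure.pi fun _ : ι => κ) :=
    iIndepFun_pi (μ := fun _ : ι => κ) (X := fun _ x => x) fun _ => aemeasurable_id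
  refine ((iIndepFun_iff_map_fun_eq_pi_map fun i =>
    ((hF i).comp (measurable_pi_apply (g i))).aemeasurable).1
      ((hindep.precomp hg).comp F hF)).trans ?_
  congr 1
  ext1 i
  exact (Measure.map_map (hF i) (measurable_pi_apply (g i))).symm.trans
    (congrArg _ (measurePreserving_eval (fun _ : ι => κ) (g i)).map_eq)

lemma map_blockEnv (κ : Measure ℝ≥0) [IsProbabilityMeasure κ] (hMN : M + 1 ≤ N) (A : ℤ × ℤ)
    (τ : TorusVertex N) :
    (torusEnvLaw κ N).map (fun c => blockEnv (M := M) A fun e => c (edgeShift τ e))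
      = squareEnvLaw κ M := by
  classical
  let F : SquareEdge M → ℝ≥0 → ℝ≥0 := fun e => if e ∈ contracted M then fun _ => 0 else id
  have hF (e : SquareEdge M) : Measurable (F e) := by
    simp only [F]
    split_ifs
    exacts [measurable_const, measurable_id]
  have hinj : Function.Injective fun e : SquareEdge M => edgeShift τ (blockEdge N A e) :=
    (edgeShift τ).injective.comp (blockEdge_injective hMN A)
  have henv : (fun c : TorusEdge N → ℝ≥0 => blockEnv (M := M) A fun e => c (edgeShift τ e)) =
      fun c e => F e (c (edgeShift τ (blockEdge N A e))) := by
    ext c e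
    simp only [blockEnv, F]
    split_ifs <;> rfl
  rw [henv]
  refine (pi_map_comp_injective κ hinj hF).trans ?_
  unfold squareEnvLaw
  congr 1
  ext1 e
  rcases e with e | ⟨_ | _ | _ | _, j⟩ <;> simp [F, contracted]

end Blocks

/-! ### Following an itinerary from block to block -/

section Gates

variable {M N K : ℕ} [NeZero N]

/-- The vertex of the torus which represents the boundary point `b` of the block `α`. -/
def gate (N : ℕ) [NeZero N] (α : Fin K × Fin K) (b : Bou M) : TorusVertex N :=
  blockPt N M (blockIdx α) b.offset

lemma torusDist_gate_le (α : Fin K × Fin K) (x y : Bou M) :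
    torusDist (gate N α x) (gate N α y) ≤ 2 * M := by
  have hdist := torusDist_torusPoint_le (N := N)
    (M * (blockIdx α).1 + x.offset.1, M * (blockIdx α).2 + x.offset.2)
    (M * (blockIdx α).1 + y.offset.1, M * (blockIdx α).2 + y.offset.2)
  obtain ⟨hx₁, hx₂⟩ := x.offset_mem
  obtain ⟨hy₁, hy₂⟩ := y.offset_mem
  simp only [add_sub_add_left_eq_sub] at hdist
  have hfst : |x.offset.1 - y.offset.1| ≤ M := by rw [abs_le]; omega
  have hsnd : |x.offset.2 - y.offset.2| ≤ M := by rw [abs_le]; omega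
  unfold gate blockPt
  omega

end Gates

/-- The displacement, in blocks, along an itinerary. -/
def displacement {M : ℕ} (l : List (Bou M × Bou M)) : ℤ × ℤ := (l.map fun a => a.2.dir).sum

lemma displacement_nil {M : ℕ} : displacement ([] : List (Bou M × Bou M)) = 0 := rfl

lemma displacement_cons {M : ℕ} (a : Bou M × Bou M) (l : List (Bou M × Bou M)) :
    displacement (a :: l) = a.2.dir + displacement l := by
  simp [displacement]

lemma displacement_eq {M : ℕ} (l : List (Bou M × Bou M)) :
    displacement l = ∑ a : Bou M × Bou M, (l.count a) • a.2.dir := by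
  induction l with
  | nil => simp [displacement_nil]
  | cons a l ih =>
    rw [displacement_cons, ih]
    simp [List.count_cons, add_smul, Finset.sum_add_distrib, ite_smul, add_comm]

section Residues

variable {K : ℕ} [NeZero K]

lemma val_add_residue (a : Fin K) (d : ℤ) :
    (((a + residue K d : Fin K) : ℕ) : ℤ) = ((a : ℕ) + d) % K := by
  rw [← residue_val, map_add, residue_natCast_val]

-- Hermite's identity: the residues of `a + d` are a permutation of those of `a`.
lemma sum_add_ediv (d : ℤ) : ∑ a : Fin K, ((a : ℕ) + d) / K = d := by
  have hperm : ∑ a : Fin K, ((a : ℕ) + d) % K = ∑ a : Fin K, ((a : ℕ) : ℤ) := by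
    simp only [← val_add_residue]
    exact Equiv.sum_comp (Equiv.addRight (residue K d)) fun a : Fin K => ((a : ℕ) : ℤ)
  have hdecomp : ∑ a : Fin K, (((a : ℕ) + d) % K + K * (((a : ℕ) + d) / K)) =
      ∑ a : Fin K, (((a : ℕ) : ℤ) + d) :=
    Finset.sum_congr rfl fun a _ => Int.emod_add_mul_ediv _ _
  simp only [Finset.sum_add_distrib, hperm, ← Finset.mul_sum, Finset.sum_const, Finset.card_univ,
    Fintype.card_fin, nsmul_eq_mul, add_right_inj] at hdecomp
  exact mul_left_cancel₀ (by exact_mod_cast NeZero.ne K) hdecomp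

lemma sum_abs_add_ediv (d : ℤ) : ∑ a : Fin K, |((a : ℕ) + d) / (K : ℤ)| = |d| := by
  have hK : (0 : ℤ) < K := by exact_mod_cast Nat.pos_of_ne_zero (NeZero.ne K)
  rcases le_total 0 d with hd | hd
  · rw [abs_of_nonneg hd]
    refine (Finset.sum_congr rfl fun a _ => abs_of_nonneg ?_).trans (sum_add_ediv d)
    exact Int.ediv_nonneg (by positivity) hK.le
  · rw [abs_of_nonpos hd]
    refine (Finset.sum_congr rfl fun a _ => abs_of_nonpos ?_).trans
      (Finset.sum_neg_distrib _ |>.trans (congrArg Neg.neg (sum_add_ediv d)))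
    refine Int.lt_add_one_iff.1 (Int.ediv_lt_of_lt_mul hK ?_)
    have := a.isLt
    omega

end Residues

section Wrap

variable {M N K : ℕ} [NeZero N]

-- Blocks are numbered modulo `K`, but `N` may exceed `M * K`: each turn around the cycle of blocks
-- shifts the position on the cycle of length `N` by `N - M * K`.
lemma residue_mul_emod_add (x o : ℤ) :
    residue N (M * (x % K) + o) = residue N (M * x + o + (N - M * K) * (x / (K : ℤ))) := by
  rw [residue_eq_iff, Int.emod_def x]
  generalize x / (K : ℤ) = q
  rw [← Int.add_mul_emod_self_left _ N q]
  ring_nf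

lemma cycleDist_residue_wrap_le (hK : M * K ≤ N) (hN : N ≤ M * K + M) (a d o : ℤ) :
    (cycleDist (residue N (M * a + o)) (residue N (M * ((a + d) % K) + (o - M * d))) : ℤ) ≤
      M * |(a + d) / (K : ℤ)| := by
  have hgap : |(N : ℤ) - M * K| ≤ M := by
    rw [abs_le]
    zify at hK hN
    constructor <;> linarith
  rw [residue_mul_emod_add]
  calc _ ≤ |M * a + o - (M * (a + d) + (o - M * d) + (N - M * K) * ((a + d) / (K : ℤ)))| :=
        cycleDist_residue_le _ _
    _ = |(N : ℤ) - M * K| * |(a + d) / (K : ℤ)| := by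
        rw [← abs_mul, ← abs_neg]
        ring_nf
    _ ≤ _ := by gcongr

end Wrap

section Travel

variable {M N K : ℕ} [NeZero K]

lemma blockIdx_add (α : Fin K × Fin K) (d : ℤ × ℤ) :
    blockIdx (α + torusPoint K d) = (((α.1 : ℕ) + d.1) % K, ((α.2 : ℕ) + d.2) % K) := by
  simp [blockIdx, torusPoint_apply, val_add_residue]

/-- The block reached by leaving the block `α` through `b`. -/
def nextBlock (α : Fin K × Fin K) (b : Bou M) : Fin K × Fin K := α + torusPoint K b.dir

/-- The sum of `φ` over the legs of an itinerary which starts in the block `α`. -/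
def traceSum (φ : Fin K × Fin K → Bou M → Bou M → ℝ≥0∞) :
    Fin K × Fin K → List (Bou M × Bou M) → ℝ≥0∞
  | _, [] => 0
  | α, (x, b) :: l => φ α x b + traceSum φ (nextBlock α b) l

-- For a uniformly distributed starting block, every leg of the itinerary starts in a uniformly
-- distributed block.
lemma sum_traceSum (φ : Fin K × Fin K → Bou M → Bou M → ℝ≥0∞) (l : List (Bou M × Bou M)) :
    ∑ α, traceSum φ α l = ∑ a, (l.count a : ℝ≥0∞) * ∑ α, φ α a.1 a.2 := by
  induction l with
  | nil => simp [traceSum]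
  | cons a l ih =>
    obtain ⟨x, b⟩ := a
    have hshift : ∑ α, traceSum φ (nextBlock α b) l = ∑ α, traceSum φ α l :=
      Equiv.sum_comp (Equiv.addRight (torusPoint K b.dir)) fun α => traceSum φ α l
    simp only [traceSum, Finset.sum_add_distrib, hshift, ih, List.count_cons, Nat.cast_add, add_mul]
    rw [add_comm]
    simp

variable [NeZero N]

/-- The connection from the exit `b` of a block to the matching entrance of the next block. -/
def wrapFlow (N : ℕ) [NeZero N] (α : Fin K × Fin K) (b : Bou M) : TorusEdge N → ℝ≥0∞ :=
  shortestFlow (gate N α b) (gate N (nextBlock α b) b.reflect)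

/-- The connections at the mismatches of an itinerary. -/
def mismatchFlow (N : ℕ) [NeZero N] :
    Fin K × Fin K → Bou M → List (Bou M × Bou M) → TorusEdge N → ℝ≥0∞
  | _, _, [] => 0
  | α, y, (x, b) :: l =>
    shortestFlow (gate N α y) (gate N α x) + mismatchFlow N (nextBlock α b) b.reflect l

/-- The entrance reached at the end of an itinerary. -/
def lastEntrance : Bou M → List (Bou M × Bou M) → Bou M
  | y, [] => y
  | _, (_, b) :: l => lastEntrance b.reflect l

lemma isUnitFlow_travel {g : Fin K × Fin K → Bou M → Bou M → TorusEdge N → ℝ≥0∞}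
    (hg : ∀ α b₁ b₂, IsUnitFlow (torus N) (gate N α b₁) (gate N α b₂) (g α b₁ b₂))
    (l : List (Bou M × Bou M)) (α : Fin K × Fin K) (y : Bou M) :
    IsUnitFlow (torus N) (gate N α y)
      (gate N (α + torusPoint K (displacement l)) (lastEntrance y l)) fun e =>
        traceSum (fun α x b => g α x b e) α l + traceSum (fun α _ b => wrapFlow N α b e) α l +
          mismatchFlow N α y l e := by
  induction l generalizing α y with
  | nil =>
    rw [displacement_nil, map_zero, add_zero]
    refine (congrArg (IsUnitFlow (torus N) _ _) ?_).mp (IsUnitFlow.refl trivial)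
    ext e
    simp [traceSum, mismatchFlow]
  | cons a l ih =>
    obtain ⟨x, b⟩ := a
    have htravel := (((isUnitFlow_shortestFlow (gate N α y) (gate N α x)).trans (hg α x b)).trans
      (isUnitFlow_shortestFlow (gate N α b) (gate N (nextBlock α b) b.reflect))).trans
      (ih (nextBlock α b) b.reflect)
    have hend : nextBlock α b + torusPoint K (displacement l) =
        α + torusPoint K (displacement ((x, b) :: l)) := by
      rw [displacement_cons, nextBlock, add_assoc, map_add]
    rw [hend] at htravel
    refine (congrArg (IsUnitFlow (torus N) _ _) ?_).mp htravel
    ext e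
    simp only [traceSum, mismatchFlow, Pi.add_apply, wrapFlow]
    ring

lemma vol_mismatchFlow_le (l : List (Bou M × Bou M)) (α : Fin K × Fin K) (y : Bou M) :
    vol (mismatchFlow N α y l) ≤ (mismatches y l * (2 * M) : ℕ) := by
  induction l generalizing α y with
  | nil => simp [mismatchFlow, vol]
  | cons a l ih =>
    obtain ⟨x, b⟩ := a
    rw [mismatchFlow, mismatches, vol_add, add_mul, Nat.cast_add]
    refine add_le_add ((vol_shortestFlow_le _ _).trans ?_) (ih _ _)
    split_ifs with hyx
    · simp [hyx, torusDist_self]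
    · rw [one_mul]
      exact_mod_cast torusDist_gate_le α y x

lemma torusDist_gate_nextBlock_le (hK : M * K ≤ N) (hN : N ≤ M * K + M) (α : Fin K × Fin K)
    (b : Bou M) :
    (torusDist (gate N α b) (gate N (nextBlock α b) b.reflect) : ℤ) ≤
      M * (|((α.1 : ℕ) + b.dir.1) / (K : ℤ)| + |((α.2 : ℕ) + b.dir.2) / (K : ℤ)|) := by
  rw [mul_add, torusDist, gate, gate, nextBlock, blockIdx_add, Bou.offset_reflect, Nat.cast_add]
  exact add_le_add (cycleDist_residue_wrap_le hK hN _ _ _) (cycleDist_residue_wrap_le hK hN _ _ _)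

lemma Bou.abs_dir_add_abs_dir (b : Bou M) : |b.dir.1| + |b.dir.2| = 1 := by
  obtain ⟨s, j⟩ := b
  cases s <;> rfl

lemma sum_vol_wrapFlow_le (hK : M * K ≤ N) (hN : N ≤ M * K + M) (b : Bou M) :
    ∑ α : Fin K × Fin K, vol (wrapFlow N α b) ≤ N := by
  have hdist : ∑ α : Fin K × Fin K,
      (torusDist (gate N α b) (gate N (nextBlock α b) b.reflect) : ℤ) ≤ N :=
    calc _ ≤ ∑ α : Fin K × Fin K, (M : ℤ) *
          (|((α.1 : ℕ) + b.dir.1) / (K : ℤ)| + |((α.2 : ℕ) + b.dir.2) / (K : ℤ)|) :=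
          Finset.sum_le_sum fun α _ => torusDist_gate_nextBlock_le hK hN α b
      _ = M * K * (|b.dir.1| + |b.dir.2|) := by
          rw [← Finset.mul_sum, Finset.sum_add_distrib, Fintype.sum_prod_type,
            Fintype.sum_prod_type_right]
          simp only [Finset.sum_const, Finset.card_univ, Fintype.card_fin, nsmul_eq_mul,
            ← Finset.mul_sum, sum_abs_add_ediv]
          ring
      _ ≤ N := by
          rw [b.abs_dir_add_abs_dir, mul_one]
          exact_mod_cast hK
  refine (Finset.sum_le_sum fun α _ => vol_shortestFlow_le _ _).trans ?_
  exact_mod_cast hdist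

end Travel

/-! ### Endpoint of an itinerary -/

section Drift

variable {M : ℕ}

/-- The direction `b.dir`, as a real vector. -/
def Bou.dirVec (b : Bou M) : ℝ × ℝ := (b.dir.1, b.dir.2)

lemma Bou.pos_sub_pos_reflect (b : Bou M) : b.pos - b.reflect.pos = (M : ℝ) • b.dirVec := by
  obtain ⟨s, j⟩ := b
  cases s <;> simp [Bou.pos, Bou.reflect, Side.opposite, Bou.dirVec, Bou.dir] <;> ring

lemma Bou.norm_dirVec_le (b : Bou M) : ‖b.dirVec‖ ≤ 1 := by
  obtain ⟨s, j⟩ := b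
  cases s <;> simp [Bou.dirVec, Bou.dir, Prod.norm_def]

-- Since `Q` is balanced, entrances may be replaced by reflected exits in the sum.
lemma drift_of_balanced {Q : Transport M} (hQ : Q ∈ balanced M) :
    drift Q = (M : ℝ)⁻¹ • ∑ a : Bou M × Bou M, (Q a.1 a.2 : ℝ) • a.2.dirVec := by
  have hreflect : ∑ b₁, ∑ b₂, (Q b₁ b₂ : ℝ) • b₁.pos = ∑ b₁, ∑ b₂, (Q b₁ b₂ : ℝ) • b₂.reflect.pos :=
    calc ∑ b₁, ∑ b₂, (Q b₁ b₂ : ℝ) • b₁.pos = ∑ b, (Q.entMarginal b : ℝ) • b.pos := by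
          simp only [Transport.entMarginal, NNReal.coe_sum, Finset.sum_smul]
      _ = ∑ b : Bou M, (Q.exiMarginal b.reflect : ℝ) • b.reflect.reflect.pos := by
          simp only [exiMarginal_reflect hQ, Bou.reflect_reflect]
      _ = ∑ b : Bou M, (Q.exiMarginal b : ℝ) • b.reflect.pos :=
          Bou.sum_reflect fun b => (Q.exiMarginal b : ℝ) • b.reflect.pos
      _ = _ := by
          rw [Finset.sum_comm]
          simp only [Transport.exiMarginal, NNReal.coe_sum, Finset.sum_smul]
  have hsum : ∑ b₁, ∑ b₂, (Q b₁ b₂ : ℝ) • (b₂.pos - b₁.pos) =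
      (M : ℝ) • ∑ a : Bou M × Bou M, (Q a.1 a.2 : ℝ) • a.2.dirVec := by
    simp only [smul_sub, Finset.sum_sub_distrib, hreflect]
    simp only [← Finset.sum_sub_distrib, ← smul_sub, Bou.pos_sub_pos_reflect, Finset.smul_sum,
      smul_comm (M : ℝ)]
    exact (Fintype.sum_prod_type fun a : Bou M × Bou M =>
      (Q a.1 a.2 : ℝ) • (M : ℝ) • a.2.dirVec).symm
  rw [drift, hsum, smul_smul]
  congr 1
  field_simp

lemma displacement_near_drift {Q : Transport M} (hQ : Q ∈ balanced M) {l : List (Bou M × Bou M)}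
    {N : ℕ} {C : ℝ}
    (hl : ∀ a, (l.count a : ℝ) ≤ N / (M : ℝ) ^ 2 * Q a.1 a.2 ∧
      N / (M : ℝ) ^ 2 * Q a.1 a.2 ≤ l.count a + C) :
    ‖(M : ℝ) • (((displacement l).1 : ℝ), ((displacement l).2 : ℝ)) - (N : ℝ) • drift Q‖ ≤
      M * (Fintype.card (Bou M × Bou M) * C) := by
  have hdisp : (((displacement l).1 : ℝ), ((displacement l).2 : ℝ)) =
      ∑ a, (l.count a : ℝ) • a.2.dirVec := by
    ext <;> simp [displacement_eq, Prod.fst_sum, Prod.snd_sum, Bou.dirVec]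
  have hsplit : (M : ℝ) • (((displacement l).1 : ℝ), ((displacement l).2 : ℝ)) - (N : ℝ) • drift Q =
      (M : ℝ) • ∑ a : Bou M × Bou M,
        ((l.count a : ℝ) - N / (M : ℝ) ^ 2 * Q a.1 a.2) • a.2.dirVec := by
    have hcoeff : (N : ℝ) * (M : ℝ)⁻¹ = M * (N / (M : ℝ) ^ 2) := by field_simp
    rw [hdisp, drift_of_balanced hQ, smul_smul, hcoeff, mul_smul, ← smul_sub, Finset.smul_sum,
      ← Finset.sum_sub_distrib]
    simp only [sub_smul, mul_smul]
  rw [hsplit, norm_smul, Real.norm_natCast, ← nsmul_eq_mul (Fintype.card _), ← Finset.card_univ]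
  gcongr
  refine norm_sum_le_of_le _ (fun a _ => ?_) |>.trans (Finset.sum_const C).le
  have hcount : |(l.count a : ℝ) - N / (M : ℝ) ^ 2 * Q a.1 a.2| ≤ C :=
    abs_le.2 ⟨by linarith [(hl a).2], by linarith [(hl a).1, (hl a).2]⟩
  calc _ = |(l.count a : ℝ) - N / (M : ℝ) ^ 2 * Q a.1 a.2| * ‖a.2.dirVec‖ := norm_smul _ _
    _ ≤ C * 1 := mul_le_mul hcount a.2.norm_dirVec_le (norm_nonneg _) ((abs_nonneg _).trans hcount)
    _ = C := mul_one C

end Drift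

section Endpoint

variable {M N K n : ℕ}

lemma abs_mul_div_sub_le (hM : 0 < M) (x : ℕ) : |(M : ℤ) * ((x / M : ℕ) : ℤ) - x| ≤ M := by
  have hmod := Nat.mod_lt x hM
  have hdiv : (M : ℤ) * ((x / M : ℕ) : ℤ) + ((x % M : ℕ) : ℤ) = x := by
    exact_mod_cast Nat.div_add_mod x M
  rw [abs_le]
  constructor <;> omega

lemma abs_sub_div_mul_le (hn : 0 < n) (hnN : n ≤ N) {u c : ℤ} (hc : 0 ≤ c ∧ c ≤ n)
    (hu : u / ((N / n : ℕ) : ℤ) = c) : |(u : ℝ) - N / n * c| ≤ N / n + n := by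
  have hn' : (0 : ℝ) < n := by exact_mod_cast hn
  have hc₀ : (0 : ℝ) ≤ c := by exact_mod_cast hc.1
  have hcn : (c : ℝ) ≤ n := by exact_mod_cast hc.2
  have hfloor : ((N / n : ℕ) : ℝ) ≤ N / n := Nat.cast_div_le
  have hceil : (N : ℝ) / n ≤ ((N / n : ℕ) : ℝ) + 1 := by
    rw [div_le_iff₀ hn']
    exact_mod_cast (Nat.lt_mul_of_div_lt (Nat.lt_succ_self (N / n)) hn).le
  have hpos : (0 : ℤ) < ((N / n : ℕ) : ℤ) := Int.natCast_pos.2 (Nat.div_pos hnN hn)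
  generalize N / n = m at hu hfloor hceil hpos
  have hlower : (m : ℝ) * c ≤ u := by
    rw [← hu]
    exact_mod_cast Int.mul_ediv_self_le hpos.ne'
  have hupper : (u : ℝ) < m * c + m := by
    rw [← hu]
    exact_mod_cast Int.lt_mul_ediv_self_add hpos
  have hfloor_mul := mul_le_mul_of_nonneg_right hfloor hc₀
  have hceil_mul := mul_le_mul_of_nonneg_right hceil hc₀
  rw [abs_le]
  constructor <;> linarith

lemma abs_add_mul_ediv_sub_le (hn : 0 < n) (hnN : n ≤ N) {u k : ℤ} {r : ℝ}
    (hu : u / ((N / n : ℕ) : ℤ) = k % n) (hr : r ∈ Set.Icc ((k : ℝ) / n) ((k + 1) / n)) :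
    |(u : ℝ) + N * ((k / n : ℤ) : ℝ) - N * r| ≤ 2 * N / n + n := by
  have hn' : (n : ℝ) ≠ 0 := by exact_mod_cast hn.ne'
  have hnz : (0 : ℤ) < n := by exact_mod_cast hn
  have hk : (n : ℝ) * ((k / n : ℤ) : ℝ) + ((k % n : ℤ) : ℝ) = k := by
    exact_mod_cast Int.mul_ediv_add_emod k n
  have hNk : (N : ℝ) * ((k : ℝ) / n) = N * ((k / n : ℤ) : ℝ) + N / n * ((k % n : ℤ) : ℝ) := by
    rw [← hk]
    field_simp
  have hcell := abs_sub_div_mul_le hn hnN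
    ⟨Int.emod_nonneg k hnz.ne', (Int.emod_lt_of_pos k hnz).le⟩ hu
  have hlower : (N : ℝ) * ((k : ℝ) / n) ≤ N * r := by gcongr; exact hr.1
  have hupper : (N : ℝ) * r ≤ N * ((k : ℝ) / n) + N / n := by
    calc (N : ℝ) * r ≤ N * (((k : ℝ) + 1) / n) := by gcongr; exact hr.2
      _ = _ := by ring
  have htwo : 2 * (N : ℝ) / n = N / n + N / n := by ring
  rw [abs_le] at hcell ⊢
  constructor <;> linarith

lemma abs_sub_mul_ediv_le [NeZero K] (hM : 0 < M) (hK : M * K ≤ N) (hN : N ≤ M * K + M) (a : Fin K)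
    {d : ℤ} {r C : ℝ} (hd : |(M : ℝ) * d - N * r| ≤ C) :
    |((N : ℝ) - M * K) * ((((a : ℕ) + d) / K : ℤ) : ℝ)| ≤ M + C + 2 * M * |r| := by
  have hM' : (0 : ℝ) < M := by exact_mod_cast hM
  have hKz : (0 : ℤ) < K := by exact_mod_cast Nat.pos_of_ne_zero (NeZero.ne K)
  have hK' : (1 : ℝ) ≤ K := by exact_mod_cast hKz
  have hgap : |(N : ℝ) - M * K| ≤ M := by
    rw [abs_le]
    have hlower : (M * K : ℝ) ≤ N := by exact_mod_cast hK
    have hupper : (N : ℝ) ≤ M * K + M := by exact_mod_cast hN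
    constructor <;> linarith
  have hquot : (K : ℝ) * |((((a : ℕ) + d) / K : ℤ) : ℝ)| ≤ K + |(d : ℝ)| := by
    have hdiv := Int.mul_ediv_add_emod ((a : ℕ) + d) K
    have hmod := Int.emod_nonneg ((a : ℕ) + d) hKz.ne'
    have hmod' := Int.emod_lt_of_pos ((a : ℕ) + d) hKz
    have ha := a.isLt
    have habs : |(K : ℤ) * (((a : ℕ) + d) / K)| ≤ K + |d| := by
      rw [abs_le]
      constructor <;> linarith [neg_abs_le d, le_abs_self d]
    rw [abs_mul, abs_of_pos hKz] at habs
    exact_mod_cast habs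
  have hMd : M * |(d : ℝ)| ≤ C + N * |r| := by
    have hsub := abs_sub_abs_le_abs_sub ((M : ℝ) * d) (N * r)
    rw [abs_mul, abs_mul, Nat.abs_cast, Nat.abs_cast] at hsub
    linarith
  have hNr : (N : ℝ) * |r| ≤ K * (2 * M * |r|) := by
    have hMK : (N : ℝ) ≤ K * (2 * M) := by
      have hNK : (N : ℝ) ≤ M * K + M := by exact_mod_cast hN
      nlinarith
    calc (N : ℝ) * |r| ≤ K * (2 * M) * |r| := by gcongr
      _ = _ := by ring
  have hC : C ≤ K * C := le_mul_of_one_le_left ((abs_nonneg _).trans hd) hK'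
  rw [abs_mul]
  refine le_of_mul_le_mul_left (a := (K : ℝ)) ?_ (by linarith)
  calc (K : ℝ) * (|(N : ℝ) - M * K| * |((((a : ℕ) + d) / K : ℤ) : ℝ)|)
      = |(N : ℝ) - M * K| * (K * |((((a : ℕ) + d) / K : ℤ) : ℝ)|) := by ring
    _ ≤ M * (K + |(d : ℝ)|) := by gcongr
    _ ≤ K * (M + C + 2 * M * |r|) := by linarith

lemma cycleDist_endpoint_le [NeZero N] [NeZero K] (hM : 0 < M) (hK : M * K ≤ N)
    (hN : N ≤ M * K + M) (hn : 0 < n) (hnN : n ≤ N) (v w : Fin N) (a : Fin K)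
    (ha : (a : ℕ) = v / M) {d k o : ℤ} {r C : ℝ} (hd : |(M : ℝ) * d - N * r| ≤ C)
    (hr : r ∈ Set.Icc ((k : ℝ) / n) ((k + 1) / n))
    (hu : (((w - v : Fin N) : ℕ) : ℤ) / ((N / n : ℕ) : ℤ) = k % n)
    (ho : -1 ≤ o ∧ o ≤ M - 1) :
    (cycleDist (residue N (M * (((a : ℕ) + d) % K) + o)) w : ℝ) ≤
      2 * N / n + (n + 2 * C + 3 * M + 2 * M * |r|) := by
  set u : ℤ := (((w - v : Fin N) : ℕ) : ℤ)
  have hw : residue N ((v : ℕ) + u + N * (k / n)) = w := by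
    have hturns : residue N (N * (k / n)) = 0 := by
      rw [← map_zero (residue N), residue_eq_iff]
      simp
    rw [map_add, map_add, hturns, residue_natCast_val, residue_natCast_val]
    simp
  have hdist := cycleDist_residue_le (N := N)
    (M * ((a : ℕ) + d) + o + (N - M * K) * (((a : ℕ) + d) / K)) ((v : ℕ) + u + N * (k / n))
  rw [hw, ← residue_mul_emod_add] at hdist
  have hdist' : (cycleDist (residue N (M * (((a : ℕ) + d) % K) + o)) w : ℝ) ≤
      |(M : ℝ) * ((a : ℕ) + d) + o + (N - M * K) * ((((a : ℕ) + d) / K : ℤ) : ℝ) -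
        ((v : ℕ) + u + N * ((k / n : ℤ) : ℝ))| := by
    exact_mod_cast hdist
  refine hdist'.trans ?_
  have hstart : |(M : ℝ) * (a : ℕ) - (v : ℕ)| ≤ M := by
    rw [ha]
    exact_mod_cast abs_mul_div_sub_le hM (v : ℕ)
  have hcell := abs_add_mul_ediv_sub_le hn hnN hu hr
  have hturns := abs_sub_mul_ediv_le hM hK hN a hd
  have ho₁ : (-1 : ℝ) ≤ o := by exact_mod_cast ho.1
  have ho₂ : (o : ℝ) ≤ M - 1 := by exact_mod_cast ho.2
  have hM' : (1 : ℝ) ≤ M := by exact_mod_cast hM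
  rw [abs_le] at hstart hcell hturns hd ⊢
  constructor <;> linarith

end Endpoint

/-! ### Distributing the components of a transport over the pairs of vertices -/

section Shares

variable {N n : ℕ}

lemma card_filter_div_eq {m : ℕ} (hm : 0 < m) (hmn : n * m ≤ N) {c : ℤ} (hc : 0 ≤ c) (hcn : c < n) :
    (Finset.univ.filter fun u : Fin N => ((u : ℕ) : ℤ) / (m : ℤ) = c).card = m := by
  lift c to ℕ using hc
  have hdiv (x : ℕ) : (x : ℤ) / (m : ℤ) = c ↔ c * m ≤ x ∧ x < c * m + m := by
    rw [← Int.natCast_ediv, Nat.cast_inj, Nat.div_eq_iff hm]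
    omega
  have himage : (Finset.univ.filter fun u : Fin N => ((u : ℕ) : ℤ) / (m : ℤ) = c).image Fin.val =
      Finset.Ico (c * m) (c * m + m) := by
    ext x
    simp only [Finset.mem_image, Finset.mem_filter, Finset.mem_univ, true_and, Finset.mem_Ico, hdiv]
    refine ⟨fun ⟨_, hu, hux⟩ => hux ▸ hu, fun hx => ⟨⟨x, ?_⟩, hx, rfl⟩⟩
    have : (c + 1) * m ≤ n * m := Nat.mul_le_mul_right _ (by exact_mod_cast hcn)
    linarith [hx.2]
  rw [← Finset.card_image_of_injective _ Fin.val_injective, himage]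
  simp

/-- The cell of the displacement `u`, in a subdivision of the torus into cells of side `N / n`.
The division truncates, so a displacement close to `N` lies in none of the `n ^ 2` proper cells. -/
def cellOf (n : ℕ) (u : TorusVertex N) : ℤ × ℤ :=
  (((u.1 : ℕ) : ℤ) / ((N / n : ℕ) : ℤ), ((u.2 : ℕ) : ℤ) / ((N / n : ℕ) : ℤ))

/-- The share of the flow with displacement `u` which is carried by the component `k`. -/
def share (n : ℕ) (p : ℤ × ℤ → ℝ≥0) (k : ℤ × ℤ) (u : TorusVertex N) : ℝ≥0∞ :=
  if (k.1 % (n : ℤ), k.2 % (n : ℤ)) = cellOf n u then (n : ℝ≥0∞) ^ 2 * p k else 0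

lemma sum_share_le_one (hn : 0 < n) {p : ℤ × ℤ → ℝ≥0} {I : Finset (ℤ × ℤ)}
    (hp : ∀ c : ℤ × ℤ, ∑ k ∈ I with (k.1 % (n : ℤ), k.2 % (n : ℤ)) = c, p k ≤ ((n : ℝ≥0) ^ 2)⁻¹)
    (u : TorusVertex N) : ∑ k ∈ I, share n p k u ≤ 1 := by
  have hcell := ENNReal.coe_le_coe.2 (hp (cellOf n u))
  rw [ENNReal.ofNNReal_finsetSum] at hcell
  unfold share
  rw [← Finset.sum_filter, ← Finset.mul_sum]
  calc _ ≤ (n : ℝ≥0∞) ^ 2 * (((n : ℝ≥0) ^ 2)⁻¹ : ℝ≥0) := by gcongr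
    _ = 1 := by
      rw [ENNReal.coe_inv (by positivity)]
      push_cast
      exact ENNReal.mul_inv_cancel (by positivity) (by finiteness)

lemma card_filter_cellOf_eq (hn : 0 < n) (hnN : n ≤ N) (k : ℤ × ℤ) :
    (Finset.univ.filter fun u : TorusVertex N =>
      (k.1 % (n : ℤ), k.2 % (n : ℤ)) = cellOf n u).card = (N / n) * (N / n) := by
  have hn' : (0 : ℤ) < n := by exact_mod_cast hn
  have hm : 0 < N / n := Nat.div_pos hnN hn
  have hmn : n * (N / n) ≤ N := Nat.mul_div_le N n
  have hprod : (Finset.univ.filter fun u : TorusVertex N =>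
      (k.1 % (n : ℤ), k.2 % (n : ℤ)) = cellOf n u) =
      (Finset.univ.filter fun u : Fin N => ((u : ℕ) : ℤ) / ((N / n : ℕ) : ℤ) = k.1 % n) ×ˢ
      (Finset.univ.filter fun u : Fin N => ((u : ℕ) : ℤ) / ((N / n : ℕ) : ℤ) = k.2 % n) := by
    ext u
    simp [cellOf, Prod.ext_iff, eq_comm]
  rw [hprod, Finset.card_product,
    card_filter_div_eq hm hmn (Int.emod_nonneg _ hn'.ne') (Int.emod_lt_of_pos _ hn'),
    card_filter_div_eq hm hmn (Int.emod_nonneg _ hn'.ne') (Int.emod_lt_of_pos _ hn')]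

lemma sum_share (hn : 0 < n) (hnN : n ≤ N) (p : ℤ × ℤ → ℝ≥0) (k : ℤ × ℤ) :
    ∑ u : TorusVertex N, share n p k u = (((N / n : ℕ) : ℝ≥0∞) * n) ^ 2 * p k := by
  unfold share
  rw [← Finset.sum_filter, Finset.sum_const, card_filter_cellOf_eq hn hnN, nsmul_eq_mul]
  push_cast
  ring

lemma sum_share_le (hn : 0 < n) (hnN : n ≤ N) (p : ℤ × ℤ → ℝ≥0) (k : ℤ × ℤ) :
    ∑ u : TorusVertex N, share n p k u ≤ (N : ℝ≥0∞) ^ 2 * p k := by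
  rw [sum_share hn hnN]
  gcongr
  exact_mod_cast Nat.div_mul_le_self N n

lemma sq_le_add_div_mul_sq (hn : 0 < n) : N ^ 2 ≤ 2 * n * N + (N / n * n) ^ 2 := by
  have hle : N / n * n ≤ N := Nat.div_mul_le_self N n
  have hge : N ≤ N / n * n + n := by
    have := Nat.div_add_mod' N n
    have := Nat.mod_lt N hn
    omega
  nlinarith

lemma sum_one_sub_share_le (hn : 0 < n) (hnN : n ≤ N) {p : ℤ × ℤ → ℝ≥0} {I : Finset (ℤ × ℤ)}
    (hshare : ∀ u : TorusVertex N, ∑ k ∈ I, share n p k u ≤ 1) {ε : ℝ≥0∞}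
    (hε : 1 ≤ ∑ k ∈ I, (p k : ℝ≥0∞) + ε) :
    ∑ u : TorusVertex N, (1 - ∑ k ∈ I, share n p k u) ≤ 2 * n * N + ε * (N : ℝ≥0∞) ^ 2 := by
  have hsum : ∑ u : TorusVertex N, ∑ k ∈ I, share n p k u =
      (((N / n : ℕ) : ℝ≥0∞) * n) ^ 2 * ∑ k ∈ I, (p k : ℝ≥0∞) := by
    rw [Finset.sum_comm, Finset.mul_sum]
    exact Finset.sum_congr rfl fun k _ => sum_share hn hnN p k
  have hfin : ∑ u : TorusVertex N, ∑ k ∈ I, share n p k u ≠ ∞ :=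
    (ENNReal.sum_lt_top.2 fun u _ => (hshare u).trans_lt ENNReal.one_lt_top).ne
  have hadd : ∑ u : TorusVertex N, (1 - ∑ k ∈ I, share n p k u) +
      ∑ u : TorusVertex N, ∑ k ∈ I, share n p k u = (N : ℝ≥0∞) ^ 2 := by
    simp only [← Finset.sum_add_distrib, tsub_add_cancel_of_le (hshare _), Finset.sum_const,
      nsmul_one, Finset.card_univ, card_torusVertex]
  have hsq : (N : ℝ≥0∞) ^ 2 ≤ 2 * n * N + (((N / n : ℕ) : ℝ≥0∞) * n) ^ 2 := by
    exact_mod_cast sq_le_add_div_mul_sq (N := N) hn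
  have hle : (((N / n : ℕ) : ℝ≥0∞) * n) ^ 2 ≤ (N : ℝ≥0∞) ^ 2 := by
    gcongr
    exact_mod_cast Nat.div_mul_le_self N n
  rw [← ENNReal.add_le_add_iff_right hfin, hadd]
  calc (N : ℝ≥0∞) ^ 2 ≤ 2 * n * N + (((N / n : ℕ) : ℝ≥0∞) * n) ^ 2 * 1 := by rwa [mul_one]
    _ ≤ 2 * n * N + (((N / n : ℕ) : ℝ≥0∞) * n) ^ 2 * (∑ k ∈ I, (p k : ℝ≥0∞) + ε) := by gcongr
    _ = 2 * n * N + ε * (((N / n : ℕ) : ℝ≥0∞) * n) ^ 2 +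
        ∑ u : TorusVertex N, ∑ k ∈ I, share n p k u := by
      rw [hsum]
      ring
    _ ≤ _ := by gcongr

end Shares

section Covered

variable {M N K : ℕ}

/-- The vertices which lie in one of the blocks. -/
def covered (M K N : ℕ) : Finset (TorusVertex N) :=
  Finset.univ.filter fun v => (v.1 : ℕ) < M * K ∧ (v.2 : ℕ) < M * K

lemma mem_covered {v : TorusVertex N} :
    v ∈ covered M K N ↔ (v.1 : ℕ) < M * K ∧ (v.2 : ℕ) < M * K := by
  simp [covered]

lemma card_covered_compl_le (hN : N ≤ M * K + M) : (covered M K N)ᶜ.card ≤ 2 * M * N := by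
  let S : Finset (Fin N) := Finset.univ.filter fun i => M * K ≤ i
  have hS : S.card ≤ M :=
    calc S.card ≤ (Finset.Ico (M * K) (M * K + M)).card :=
          Finset.card_le_card_of_injOn Fin.val
            (fun i hi => Finset.mem_coe.2 (Finset.mem_Ico.2
              ⟨(Finset.mem_filter.1 hi).2, i.isLt.trans_le hN⟩)) Fin.val_injective.injOn
      _ = M := by simp
  have hsub : (covered M K N)ᶜ ⊆ S ×ˢ Finset.univ ∪ Finset.univ ×ˢ S := by
    intro v hv
    simp only [Finset.mem_compl, mem_covered, not_and_or, not_lt] at hv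
    simpa [S] using hv
  calc _ ≤ _ := Finset.card_le_card hsub
    _ ≤ S.card * N + N * S.card := by
      refine (Finset.card_union_le _ _).trans_eq ?_
      simp
    _ ≤ M * N + N * M := by gcongr
    _ = _ := by ring

variable [NeZero K]

/-- The block of a covered vertex (a block without meaning for the other vertices). -/
def homeBlock (M K : ℕ) [NeZero K] {N : ℕ} (v : TorusVertex N) : Fin K × Fin K :=
  torusPoint K (((v.1 : ℕ) / M : ℕ), ((v.2 : ℕ) / M : ℕ))

lemma homeBlock_val {v : TorusVertex N} (hv : v ∈ covered M K N) :
    ((homeBlock M K v).1 : ℕ) = (v.1 : ℕ) / M ∧ ((homeBlock M K v).2 : ℕ) = (v.2 : ℕ) / M := by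
  have hval (x : ℕ) (hx : x < M * K) : (residue K ((x / M : ℕ) : ℤ) : ℕ) = x / M := by
    have hlt : x / M < K := Nat.div_lt_of_lt_mul hx
    zify
    rw [residue_val, ← Int.natCast_ediv]
    exact Int.emod_eq_of_lt (by positivity) (by exact_mod_cast hlt)
  rw [mem_covered] at hv
  exact ⟨hval _ hv.1, hval _ hv.2⟩

lemma card_filter_homeBlock_le (hM : 0 < M) (β : Fin K × Fin K) :
    {v ∈ covered M K N | homeBlock M K v = β}.card ≤ M ^ 2 := by
  refine (Finset.card_le_card_of_injOn (t := Finset.range M ×ˢ Finset.range M)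
    (fun v => ((v.1 : ℕ) % M, (v.2 : ℕ) % M)) ?_ ?_).trans_eq (by simp [sq])
  · intro v _
    simp [Nat.mod_lt _ hM]
  · intro v hv w hw hmod
    simp only [Finset.coe_filter, Set.mem_ofPred_eq] at hv hw
    obtain ⟨hv₁, hv₂⟩ := hv.2 ▸ homeBlock_val hv.1
    obtain ⟨hw₁, hw₂⟩ := hw.2 ▸ homeBlock_val hw.1
    simp only [Prod.mk.injEq] at hmod
    refine Prod.ext (Fin.ext ?_) (Fin.ext ?_)
    · rw [← Nat.div_add_mod (v.1 : ℕ) M, ← hv₁, hw₁, hmod.1, Nat.div_add_mod]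
    · rw [← Nat.div_add_mod (v.2 : ℕ) M, ← hv₂, hw₂, hmod.2, Nat.div_add_mod]

lemma sum_mul_homeBlock_le (hM : 0 < M) {ω : TorusVertex N → ℝ≥0∞} {c : ℝ≥0∞}
    (hω : ∀ v, ω v ≤ if v ∈ covered M K N then c else 0) (G : Fin K × Fin K → ℝ≥0∞) :
    ∑ v, ω v * G (homeBlock M K v) ≤ c * ((M : ℝ≥0∞) ^ 2 * ∑ β, G β) :=
  calc ∑ v, ω v * G (homeBlock M K v)
      ≤ ∑ v, (if v ∈ covered M K N then c else 0) * G (homeBlock M K v) := by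
        gcongr with v _
        exact hω v
    _ = c * ∑ v ∈ covered M K N, G (homeBlock M K v) := by
        simp only [ite_mul, zero_mul, Finset.sum_ite_mem, Finset.univ_inter, Finset.mul_sum]
    _ = c * ∑ β, ({v ∈ covered M K N | homeBlock M K v = β}.card : ℝ≥0∞) * G β := by
        simp_rw [← nsmul_eq_mul, ← Finset.sum_const]
        rw [← Finset.sum_fiberwise (covered M K N) (homeBlock M K)]
        congr! 3 with β _ v hv
        rw [(Finset.mem_filter.1 hv).2]
    _ ≤ c * ((M : ℝ≥0∞) ^ 2 * ∑ β, G β) := by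
        rw [Finset.mul_sum (f := G)]
        gcongr with β _
        exact_mod_cast card_filter_homeBlock_le hM β

lemma torusDist_gate_homeBlock_le [NeZero N] (hM : 0 < M) {v : TorusVertex N}
    (hv : v ∈ covered M K N) (y : Bou M) :
    torusDist v (gate N (homeBlock M K v) y) ≤ 2 * M := by
  obtain ⟨hα₁, hα₂⟩ := homeBlock_val hv
  obtain ⟨⟨hy₁, hy₁'⟩, hy₂, hy₂'⟩ := y.offset_mem
  have hcoord (x : ℕ) {o : ℤ} (ho : -1 ≤ o) (ho' : o ≤ M - 1) :
      |(x : ℤ) - (M * ((x / M : ℕ) : ℤ) + o)| ≤ M := by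
    have hmod := Nat.mod_lt x hM
    have hdiv : (M : ℤ) * ((x / M : ℕ) : ℤ) + ((x % M : ℕ) : ℤ) = x := by
      exact_mod_cast Nat.div_add_mod x M
    rw [abs_le]
    omega
  have hpoint : v = torusPoint N ((v.1 : ℕ), (v.2 : ℕ)) := by
    simp [torusPoint_apply, residue_natCast_val]
  have hdist := torusDist_torusPoint_le (N := N) ((v.1 : ℕ), (v.2 : ℕ))
    (M * (blockIdx (homeBlock M K v)).1 + y.offset.1,
      M * (blockIdx (homeBlock M K v)).2 + y.offset.2)
  rw [← hpoint] at hdist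
  simp only [blockIdx, hα₁, hα₂] at hdist
  have := hcoord v.1 hy₁ hy₁'
  have := hcoord v.2 hy₂ hy₂'
  simp only [gate, blockPt, blockIdx, hα₁, hα₂]
  omega

end Covered

section Weights

variable {M N K n : ℕ}

/-- The share of the flow from `v` to `w` which follows the itinerary of the component `k`. The
flow from an uncovered vertex follows no itinerary. -/
def weight (M K n : ℕ) (p : ℤ × ℤ → ℝ≥0) (v w : TorusVertex N) (k : ℤ × ℤ) : ℝ≥0∞ :=
  if v ∈ covered M K N then share n p k (w - v) else 0

lemma mem_covered_of_weight_ne_zero {p : ℤ × ℤ → ℝ≥0} {v w : TorusVertex N} {k : ℤ × ℤ}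
    (h : weight M K n p v w k ≠ 0) : v ∈ covered M K N :=
  (ite_ne_right_iff.1 h).1

lemma cellOf_sub_of_weight_ne_zero {p : ℤ × ℤ → ℝ≥0} {v w : TorusVertex N} {k : ℤ × ℤ}
    (h : weight M K n p v w k ≠ 0) : cellOf n (w - v) = (k.1 % (n : ℤ), k.2 % (n : ℤ)) :=
  (ite_ne_right_iff.1 (ite_ne_right_iff.1 h).2).1.symm

lemma sum_weight_le_one {p : ℤ × ℤ → ℝ≥0} {I : Finset (ℤ × ℤ)}
    (hshare : ∀ u : TorusVertex N, ∑ k ∈ I, share n p k u ≤ 1) (v w : TorusVertex N) :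
    ∑ k ∈ I, weight M K n p v w k ≤ 1 := by
  unfold weight
  split_ifs
  · exact hshare (w - v)
  · simp

variable [NeZero N]

lemma sum_weight_le (hn : 0 < n) (hnN : n ≤ N) (p : ℤ × ℤ → ℝ≥0) (k : ℤ × ℤ)
    (v : TorusVertex N) :
    ∑ w, weight M K n p v w k ≤ if v ∈ covered M K N then (N : ℝ≥0∞) ^ 2 * p k else 0 := by
  unfold weight
  split_ifs
  · exact (Equiv.sum_comp (Equiv.subRight v) (share n p k)).trans_le (sum_share_le hn hnN p k)
  · simp

lemma sum_one_sub_weight_le (hN : N ≤ M * K + M) (hn : 0 < n) (hnN : n ≤ N)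
    {p : ℤ × ℤ → ℝ≥0} {I : Finset (ℤ × ℤ)}
    (hshare : ∀ u : TorusVertex N, ∑ k ∈ I, share n p k u ≤ 1) {ε : ℝ≥0∞}
    (hε : 1 ≤ ∑ k ∈ I, (p k : ℝ≥0∞) + ε) :
    ∑ v : TorusVertex N, ∑ w, (1 - ∑ k ∈ I, weight M K n p v w k) ≤
      (N : ℝ≥0∞) ^ 2 * (2 * n * N + ε * (N : ℝ≥0∞) ^ 2 + 2 * M * N) := by
  have hvertex (v : TorusVertex N) : ∑ w, (1 - ∑ k ∈ I, weight M K n p v w k) ≤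
      (2 * n * N + ε * (N : ℝ≥0∞) ^ 2) + if v ∈ (covered M K N)ᶜ then (N : ℝ≥0∞) ^ 2 else 0 := by
    by_cases hv : v ∈ covered M K N
    · simp only [weight, hv, if_true, Finset.mem_compl, not_true_eq_false, if_false, add_zero]
      exact (Equiv.sum_comp (Equiv.subRight v) fun u => 1 - ∑ k ∈ I, share n p k u).trans_le
        (sum_one_sub_share_le hn hnN hshare hε)
    · simp [weight, hv, ← card_torusVertex]
  calc _ ≤ ∑ v : TorusVertex N, ((2 * n * N + ε * (N : ℝ≥0∞) ^ 2) +
        if v ∈ (covered M K N)ᶜ then (N : ℝ≥0∞) ^ 2 else 0) :=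
        Finset.sum_le_sum fun v _ => hvertex v
    _ = (N : ℝ≥0∞) ^ 2 * (2 * n * N + ε * (N : ℝ≥0∞) ^ 2) +
        ((covered M K N)ᶜ.card : ℝ≥0∞) * (N : ℝ≥0∞) ^ 2 := by
        rw [Finset.sum_add_distrib, Finset.sum_const, Finset.card_univ, nsmul_eq_mul,
          card_torusVertex, Finset.sum_ite_mem, Finset.univ_inter, Finset.sum_const, nsmul_eq_mul]
    _ ≤ (N : ℝ≥0∞) ^ 2 * (2 * n * N + ε * (N : ℝ≥0∞) ^ 2) + (2 * M * N) * (N : ℝ≥0∞) ^ 2 := by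
        gcongr
        exact_mod_cast card_covered_compl_le hN
    _ = _ := by ring

end Weights

/-! ### The main part and the remainder of the global flow -/

section Trips

variable {M N K : ℕ} [NeZero N] [NeZero K]

/-- The connections used on a trip from `v` to `w` by the itinerary `l`, other than those inside
a block and those from the exit of a block to the entrance of the next one. -/
def tripExtra (y : Bou M) (l : List (Bou M × Bou M)) (K : ℕ) [NeZero K] (v w : TorusVertex N) :
    TorusEdge N → ℝ≥0∞ :=
  shortestFlow v (gate N (homeBlock M K v) y) + mismatchFlow N (homeBlock M K v) y l +
    shortestFlow (gate N (homeBlock M K v + torusPoint K (displacement l)) (lastEntrance y l)) w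

lemma isUnitFlow_trip {g : Fin K × Fin K → Bou M → Bou M → TorusEdge N → ℝ≥0∞}
    (hg : ∀ α b₁ b₂, IsUnitFlow (torus N) (gate N α b₁) (gate N α b₂) (g α b₁ b₂))
    (y : Bou M) (l : List (Bou M × Bou M)) (v w : TorusVertex N) :
    IsUnitFlow (torus N) v w fun e =>
      traceSum (fun α x b => g α x b e) (homeBlock M K v) l +
        (traceSum (fun α _ b => wrapFlow N α b e) (homeBlock M K v) l + tripExtra y l K v w e) := by
  have htrip := ((isUnitFlow_shortestFlow v (gate N (homeBlock M K v) y)).trans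
    (isUnitFlow_travel hg l (homeBlock M K v) y)).trans (isUnitFlow_shortestFlow _ w)
  refine (congrArg (IsUnitFlow (torus N) _ _) ?_).mp htrip
  ext e
  simp only [tripExtra, Pi.add_apply]
  ring

end Trips

lemma IsUnitFlow.finsetSum_add {V E ι : Type} {G : Graph V E} {v w : V} {I : Finset ι}
    {m : ι → ℝ≥0∞} {f : ι → E → ℝ≥0∞} {f₀ : E → ℝ≥0∞} (hm : ∑ k ∈ I, m k ≤ 1)
    (hf : ∀ k ∈ I, IsUnitFlow G v w (f k)) (hf₀ : IsUnitFlow G v w f₀) :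
    IsUnitFlow G v w fun e => ∑ k ∈ I, m k * f k e + (1 - ∑ k ∈ I, m k) * f₀ e := by
  have hmix := IsUnitFlow.sum (J := Option I) (G := G) (v := v) (w := w)
    (m := fun j => j.elim (1 - ∑ k ∈ I, m k) fun k => m k)
    (f := fun j => j.elim f₀ fun k => f k) ?_ ?_
  · refine (congrArg (IsUnitFlow G _ _) ?_).mp hmix
    ext e
    rw [Fintype.sum_option, add_comm]
    exact congrArg (· + _) (Finset.sum_coe_sort I fun k => m k * f k e)
  · rw [Fintype.sum_option]
    simp only [Option.elim]
    rw [Finset.sum_coe_sort I m, tsub_add_cancel_of_le hm]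
  · rintro (_ | ⟨k, hk⟩)
    exacts [hf₀, hf k hk]

lemma sum_traceSum_le {M K : ℕ} [NeZero K] {φ : Fin K × Fin K → Bou M → Bou M → ℝ≥0∞}
    {Q : Transport M} {l : List (Bou M × Bou M)} {s r : ℝ≥0∞}
    (hl : ∀ a, s * (l.count a : ℝ≥0∞) ≤ r * Q a.1 a.2) :
    s * ∑ β, traceSum φ β l ≤
      r * ∑ a : Bou M × Bou M, (Q a.1 a.2 : ℝ≥0∞) * ∑ α, φ α a.1 a.2 := by
  rw [sum_traceSum, Finset.mul_sum, Finset.mul_sum]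
  simp only [← mul_assoc]
  exact Finset.sum_le_sum fun a _ => mul_le_mul_left (hl a) _

section Parts

variable {ι : Type} {M N K : ℕ} [NeZero K] {I : Finset ι}
  {W : TorusVertex N → TorusVertex N → ι → ℝ≥0∞} {l : ι → List (Bou M × Bou M)}

/-- The part of the global flow which uses the flows `g` of the legs: the flow from `v` to `w`
follows the itinerary `l k` with weight `W v w k`. -/
def mainPart (I : Finset ι) (W : TorusVertex N → TorusVertex N → ι → ℝ≥0∞)
    (l : ι → List (Bou M × Bou M)) (g : Fin K × Fin K → Bou M → Bou M → TorusEdge N → ℝ≥0∞) :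
    TorusEdge N → ℝ≥0∞ :=
  superpose fun v w e =>
    ∑ k ∈ I, W v w k * traceSum (fun α x b => g α x b e) (homeBlock M K v) (l k)

lemma mainPart_eq (g : Fin K × Fin K → Bou M → Bou M → TorusEdge N → ℝ≥0∞) (e : TorusEdge N) :
    mainPart I W l g e = ((N : ℝ≥0∞) ^ 3)⁻¹ * ∑ k ∈ I, ∑ v, (∑ w, W v w k) *
      traceSum (fun α x b => g α x b e) (homeBlock M K v) (l k) := by
  simp only [mainPart, superpose, ← Finset.mul_sum, Finset.sum_mul]
  rw [Finset.sum_comm (s := I)]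
  simp only [Finset.sum_comm (s := I)]

variable [NeZero N]

/-- The part of the global flow which completes the itineraries and, with the weight that they
leave over, joins the vertices directly. -/
def restPart (K : ℕ) [NeZero K] (I : Finset ι) (W : TorusVertex N → TorusVertex N → ι → ℝ≥0∞)
    (l : ι → List (Bou M × Bou M)) (y : Bou M) : TorusEdge N → ℝ≥0∞ :=
  superpose fun v w e => ∑ k ∈ I, W v w k * tripExtra y (l k) K v w e +
    (1 - ∑ k ∈ I, W v w k) * shortestFlow v w e

lemma isStdFlow_parts (hW : ∀ v w, ∑ k ∈ I, W v w k ≤ 1) (y : Bou M)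
    {g : Fin K × Fin K → Bou M → Bou M → TorusEdge N → ℝ≥0∞}
    (hg : ∀ α b₁ b₂, IsUnitFlow (torus N) (gate N α b₁) (gate N α b₂) (g α b₁ b₂)) :
    IsStdFlow N (mainPart I W l g +
      (mainPart (K := K) I W l (fun α _ b => wrapFlow N α b) + restPart K I W l y)) := by
  refine ⟨_, fun v w => IsUnitFlow.finsetSum_add (hW v w)
    (fun k _ => isUnitFlow_trip hg y (l k) v w) (isUnitFlow_shortestFlow v w), ?_⟩
  unfold mainPart restPart
  rw [← superpose_add, ← superpose_add]
  congr 1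
  ext v w e
  simp only [Pi.add_apply, mul_add, Finset.sum_add_distrib]
  ring

lemma mainPart_le (hM : 0 < M) {p : ι → ℝ≥0} {Q : ι → Transport M} {Q₀ : Transport M}
    (hW : ∀ k ∈ I, ∀ v, ∑ w, W v w k ≤ if v ∈ covered M K N then (N : ℝ≥0∞) ^ 2 * p k else 0)
    (hl : ∀ k ∈ I, ∀ a, (M : ℝ≥0∞) ^ 2 * ((l k).count a : ℝ≥0∞) ≤ N * Q k a.1 a.2)
    (hQ : ∀ b₁ b₂, ∑ k ∈ I, p k * Q k b₁ b₂ ≤ Q₀ b₁ b₂)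
    (g : Fin K × Fin K → Bou M → Bou M → TorusEdge N → ℝ≥0∞) (e : TorusEdge N) :
    mainPart I W l g e ≤ ∑ a : Bou M × Bou M, (Q₀ a.1 a.2 : ℝ≥0∞) * ∑ α, g α a.1 a.2 e := by
  have hN : (N : ℝ≥0∞) ≠ 0 := by simp [NeZero.ne N]
  calc mainPart I W l g e
      ≤ ((N : ℝ≥0∞) ^ 3)⁻¹ * ∑ k ∈ I, (N : ℝ≥0∞) ^ 2 * p k *
          (N * ∑ a : Bou M × Bou M, (Q k a.1 a.2 : ℝ≥0∞) * ∑ α, g α a.1 a.2 e) := by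
        rw [mainPart_eq]
        gcongr with k hk
        exact (sum_mul_homeBlock_le hM (hW k hk) fun β =>
          traceSum (fun α x b => g α x b e) β (l k)).trans
          (mul_le_mul_right (sum_traceSum_le (hl k hk)) _)
    _ = ((N : ℝ≥0∞) ^ 3)⁻¹ * (N : ℝ≥0∞) ^ 3 * ∑ k ∈ I, p k *
          ∑ a : Bou M × Bou M, (Q k a.1 a.2 : ℝ≥0∞) * ∑ α, g α a.1 a.2 e := by
        rw [mul_assoc, Finset.mul_sum (a := (N : ℝ≥0∞) ^ 3)]
        congr! 2
        ring
    _ = ∑ a : Bou M × Bou M, ((∑ k ∈ I, p k * Q k a.1 a.2 : ℝ≥0) : ℝ≥0∞) *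
          ∑ α, g α a.1 a.2 e := by
        rw [ENNReal.inv_mul_cancel (by simp [hN]) (by finiteness), one_mul]
        simp only [ENNReal.ofNNReal_finsetSum, ENNReal.coe_mul, Finset.sum_mul, mul_assoc]
        simp only [Finset.mul_sum (s := (Finset.univ : Finset (Bou M × Bou M)))]
        exact Finset.sum_comm
    _ ≤ _ := by
        gcongr with a _
        exact hQ a.1 a.2

lemma vol_finsetSum_add {E : Type} [Fintype E] (m : ι → ℝ≥0∞) (f : ι → E → ℝ≥0∞) (m₀ : ℝ≥0∞)
    (f₀ : E → ℝ≥0∞) :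
    vol (fun e => ∑ k ∈ I, m k * f k e + m₀ * f₀ e) =
      ∑ k ∈ I, m k * vol (f k) + m₀ * vol f₀ := by
  simp only [vol, Finset.sum_add_distrib, Finset.mul_sum]
  rw [Finset.sum_comm]

lemma vol_restPart_le (hW : ∀ v w, ∑ k ∈ I, W v w k ≤ 1) (y : Bou M) {A δ : ℝ≥0∞}
    (hA : ∀ k ∈ I, ∀ v w, W v w k ≠ 0 → vol (tripExtra y (l k) K v w) ≤ A)
    (hδ : ∑ v, ∑ w, (1 - ∑ k ∈ I, W v w k) ≤ (N : ℝ≥0∞) ^ 2 * δ) :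
    vol (restPart K I W l y) ≤ N * A + δ := by
  have hN : (N : ℝ≥0∞) ≠ 0 := by simp [NeZero.ne N]
  have hpair (v w : TorusVertex N) : ∑ k ∈ I, W v w k * vol (tripExtra y (l k) K v w) +
      (1 - ∑ k ∈ I, W v w k) * vol (shortestFlow v w) ≤ A + (1 - ∑ k ∈ I, W v w k) * N := by
    gcongr
    · calc _ ≤ ∑ k ∈ I, W v w k * A := by
            refine Finset.sum_le_sum fun k hk => ?_
            rcases eq_or_ne (W v w k) 0 with h₀ | h₀
            · simp [h₀]
            · gcongr
              exact hA k hk v w h₀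
        _ ≤ A := by
            rw [← Finset.sum_mul]
            exact mul_le_of_le_one_left' (hW v w)
    · exact (vol_shortestFlow_le v w).trans (by exact_mod_cast torusDist_le v w)
  calc vol (restPart K I W l y)
      ≤ ((N : ℝ≥0∞) ^ 3)⁻¹ * ∑ v, ∑ w, (A + (1 - ∑ k ∈ I, W v w k) * N) := by
        rw [restPart, vol_superpose]
        gcongr with v _ w _
        rw [vol_finsetSum_add]
        exact hpair v w
    _ = ((N : ℝ≥0∞) ^ 3)⁻¹ * ((N : ℝ≥0∞) ^ 4 * A +
          N * ∑ v, ∑ w, (1 - ∑ k ∈ I, W v w k)) := by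
        simp only [Finset.sum_add_distrib, Finset.sum_const, Finset.card_univ, nsmul_eq_mul,
          card_torusVertex, ← Finset.sum_mul]
        ring
    _ ≤ ((N : ℝ≥0∞) ^ 3)⁻¹ * ((N : ℝ≥0∞) ^ 4 * A + N * ((N : ℝ≥0∞) ^ 2 * δ)) := by gcongr
    _ = ((N : ℝ≥0∞) ^ 3)⁻¹ * (N : ℝ≥0∞) ^ 3 * (N * A + δ) := by ring
    _ = N * A + δ := by
        rw [ENNReal.inv_mul_cancel (by simp [hN]) (by finiteness), one_mul]

end Parts

/-! ### Global flows built from flows across the blocks -/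

section GlobalFlow

variable {M N K n : ℕ} {Q : Transport M} {C : ℕ} {l : List (Bou M × Bou M)}

/-- The part of the bound on the volume of `tripExtra` which does not grow with the size of the
torus, for an itinerary which uses the legs according to `Q` up to an error `C`. -/
def tripExcess (n : ℕ) (Q : Transport M) (C : ℕ) : ℝ≥0 :=
  2 * (n + 2 * (M * (Fintype.card (Bou M × Bou M) * C)) + 3 * M + 2 * M * ‖drift Q‖₊) +
    (2 * M + C * (2 * M))

lemma sq_mul_le_of_le_div_sq_mul (hM : 0 < M) {x q : ℝ≥0} (hx : (x : ℝ) ≤ N / (M : ℝ) ^ 2 * q) :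
    (M : ℝ≥0∞) ^ 2 * x ≤ N * q := by
  have hx' : (M : ℝ≥0) ^ 2 * x ≤ N * q :=
    calc (M : ℝ≥0) ^ 2 * x ≤ (M : ℝ≥0) ^ 2 * (N / (M : ℝ≥0) ^ 2 * q) := by
          gcongr
          exact_mod_cast hx
      _ = N * q := by field_simp
  exact_mod_cast hx'

variable [NeZero N] [NeZero K]

lemma torusDist_endpoint_le (hM : 0 < M) (hK : M * K ≤ N) (hN : N ≤ M * K + M) (hn : 0 < n)
    (hnN : n ≤ N) (hQ : Q ∈ balanced M)
    (hl : ∀ a, (l.count a : ℝ) ≤ N / (M : ℝ) ^ 2 * Q a.1 a.2 ∧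
      N / (M : ℝ) ^ 2 * Q a.1 a.2 ≤ l.count a + C)
    {k : ℤ × ℤ} (hk : drift Q ∈ gridCell n k) {v w : TorusVertex N} (hv : v ∈ covered M K N)
    (hvw : cellOf n (w - v) = (k.1 % (n : ℤ), k.2 % (n : ℤ))) (y : Bou M) :
    (torusDist (gate N (homeBlock M K v + torusPoint K (displacement l)) y) w : ℝ) ≤
      4 * N / n + 2 * (n + 2 * (M * (Fintype.card (Bou M × Bou M) * C)) + 3 * M +
        2 * M * ‖drift Q‖) := by
  have hdisp := displacement_near_drift hQ hl
  have hdrift₁ := norm_fst_le (drift Q)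
  have hdrift₂ := norm_snd_le (drift Q)
  rw [Real.norm_eq_abs] at hdrift₁ hdrift₂
  obtain ⟨hα₁, hα₂⟩ := homeBlock_val hv
  obtain ⟨hcell₁, hcell₂⟩ := Prod.mk.inj hvw
  have hfst := cycleDist_endpoint_le hM hK hN hn hnN v.1 w.1 _ hα₁
    ((norm_fst_le _).trans hdisp) hk.1 hcell₁ y.offset_mem.1
  have hsnd := cycleDist_endpoint_le hM hK hN hn hnN v.2 w.2 _ hα₂
    ((norm_snd_le _).trans hdisp) hk.2 hcell₂ y.offset_mem.2
  have hmul₁ : 2 * M * |(drift Q).1| ≤ 2 * M * ‖drift Q‖ := by gcongr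
  have hmul₂ : 2 * M * |(drift Q).2| ≤ 2 * M * ‖drift Q‖ := by gcongr
  rw [torusDist, gate, blockPt, blockIdx_add, Nat.cast_add]
  refine (add_le_add hfst hsnd).trans ?_
  have hsplit : (4 : ℝ) * N / n = 2 * N / n + 2 * N / n := by ring
  linarith

lemma vol_tripExtra_le (hM : 0 < M) (hK : M * K ≤ N) (hN : N ≤ M * K + M) (hn : 0 < n)
    (hnN : n ≤ N) (hQ : Q ∈ balanced M) {y : Bou M} (hmis : mismatches y l ≤ C)
    (hl : ∀ a, (l.count a : ℝ) ≤ N / (M : ℝ) ^ 2 * Q a.1 a.2 ∧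
      N / (M : ℝ) ^ 2 * Q a.1 a.2 ≤ l.count a + C)
    {k : ℤ × ℤ} (hk : drift Q ∈ gridCell n k) {v w : TorusVertex N} (hv : v ∈ covered M K N)
    (hvw : cellOf n (w - v) = (k.1 % (n : ℤ), k.2 % (n : ℤ))) :
    vol (tripExtra y l K v w) ≤ ((4 * N / n + tripExcess n Q C : ℝ≥0) : ℝ≥0∞) := by
  set z := gate N (homeBlock M K v + torusPoint K (displacement l)) (lastEntrance y l)
  have hend : (torusDist z w : ℝ≥0) ≤ 4 * N / n +
      2 * (n + 2 * (M * (Fintype.card (Bou M × Bou M) * C)) + 3 * M + 2 * M * ‖drift Q‖₊) := by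
    exact_mod_cast torusDist_endpoint_le hM hK hN hn hnN hQ hl hk hv hvw _
  calc vol (tripExtra y l K v w)
      ≤ ((2 * M : ℕ) : ℝ≥0∞) + ((C * (2 * M) : ℕ) : ℝ≥0∞) + (torusDist z w : ℝ≥0∞) := by
        rw [tripExtra, vol_add, vol_add]
        gcongr
        · exact (vol_shortestFlow_le _ _).trans
            (by exact_mod_cast torusDist_gate_homeBlock_le hM hv y)
        · exact (vol_mismatchFlow_le _ _ _).trans
            (by exact_mod_cast Nat.mul_le_mul_right _ hmis)
        · exact vol_shortestFlow_le _ _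
    _ = ((torusDist z w + (2 * M + C * (2 * M)) : ℝ≥0) : ℝ≥0∞) := by
        push_cast
        ring
    _ ≤ _ := by
        rw [tripExcess, ← add_assoc (4 * N / n : ℝ≥0)]
        exact ENNReal.coe_le_coe.2 (add_le_add hend le_rfl)

lemma vol_mainPart_wrapFlow_le {ι : Type} {I : Finset ι}
    {W : TorusVertex N → TorusVertex N → ι → ℝ≥0∞} {l : ι → List (Bou M × Bou M)}
    {Q₀ : Transport M} (hK : M * K ≤ N) (hN : N ≤ M * K + M)
    (hmain : ∀ e, mainPart (K := K) I W l (fun α _ b => wrapFlow N α b) e ≤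
      ∑ a : Bou M × Bou M, (Q₀ a.1 a.2 : ℝ≥0∞) * ∑ α : Fin K × Fin K, wrapFlow N α a.2 e) :
    vol (mainPart (K := K) I W l fun α _ b => wrapFlow N α b) ≤
      (∑ a : Bou M × Bou M, (Q₀ a.1 a.2 : ℝ≥0∞)) * N :=
  calc _ ≤ ∑ e, ∑ a : Bou M × Bou M, (Q₀ a.1 a.2 : ℝ≥0∞) *
        ∑ α : Fin K × Fin K, wrapFlow N α a.2 e := Finset.sum_le_sum fun e _ => hmain e
    _ = ∑ a : Bou M × Bou M, (Q₀ a.1 a.2 : ℝ≥0∞) *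
        ∑ α : Fin K × Fin K, vol (wrapFlow N α a.2) := by
        simp only [vol, Finset.mul_sum]
        rw [Finset.sum_comm]
        simp only [Finset.sum_comm (s := (Finset.univ : Finset (TorusEdge N)))]
    _ ≤ _ := by
        rw [Finset.sum_mul]
        gcongr with a _
        exact sum_vol_wrapFlow_le hK hN a.2

/-- `h` completes the block flows to a global flow: whenever unit flows `g` between the gates of
the blocks are given, some flow `m`, of at most the flow that `Q₀` sends through `g` in all blocks,
makes `m + h` a standardized global flow. -/
def Completes (K : ℕ) (Q₀ : Transport M) (h : TorusEdge N → ℝ≥0∞) : Prop :=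
  ∀ g : Fin K × Fin K → Bou M → Bou M → TorusEdge N → ℝ≥0∞,
    (∀ α b₁ b₂, IsUnitFlow (torus N) (gate N α b₁) (gate N α b₂) (g α b₁ b₂)) →
    ∃ m, IsStdFlow N (m + h) ∧
      ∀ e, m e ≤ ∑ a : Bou M × Bou M, (Q₀ a.1 a.2 : ℝ≥0∞) * ∑ α, g α a.1 a.2 e

lemma exists_completes_of_itineraries (hM : 0 < M) (hK : M * K ≤ N) (hN : N ≤ M * K + M)
    (hn : 0 < n) (hnN : n ≤ N) {Q₀ : Transport M} {I : Finset (ℤ × ℤ)} {p : ℤ × ℤ → ℝ≥0}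
    {Q : ℤ × ℤ → Transport M} {ε : ℝ≥0∞} (hbal : ∀ k ∈ I, Q k ∈ balanced M)
    (hmix : ∀ b₁ b₂, ∑ k ∈ I, p k * Q k b₁ b₂ ≤ Q₀ b₁ b₂)
    (hcell : ∀ c, ∑ k ∈ I with (k.1 % (n : ℤ), k.2 % (n : ℤ)) = c, p k ≤ ((n : ℝ≥0) ^ 2)⁻¹)
    (htot : 1 ≤ ∑ k ∈ I, (p k : ℝ≥0∞) + ε) (hdrift : ∀ k ∈ I, drift (Q k) ∈ gridCell n k)
    {C : ℤ × ℤ → ℕ} {l : ℤ × ℤ → List (Bou M × Bou M)}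
    (hmis : ∀ k ∈ I, ∀ y, mismatches y (l k) ≤ C k)
    (hl : ∀ k ∈ I, ∀ a, ((l k).count a : ℝ) ≤ N / (M : ℝ) ^ 2 * Q k a.1 a.2 ∧
      N / (M : ℝ) ^ 2 * Q k a.1 a.2 ≤ (l k).count a + C k)
    {D : ℝ≥0} (hD : ∀ k ∈ I, tripExcess n (Q k) (C k) ≤ D) :
    ∃ h : TorusEdge N → ℝ≥0∞, Completes K Q₀ h ∧
      vol h ≤ (∑ a : Bou M × Bou M, (Q₀ a.1 a.2 : ℝ≥0∞)) * N +
        (N * ((4 * N / n + D : ℝ≥0) : ℝ≥0∞) +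
          (2 * n * N + ε * (N : ℝ≥0∞) ^ 2 + 2 * M * N)) := by
  let W := weight (N := N) M K n p
  let y : Bou M := (.left, ⟨0, hM⟩)
  have hshare := sum_share_le_one (N := N) hn hcell
  have hW := sum_weight_le_one (M := M) (K := K) hshare
  have hmain := mainPart_le (N := N) (K := K) (W := W) hM
    (fun k _ => sum_weight_le hn hnN p k)
    (fun k hk a => sq_mul_le_of_le_div_sq_mul hM (by exact_mod_cast (hl k hk a).1)) hmix
  refine ⟨_, fun g hg => ⟨mainPart I W l g, isStdFlow_parts hW y hg, hmain g⟩, ?_⟩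
  rw [vol_add]
  refine add_le_add (vol_mainPart_wrapFlow_le hK hN (hmain _)) (vol_restPart_le hW y ?_
    (sum_one_sub_weight_le hN hn hnN hshare htot))
  intro k hk v w hkvw
  refine (vol_tripExtra_le hM hK hN hn hnN (hbal k hk) (hmis k hk y) (hl k hk) (hdrift k hk)
    (mem_covered_of_weight_ne_zero hkvw) (cellOf_sub_of_weight_ne_zero hkvw)).trans ?_
  gcongr
  exact hD k hk

end GlobalFlow

lemma exists_completes {M : ℕ} (hM : 0 < M) {Q₀ : Transport M} (hQ₀ : Q₀ ∈ isotropic M)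
    {η : ℝ≥0} (hη : 0 < η) :
    ∃ N₀ : ℕ, ∀ (N K : ℕ) [NeZero N] [NeZero K], N₀ ≤ N → M * K ≤ N → N ≤ M * K + M →
      ∃ h : TorusEdge N → ℝ≥0∞, Completes K Q₀ h ∧ vol h ≤ η * (N : ℝ≥0∞) ^ 2 := by
  obtain ⟨t, ht₀, ht⟩ : ∃ t : ℝ≥0, 0 < t ∧ 3 * t = η :=
    ⟨η / 3, by positivity, mul_div_cancel₀ η (by norm_num)⟩
  obtain ⟨n, hn⟩ := exists_nat_gt (4 / t)
  have hn₀ : 0 < n := by exact_mod_cast zero_le.trans_lt hn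
  have hnt : 4 / (n : ℝ≥0) ≤ t := (div_le_comm₀ ht₀ (by exact_mod_cast hn₀)).1 hn.le
  obtain ⟨I, p, Q, hbal, hmix, hcell, htot, hdrift⟩ :=
    exists_discretization hQ₀ hn₀ (ε := t) (by exact_mod_cast ht₀)
  choose! C hC using fun k (hk : k ∈ I) => exists_itinerary (hbal k hk)
  let D := ∑ k ∈ I, tripExcess n (Q k) (C k)
  let S := ∑ a : Bou M × Bou M, Q₀ a.1 a.2
  obtain ⟨N₁, hN₁⟩ := exists_nat_ge ((S + D + 2 * n + 2 * M) / t)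
  refine ⟨max n N₁, fun N K _ _ hN hK hKN => ?_⟩
  have hlarge : S + D + 2 * n + 2 * M ≤ t * N := by
    rw [mul_comm t, ← div_le_iff₀ ht₀]
    exact hN₁.trans (by exact_mod_cast (le_max_right _ _).trans hN)
  choose! l hmis hcount using fun k (hk : k ∈ I) => hC k hk ((N : ℝ) / (M : ℝ) ^ 2) (by positivity)
  obtain ⟨h, hcompl, hvol⟩ := exists_completes_of_itineraries hM hK hKN hn₀
    ((le_max_left _ _).trans hN) hbal hmix hcell htot hdrift hmis hcount (D := D)
    fun k hk => Finset.single_le_sum (f := fun k => tripExcess n (Q k) (C k)) (by simp) hk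
  have hbound : S * N + (N * (4 * N / n + D) + (2 * n * N + t * (N : ℝ≥0) ^ 2 + 2 * M * N)) ≤
      η * (N : ℝ≥0) ^ 2 :=
    calc _ = 4 / n * N ^ 2 + t * N ^ 2 + (S + D + 2 * n + 2 * M) * N := by ring
      _ ≤ t * N ^ 2 + t * N ^ 2 + t * N * N := by gcongr
      _ = η * N ^ 2 := by
        rw [← ht]
        ring
  refine ⟨h, hcompl, hvol.trans ?_⟩
  rw [← ENNReal.ofNNReal_finsetSum]
  exact_mod_cast hbound

/-! ### Feasible flows of small expected cost -/

section Assembly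

lemma IsStdFlow.convexComb {N : ℕ} {a b : ℝ≥0∞} (hab : a + b = 1) {f g : TorusEdge N → ℝ≥0∞}
    (hf : IsStdFlow N f) (hg : IsStdFlow N g) : IsStdFlow N fun e => a * f e + b * g e := by
  have hsum := IsStdFlow.sum (J := Bool) (m := fun j => cond j a b) (f := fun j => cond j f g)
    (by simpa using hab) (by rintro (_ | _); exacts [hg, hf])
  simpa using hsum

/-- The loss per edge when a flow is made feasible: the remainder adds `η`, and diluting the flow
with a proportion `η / (B - 1/4)` of a flow which is at most `1/4` brings it back below `B`. -/
def flowError (B η : ℝ≥0) : ℝ≥0 := η / (B - 1 / 4) + η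

lemma dilution_le {B η : ℝ≥0} (hB : 1 / 4 < B) (hηB : η ≤ B - 1 / 4) :
    η / (B - 1 / 4) * (1 / 4) + (1 - η / (B - 1 / 4)) * (B + η) ≤ B := by
  have hgap : 0 < B - 1 / 4 := tsub_pos_of_lt hB
  set θ : ℝ≥0 := η / (B - 1 / 4)
  have hθ_le : θ ≤ 1 := div_le_one_of_le₀ hηB zero_le
  have hθ_mul : (θ : ℝ) * (B - 1 / 4) = η := by
    have hmul : θ * (B - 1 / 4) = η := div_mul_cancel₀ η hgap.ne'
    rw [← NNReal.coe_inj, NNReal.coe_mul, NNReal.coe_sub hB.le] at hmul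
    simpa using hmul
  have hθη : (0 : ℝ) ≤ θ * η := by positivity
  rw [← NNReal.coe_le_coe]
  push_cast [NNReal.coe_sub hθ_le]
  linarith

lemma exists_feasible_of_isStdFlow {N : ℕ} {B η : ℝ≥0} (hB : 1 / 4 < B) (hηB : η ≤ B - 1 / 4)
    {f m : TorusEdge N → ℝ≥0∞} (hf : IsStdFlow N f) (hfm : ∀ e, f e ≤ m e + η)
    (hm : ∀ e, m e ≤ B) : ∃ g ∈ feasible N B, ∀ e, g e ≤ m e + flowError B η := by
  obtain ⟨u, hu, hu_le⟩ := exists_isStdFlow_le_quarter N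
  set θ : ℝ≥0 := η / (B - 1 / 4) with hθ
  have hθ_le : θ ≤ 1 := div_le_one_of_le₀ hηB zero_le
  have hweights : (θ : ℝ≥0∞) + ((1 - θ : ℝ≥0) : ℝ≥0∞) = 1 := by
    rw [← ENNReal.coe_add, add_tsub_cancel_of_le hθ_le, ENNReal.coe_one]
  refine ⟨_, ⟨(hu.convexComb hweights hf).isStandardizedGlobalFlow, fun e => ?_⟩, fun e => ?_⟩
  · calc (θ : ℝ≥0∞) * u e + ((1 - θ : ℝ≥0) : ℝ≥0∞) * f e
        ≤ θ * ((1 / 4 : ℝ≥0) : ℝ≥0∞) + ((1 - θ : ℝ≥0) : ℝ≥0∞) * (B + η) := by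
          gcongr
          · exact (hu_le e).trans (by simp)
          · exact (hfm e).trans (by gcongr; exact hm e)
      _ = ((θ * (1 / 4) + (1 - θ) * (B + η) : ℝ≥0) : ℝ≥0∞) := by push_cast; ring
      _ ≤ B := ENNReal.coe_le_coe.2 (dilution_le hB hηB)
  · calc (θ : ℝ≥0∞) * u e + ((1 - θ : ℝ≥0) : ℝ≥0∞) * f e ≤ θ * 1 + 1 * (m e + η) := by
          gcongr
          · exact (hu_le e).trans (by rw [one_div]; exact ENNReal.inv_le_one.2 (by norm_num))
          · exact_mod_cast tsub_le_self
          · exact hfm e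
      _ = m e + flowError B η := by rw [flowError, ← hθ]; push_cast; ring

section Cost

variable {E : Type} [Fintype E]

lemma cost_mono {f f' : E → ℝ≥0∞} (h : ∀ e, f e ≤ f' e) (c : E → ℝ≥0) : cost f c ≤ cost f' c := by
  unfold cost
  gcongr with e _
  exact h e

lemma cost_add_const_le {f : E → ℝ≥0∞} {B δ : ℝ≥0∞} (hf : ∀ e, f e ≤ B) (c : E → ℝ≥0) :
    cost (fun e => f e + δ) c ≤ cost f c + (2 * B * δ + δ ^ 2) * ∑ e, (c e : ℝ≥0∞) := by
  unfold cost
  rw [Finset.mul_sum, ← Finset.sum_add_distrib]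
  refine Finset.sum_le_sum fun e _ => ?_
  calc (c e : ℝ≥0∞) * (f e + δ) ^ 2 = c e * f e ^ 2 + (2 * f e * δ + δ ^ 2) * c e := by ring
    _ ≤ c e * f e ^ 2 + (2 * B * δ + δ ^ 2) * c e := by gcongr; exact hf e

lemma cost_sum_mul_le {J : Type} [Fintype J] {w : J → ℝ≥0∞} (hw : ∑ j, w j = 1)
    (f : J → E → ℝ≥0∞) (c : E → ℝ≥0) :
    cost (fun e => ∑ j, w j * f j e) c ≤ ∑ j, w j * cost (f j) c := by
  have sq_le (e : E) : (∑ j, w j * f j e) ^ 2 ≤ ∑ j, w j * f j e ^ 2 := by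
    simpa only [ENNReal.rpow_two] using ENNReal.rpow_arith_mean_le_arith_mean_rpow Finset.univ w
      (fun j => f j e) hw (one_le_two (α := ℝ))
  calc cost (fun e => ∑ j, w j * f j e) c
      ≤ ∑ e, ∑ j, (c e : ℝ≥0∞) * (w j * f j e ^ 2) := by
        unfold cost
        simp only [← Finset.mul_sum]
        gcongr with e _
        exact sq_le e
    _ = ∑ j, w j * cost (f j) c := by
        rw [Finset.sum_comm]
        simp only [cost, Finset.mul_sum, mul_left_comm]

end Cost

variable {M N K : ℕ} (κ : Measure ℝ≥0) [IsProbabilityMeasure κ]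

lemma isProbabilityMeasure_torusEnvLaw (N : ℕ) : IsProbabilityMeasure (torusEnvLaw κ N) := by
  unfold torusEnvLaw
  infer_instance

lemma lintegral_sum_env : ∫⁻ c, ∑ e, (c e : ℝ≥0∞) ∂(torusEnvLaw κ N) =
    2 * (N : ℝ≥0∞) ^ 2 * ∫⁻ x, (x : ℝ≥0∞) ∂κ := by
  have hterm (e : TorusEdge N) : ∫⁻ c, (c e : ℝ≥0∞) ∂(torusEnvLaw κ N) = ∫⁻ x, (x : ℝ≥0∞) ∂κ :=
    (measurePreserving_eval (fun _ : TorusEdge N => κ) e).lintegral_comp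
      measurable_coe_nnreal_ennreal
  rw [lintegral_finsetSum _ fun e _ => (measurable_pi_apply e).coe_nnreal_ennreal]
  simp only [hterm, Finset.sum_const, nsmul_eq_mul, Finset.card_univ, Fintype.card_sum,
    Nat.cast_add, card_torusVertex]
  ring

lemma squareCost_ne_top {B : ℝ≥0} {Q : Transport M} {c₀ : SquareEdge M → ℝ≥0}
    (h₀ : squareCost M B Q c₀ ≠ ∞) (c : SquareEdge M → ℝ≥0) : squareCost M B Q c ≠ ∞ := by
  have hlt := lt_top_iff_ne_top.2 h₀
  simp only [squareCost, iInf_lt_iff] at hlt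
  obtain ⟨μ, hμ, -⟩ := hlt
  have hfin (e : SquareEdge M) : flo μ e ≠ ∞ := ((hμ.2.2 e).trans_lt ENNReal.coe_lt_top).ne
  exact ((iInf₂_le μ hμ).trans_lt (cost_lt_top hfin c)).ne

lemma exists_flo_cost_le_squareCost_add {B : ℝ≥0} {Q : Transport M} {c : SquareEdge M → ℝ≥0}
    (hfin : squareCost M B Q c ≠ ∞) {η : ℝ≥0} (hη : 0 < η) :
    ∃ μ : Measure (FinPath (square M)), IsFiniteMeasure μ ∧ (∀ v w, tra μ v w = Q.extend v w) ∧
      (∀ e, flo μ e ≤ B) ∧ cost (flo μ) c ≤ squareCost M B Q c + η := by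
  have hlt : squareCost M B Q c < squareCost M B Q c + η :=
    ENNReal.lt_add_right hfin (by exact_mod_cast hη.ne')
  conv_lhs at hlt => unfold squareCost
  simp only [iInf_lt_iff] at hlt
  obtain ⟨μ, ⟨hμ_fin, hμ_tra, hμ_flo⟩, hμ_cost⟩ := hlt
  exact ⟨μ, hμ_fin, hμ_tra, hμ_flo, hμ_cost.le⟩

variable [NeZero N]

lemma exists_isUnitFlow_gate_le_flo {Q : Transport M} (α : Fin K × Fin K)
    (μ : Measure (FinPath (square M))) [IsFiniteMeasure μ]
    (hQ : ∀ v w, tra μ v w = Q.extend v w) :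
    ∃ g : Bou M → Bou M → TorusEdge N → ℝ≥0∞,
      (∀ b₁ b₂, IsUnitFlow (torus N) (gate N α b₁) (gate N α b₂) (g b₁ b₂)) ∧
      ∀ e, ∑ a : Bou M × Bou M, (Q a.1 a.2 : ℝ≥0∞) * g a.1 a.2 e ≤
        pushFlow (contracted M) (blockEdge N (blockIdx α)) (flo μ) e := by
  classical
  obtain ⟨g, hg, hg_le⟩ := exists_isUnitFlow_of_measure (ι := (Sum.inr : Bou M → SquareVertex M))
    Sum.inr_injective μ
  simp only [hQ, Transport.extend] at hg hg_le
  let push := pushFlow (contracted M) (blockEdge N (blockIdx α))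
  refine ⟨fun b₁ b₂ => if Q b₁ b₂ = 0 then shortestFlow (gate N α b₁) (gate N α b₂)
    else push (g b₁ b₂), fun b₁ b₂ => ?_, fun e' => ?_⟩
  · beta_reduce
    split_ifs with hzero
    · exact isUnitFlow_shortestFlow _ _
    · exact (hg b₁ b₂ (by simpa using hzero)).toBlock (blockIdx α)
  · calc _ ≤ ∑ a : Bou M × Bou M, (Q a.1 a.2 : ℝ≥0∞) * push (g a.1 a.2) e' := by
          refine Finset.sum_le_sum fun a _ => ?_
          by_cases hzero : Q a.1 a.2 = 0 <;> simp [hzero]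
      _ ≤ push (flo μ) e' := by
          simp only [push, pushFlow, Finset.mul_sum]
          rw [Finset.sum_comm]
          refine Finset.sum_le_sum fun e _ => le_trans (le_of_eq ?_) (hg_le e)
          exact Fintype.sum_prod_type fun a : Bou M × Bou M => (Q a.1 a.2 : ℝ≥0∞) * g a.1 a.2 e

lemma exists_isStdFlow_cost_le (hK : M * K ≤ N) {B η : ℝ≥0} (hη : 0 < η)
    {Q₀ : Transport M} {c₀ : SquareEdge M → ℝ≥0} (h₀ : squareCost M B Q₀ c₀ ≠ ∞)
    {h : TorusEdge N → ℝ≥0∞} (hcompl : Completes K Q₀ h) (c : TorusEdge N → ℝ≥0) :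
    ∃ m b : TorusEdge N → ℝ≥0∞, IsStdFlow N (m + h) ∧ (∀ e, m e ≤ b e) ∧ (∀ e, b e ≤ B) ∧
      cost b c ≤ ∑ α : Fin K × Fin K, (squareCost M B Q₀ (blockEnv (blockIdx α) c) + η) := by
  choose μ hμ_fin hμ_tra hμ_flo hμ_cost using fun α : Fin K × Fin K =>
    exists_flo_cost_le_squareCost_add (squareCost_ne_top h₀ (blockEnv (blockIdx α) c)) hη
  choose g hg hg_le using fun α : Fin K × Fin K =>
    exists_isUnitFlow_gate_le_flo (N := N) α (μ α) (hμ_tra α)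
  obtain ⟨m, hm, hm_le⟩ := hcompl g hg
  refine ⟨m, blockSum N fun α => flo (μ α), hm, fun e => ?_,
    blockSum_le hK hμ_flo, (cost_blockSum_le hK _ c).trans ?_⟩
  · refine (hm_le e).trans ?_
    simp only [Finset.mul_sum]
    rw [Finset.sum_comm]
    exact Finset.sum_le_sum fun α _ => hg_le α e
  · exact Finset.sum_le_sum fun α _ => hμ_cost α

lemma cost_average_le (f : TorusVertex N → TorusEdge N → ℝ≥0∞) (c : TorusEdge N → ℝ≥0) :
    cost (average f) c ≤
      ((N : ℝ≥0∞) ^ 2)⁻¹ * ∑ τ, cost (f τ) fun e => c (edgeShift τ e) := by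
  have cost_shift (τ : TorusVertex N) :
      cost (fun e => f τ ((edgeShift τ).symm e)) c = cost (f τ) fun e => c (edgeShift τ e) := by
    unfold cost
    rw [← Equiv.sum_comp (edgeShift τ)]
    simp
  refine (cost_sum_mul_le sum_inv_card_torusVertex _ c).trans_eq ?_
  simp only [cost_shift, Finset.mul_sum]

lemma exists_feasible_cost_le (hK : M * K ≤ N) {B η : ℝ≥0} (hη : 0 < η)
    (hB : 1 / 4 < B) (hηB : η ≤ B - 1 / 4) {Q₀ : Transport M} {c₀ : SquareEdge M → ℝ≥0}
    (h₀ : squareCost M B Q₀ c₀ ≠ ∞) {h : TorusEdge N → ℝ≥0∞} (hcompl : Completes K Q₀ h)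
    (hvol : vol h ≤ η * (N : ℝ≥0∞) ^ 2) (c : TorusEdge N → ℝ≥0) :
    ∃ f ∈ feasible N B, cost f c ≤
      ((N : ℝ≥0∞) ^ 2)⁻¹ * ∑ τ : TorusVertex N, ∑ α : Fin K × Fin K,
        (squareCost M B Q₀ (blockEnv (blockIdx α) fun e => c (edgeShift τ e)) + η) +
      (2 * B * flowError B η + flowError B η ^ 2) * ∑ e, (c e : ℝ≥0∞) := by
  choose m b hm hmb hbB hb_cost using fun τ : TorusVertex N =>
    exists_isStdFlow_cost_le hK hη h₀ hcompl fun e => c (edgeShift τ e)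
  have hstd : IsStdFlow N (average m + average fun _ => h) :=
    average_add m _ ▸ IsStdFlow.average hm
  have hstd_le (e : TorusEdge N) : (average m + average fun _ => h) e ≤ average b e + η :=
    add_le_add (average_mono hmb e) (average_const_le ((sum_edgeShift_le_vol h e).trans hvol))
  obtain ⟨f, hf, hf_le⟩ := exists_feasible_of_isStdFlow hB hηB hstd hstd_le (average_le hbB)
  refine ⟨f, hf, ?_⟩
  calc cost f c ≤ cost (fun e => average b e + flowError B η) c := cost_mono hf_le c
    _ ≤ cost (average b) c +
        (2 * B * flowError B η + flowError B η ^ 2) * ∑ e, (c e : ℝ≥0∞) :=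
        cost_add_const_le (average_le hbB) c
    _ ≤ _ := by
        refine add_le_add ((cost_average_le b c).trans ?_) le_rfl
        gcongr with τ _
        exact hb_cost τ

lemma measurable_blockEnv_edgeShift (A : ℤ × ℤ) (τ : TorusVertex N) :
    Measurable fun c : TorusEdge N → ℝ≥0 => blockEnv (M := M) A fun e => c (edgeShift τ e) := by
  refine measurable_pi_lambda _ fun e => ?_
  unfold blockEnv
  split_ifs
  exacts [measurable_const, measurable_pi_apply _]

lemma measurable_squareCost_blockEnv (B : ℝ≥0) (Q : Transport M) (A : ℤ × ℤ) (τ : TorusVertex N) :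
    Measurable fun c : TorusEdge N → ℝ≥0 =>
      squareCost M B Q (blockEnv A fun e => c (edgeShift τ e)) :=
  (measurable_squareCost M B Q).comp (measurable_blockEnv_edgeShift A τ)

lemma lintegral_squareCost_blockEnv (hMN : M + 1 ≤ N) (B : ℝ≥0) (Q : Transport M) (A : ℤ × ℤ)
    (τ : TorusVertex N) :
    ∫⁻ c, squareCost M B Q (blockEnv A fun e => c (edgeShift τ e)) ∂(torusEnvLaw κ N) =
      ∫⁻ c, squareCost M B Q c ∂(squareEnvLaw κ M) := by
  rw [← map_blockEnv κ hMN A τ,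
    lintegral_map (measurable_squareCost M B Q) (measurable_blockEnv_edgeShift A τ)]

lemma lintegral_sum_squareCost_blockEnv (hMN : M + 1 ≤ N) (B : ℝ≥0) (η : ℝ≥0∞)
    (Q : Transport M) :
    ∫⁻ c, ∑ τ : TorusVertex N, ∑ α : Fin K × Fin K,
        (squareCost M B Q (blockEnv (blockIdx α) fun e => c (edgeShift τ e)) + η)
          ∂(torusEnvLaw κ N) =
      (N : ℝ≥0∞) ^ 2 * ((K : ℝ≥0∞) ^ 2 * (∫⁻ c, squareCost M B Q c ∂(squareEnvLaw κ M) + η)) := by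
  have := isProbabilityMeasure_torusEnvLaw κ N
  have hmeas (τ : TorusVertex N) (α : Fin K × Fin K) :=
    measurable_squareCost_blockEnv B Q (blockIdx α) τ
  have hterm (τ : TorusVertex N) (α : Fin K × Fin K) :
      ∫⁻ c, (squareCost M B Q (blockEnv (blockIdx α) fun e => c (edgeShift τ e)) + η)
        ∂(torusEnvLaw κ N) = ∫⁻ c, squareCost M B Q c ∂(squareEnvLaw κ M) + η := by
    rw [lintegral_add_right _ measurable_const, lintegral_squareCost_blockEnv κ hMN,
      lintegral_const, measure_univ, mul_one]
  rw [lintegral_finsetSum _ fun τ _ => by fun_prop]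
  simp_rw [lintegral_finsetSum Finset.univ fun α _ => (hmeas _ α).add_const η, hterm]
  simp only [Finset.sum_const, nsmul_eq_mul, Finset.card_univ, card_torusVertex]

lemma lintegral_cost_le (hMN : M + 1 ≤ N) {B : ℝ≥0} {η D : ℝ≥0∞} {Q₀ : Transport M}
    {f : (TorusEdge N → ℝ≥0) → TorusEdge N → ℝ≥0∞}
    (hf : ∀ c, cost (f c) c ≤ ((N : ℝ≥0∞) ^ 2)⁻¹ * ∑ τ : TorusVertex N, ∑ α : Fin K × Fin K,
        (squareCost M B Q₀ (blockEnv (blockIdx α) fun e => c (edgeShift τ e)) + η) +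
      D * ∑ e, (c e : ℝ≥0∞) + 1) :
    ∫⁻ c, cost (f c) c ∂(torusEnvLaw κ N) ≤
      (K : ℝ≥0∞) ^ 2 * (∫⁻ c, squareCost M B Q₀ c ∂(squareEnvLaw κ M) + η) +
      D * (2 * (N : ℝ≥0∞) ^ 2 * ∫⁻ x, (x : ℝ≥0∞) ∂κ) + 1 := by
  have := isProbabilityMeasure_torusEnvLaw κ N
  have hmeas (τ : TorusVertex N) (α : Fin K × Fin K) :=
    measurable_squareCost_blockEnv B Q₀ (blockIdx α) τ
  refine (lintegral_mono hf).trans_eq ?_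
  rw [lintegral_add_right _ measurable_const, lintegral_add_left (by fun_prop),
    lintegral_const_mul _ (by fun_prop), lintegral_const_mul _ (by fun_prop),
    lintegral_sum_squareCost_blockEnv κ hMN, lintegral_sum_env, ← mul_assoc,
    ENNReal.inv_mul_cancel (by simp [NeZero.ne N]) (by finiteness), one_mul, lintegral_const,
    measure_univ, mul_one]

end Assembly

/-! ### The limit of large tori -/

section Limit

variable {M : ℕ}

lemma isProbabilityMeasure_squareEnvLaw (κ : Measure ℝ≥0) [IsProbabilityMeasure κ] (M : ℕ) :
    IsProbabilityMeasure (squareEnvLaw κ M) := by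
  unfold squareEnvLaw
  have (e : SquareEdge M) : IsProbabilityMeasure (match e with
      | .inl _ => κ
      | .inr (.left, _) => κ
      | .inr (.bottom, _) => κ
      | .inr (.right, _) => Measure.dirac (0 : ℝ≥0)
      | .inr (.top, _) => Measure.dirac 0) := by
    rcases e with _ | ⟨_ | _ | _ | _, _⟩ <;> dsimp only <;> infer_instance
  infer_instance

lemma exists_squareCost_ne_top {κ : Measure ℝ≥0} [IsProbabilityMeasure κ] {B : ℝ≥0}
    {Q : Transport M} (hfin : ∫⁻ c, squareCost M B Q c ∂(squareEnvLaw κ M) ≠ ∞) :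
    ∃ c, squareCost M B Q c ≠ ∞ := by
  have := isProbabilityMeasure_squareEnvLaw κ M
  by_contra! htop
  exact hfin (by simp [htop])

/-- The excess of the expected cost per vertex over its local counterpart, when the cost-factors
have mean `m` and the remainder has volume at most `η * N ^ 2`. -/
def excess (B m η : ℝ≥0) : ℝ≥0 :=
  η + (2 * B * flowError B η + flowError B η ^ 2) * (2 * m) + η

lemma tendsto_excess (B m : ℝ≥0) :
    Tendsto (fun η => (excess B m η : ℝ≥0∞)) (nhdsWithin 0 (Set.Ioi 0)) (nhds 0) := by
  have hcont : Continuous (excess B m) := by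
    unfold excess flowError
    simp only [div_eq_mul_inv]
    fun_prop
  have hzero : (excess B m 0 : ℝ≥0∞) = 0 := by simp [excess, flowError]
  rw [← hzero]
  exact ((ENNReal.continuous_coe.comp hcont).tendsto 0).mono_left nhdsWithin_le_nhds

lemma natCast_sq_div_sq_le_inv {K N : ℕ} (hM : 0 < M) (hK : M * K ≤ N) :
    (K : ℝ≥0∞) ^ 2 / (N : ℝ≥0∞) ^ 2 ≤ ((M : ℝ≥0∞) ^ 2)⁻¹ := by
  refine ENNReal.div_le_of_le_mul ?_
  rw [mul_comm, ← div_eq_mul_inv, ENNReal.le_div_iff_mul_le (.inl (by simp [hM.ne']))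
    (.inl (by finiteness)), ← mul_pow, mul_comm]
  gcongr
  exact_mod_cast hK

lemma div_sq_le_div_sq_add {N K : ℕ} (hM : 0 < M) (hN : 0 < N) (hK : M * K ≤ N)
    {J η D m : ℝ≥0∞} (hNη : ((N : ℝ≥0∞) ^ 2)⁻¹ ≤ η) :
    ((K : ℝ≥0∞) ^ 2 * (J + η) + D * (2 * (N : ℝ≥0∞) ^ 2 * m) + 1) / (N : ℝ≥0∞) ^ 2 ≤
      J / (M : ℝ≥0∞) ^ 2 + (η + D * (2 * m) + η) := by
  have hKN := natCast_sq_div_sq_le_inv hM hK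
  have hM_inv : ((M : ℝ≥0∞) ^ 2)⁻¹ ≤ 1 := by
    rw [ENNReal.inv_le_one]
    exact_mod_cast Nat.one_le_pow _ _ hM
  calc _ = (K : ℝ≥0∞) ^ 2 / (N : ℝ≥0∞) ^ 2 * (J + η) +
        D * (2 * m) * ((N : ℝ≥0∞) ^ 2 * ((N : ℝ≥0∞) ^ 2)⁻¹) + ((N : ℝ≥0∞) ^ 2)⁻¹ := by
        simp only [div_eq_mul_inv]; ring
    _ ≤ ((M : ℝ≥0∞) ^ 2)⁻¹ * J + 1 * η + D * (2 * m) + η := by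
        rw [ENNReal.mul_inv_cancel (by simp [hN.ne']) (by finiteness), mul_one, mul_add]
        gcongr
        exact hKN.trans hM_inv
    _ = _ := by rw [div_eq_mul_inv]; ring

lemma tendsto_inv_natCast_sq : Tendsto (fun N : ℕ => ((N : ℝ≥0∞) ^ 2)⁻¹) atTop (nhds 0) := by
  simpa [ENNReal.inv_pow] using ENNReal.Tendsto.pow (n := 2) ENNReal.tendsto_inv_nat_nhds_zero

lemma eventually_lintegral_cost_le {κ : Measure ℝ≥0} [IsProbabilityMeasure κ]
    (hκ : ∫⁻ x, (x : ℝ≥0∞) ∂κ ≠ ∞) {B : ℝ≥0} (hB : 1 / 4 < B) (hM : 0 < M)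
    {f : (N : ℕ) → (TorusEdge N → ℝ≥0) → (TorusEdge N → ℝ≥0∞)}
    (hf : ∀ N c, ∀ g ∈ feasible N B, cost (f N c) c ≤ cost g c + 1)
    {Q₀ : Transport M} (hQ₀ : Q₀ ∈ isotropic M)
    (hfin : ∫⁻ c, squareCost M B Q₀ c ∂(squareEnvLaw κ M) ≠ ∞) {η : ℝ≥0} (hη : 0 < η)
    (hηB : η ≤ B - 1 / 4) :
    ∀ᶠ N : ℕ in atTop, (∫⁻ c, cost (f N c) c ∂(torusEnvLaw κ N)) / (N : ℝ≥0∞) ^ 2 ≤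
      (∫⁻ c, squareCost M B Q₀ c ∂(squareEnvLaw κ M)) / (M : ℝ≥0∞) ^ 2 +
        excess B (∫⁻ x, (x : ℝ≥0∞) ∂κ).toNNReal η := by
  obtain ⟨c₀, h₀⟩ := exists_squareCost_ne_top hfin
  obtain ⟨N₀, hN₀⟩ := exists_completes hM hQ₀ hη
  filter_upwards [eventually_ge_atTop N₀, eventually_ge_atTop (M + 1),
    tendsto_inv_natCast_sq.eventually_le_const (u := (η : ℝ≥0∞)) (by exact_mod_cast hη)]
    with N hN hMN hNη
  have : NeZero N := ⟨by omega⟩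
  have : NeZero (N / M) := ⟨(Nat.div_pos (by omega) hM).ne'⟩
  have hK : M * (N / M) ≤ N := Nat.mul_div_le N M
  obtain ⟨h, hcompl, hvol⟩ := hN₀ N (N / M) hN hK (Nat.lt_mul_div_succ N hM).le
  have hint := lintegral_cost_le κ hMN (f := f N) fun c => by
    obtain ⟨g, hg, hgc⟩ := exists_feasible_cost_le hK hη hB hηB h₀ hcompl hvol c
    exact (hf N c g hg).trans (by gcongr)
  refine (ENNReal.div_le_div_right hint _).trans
    ((div_sq_le_div_sq_add hM (by omega) hK hNη).trans_eq ?_)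
  simp only [excess]
  push_cast [ENNReal.coe_toNNReal hκ]
  rfl

lemma limsup_lintegral_cost_le {κ : Measure ℝ≥0} [IsProbabilityMeasure κ]
    (hκ : ∫⁻ x, (x : ℝ≥0∞) ∂κ ≠ ∞) {B : ℝ≥0} (hB : 1 / 4 < B) (hM : 0 < M)
    {f : (N : ℕ) → (TorusEdge N → ℝ≥0) → (TorusEdge N → ℝ≥0∞)}
    (hf : ∀ N c, ∀ g ∈ feasible N B, cost (f N c) c ≤ cost g c + 1) :
    limsup (fun N : ℕ => (∫⁻ c, cost (f N c) c ∂(torusEnvLaw κ N)) / (N : ℝ≥0∞) ^ 2) atTop ≤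
      localCost κ B M / (M : ℝ≥0∞) ^ 2 := by
  have hM_ne : ((M : ℝ≥0∞) ^ 2) ≠ 0 := by simp [hM.ne']
  have hM_ne_top : ((M : ℝ≥0∞) ^ 2) ≠ ∞ := by finiteness
  rw [ENNReal.le_div_iff_mul_le (.inl hM_ne) (.inl hM_ne_top)]
  refine le_iInf₂ fun Q₀ hQ₀ => ?_
  rw [← ENNReal.le_div_iff_mul_le (.inl hM_ne) (.inl hM_ne_top)]
  by_cases hfin : ∫⁻ c, squareCost M B Q₀ c ∂(squareEnvLaw κ M) = ∞
  · rw [hfin, ENNReal.top_div_of_ne_top hM_ne_top]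
    exact le_top
  have hlim := (tendsto_excess B (∫⁻ x, (x : ℝ≥0∞) ∂κ).toNNReal).const_add
    ((∫⁻ c, squareCost M B Q₀ c ∂(squareEnvLaw κ M)) / (M : ℝ≥0∞) ^ 2)
  rw [add_zero] at hlim
  refine ge_of_tendsto hlim ?_
  filter_upwards [Ioc_mem_nhdsGT (tsub_pos_of_lt hB)] with η hη
  exact limsup_le_of_le (by isBoundedDefault)
    (eventually_lintegral_cost_le hκ hB hM hf hQ₀ hfin hη.1 hη.2)

lemma lintegral_coe_ne_top_of_measure_Icc_eq_one {κ : Measure ℝ≥0} [IsProbabilityMeasure κ]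
    {C : ℝ≥0} (hκ : κ (Set.Icc 0 C) = 1) : ∫⁻ x, (x : ℝ≥0∞) ∂κ ≠ ∞ := by
  have hle : ∀ᵐ x : ℝ≥0 ∂κ, (x : ℝ≥0∞) ≤ C := by
    filter_upwards [(mem_ae_iff_prob_eq_one measurableSet_Icc).2 hκ] with x hx
    exact_mod_cast hx.2
  have hconst : ∫⁻ _, (C : ℝ≥0∞) ∂κ = C := by simp
  exact ne_top_of_le_ne_top ENNReal.coe_ne_top ((lintegral_mono_ae hle).trans_eq hconst)

end Limit

end

end RoutingFlow

theorem proposition17_general (B : ℝ≥0) (hB : 1 / 4 < B) :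
    ∃ f : (N : ℕ) → (RoutingFlow.TorusEdge N → ℝ≥0) → (RoutingFlow.TorusEdge N → ℝ≥0∞),
      (∀ N, Measurable (f N)) ∧
      (∀ N c, RoutingFlow.IsStandardizedGlobalFlow N (f N c)) ∧
      (∀ N c e, f N c e ≤ B) ∧
      ∀ (κ : Measure ℝ≥0) [IsProbabilityMeasure κ], ∫⁻ x, (x : ℝ≥0∞) ∂κ ≠ ∞ →
        ∀ M : ℕ, 1 ≤ M →
          limsup (fun N : ℕ =>
              (∫⁻ c, RoutingFlow.cost (f N c) c ∂(RoutingFlow.torusEnvLaw κ N)) / (N : ℝ≥0∞) ^ 2)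
            atTop ≤ RoutingFlow.localCost κ B M / (M : ℝ≥0∞) ^ 2 := by
  choose f hmeas hfeas hopt using
    fun N => RoutingFlow.exists_measurable_selection_feasible N hB.le
  exact ⟨f, hmeas, fun N c => (hfeas N c).1, fun N c => (hfeas N c).2,
    fun κ _ hκ M hM => RoutingFlow.limsup_lintegral_cost_le hκ hB hM hopt⟩

theorem proposition17 (κ : Measure ℝ≥0) [IsProbabilityMeasure κ]
    (cstar : ℝ≥0) (hcstar : 0 < cstar) (hκ : κ (Set.Icc 0 cstar) = 1)
    (B : ℝ≥0) (hB : 1 / 4 < B) :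
    ∃ f : (N : ℕ) → (RoutingFlow.TorusEdge N → ℝ≥0) → (RoutingFlow.TorusEdge N → ℝ≥0∞),
      (∀ N, Measurable (f N)) ∧
      (∀ N c, RoutingFlow.IsStandardizedGlobalFlow N (f N c)) ∧
      (∀ N c e, f N c e ≤ B) ∧
      ∀ M : ℕ, 1 ≤ M →
        limsup (fun N : ℕ =>
            (∫⁻ c, RoutingFlow.cost (f N c) c ∂(RoutingFlow.torusEnvLaw κ N)) / (N : ℝ≥0∞) ^ 2)
          atTop ≤ RoutingFlow.localCost κ B M / (M : ℝ≥0∞) ^ 2 := by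
  obtain ⟨f, hmeas, hstd, hcap, hlim⟩ := proposition17_general B hB
  exact ⟨f, hmeas, hstd, hcap, hlim κ (RoutingFlow.lintegral_coe_ne_top_of_measure_Icc_eq_one hκ)⟩
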